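/- Let $M$ be a compact connected complex manifold of complex dimension $n$ with a fixed Kähler form $\omega$. For a smooth function $\psi: M\to\mathbb{R}$ write $dd^c\psi=\sqrt{-1}\,\partial\bar\partial\psi$, and suppose that $\omega'=\omega+dd^c\psi$ is again a Kähler form. Let $d_\omega$ and $d_{\omega'}$ be the Riemannian distance functions of the Kähler metrics $\omega$ and $\omega'$, and for $0<\alpha\le 1$ let $\|\psi\|_{C^\alpha}=\sup_x|\psi(x)|+\sup_{x\ne y}\frac{|\psi(x)-\psi(y)|}{d_\omega(x,y)^\alpha}$. (1) For every $\alpha\in(0,1]$ and $K\ge 0$ there is a constant $C$, depending only on $(M,\omega)$, $\alpha$ and $K$, such that for every such $\psi$ with $\|\psi\|_{C^\alpha}\le K$, $$d_{\omega'}(x,y)\le C\, d_\omega(x,y)^{\alpha/2}\qquad\text{for all } x,y\in M.$$ (2) Without any further control on $\psi$: there are constants $C>0$ and $C'$, depending only on $(M,\omega)$, such that for every such $\psi$, $$\int_{M\times M}\exp\!\left(\frac{d_{\omega'}(x,y)}{C}\right)d\mu_x\,d\mu_y\le C',$$ where $d\mu=\omega^n$. -/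

import Mathlib

open MeasureTheory Set
open scoped Manifold ContDiff ENNReal NNReal

noncomputable section

namespace KahlerDist

/-- The model space `ℂⁿ`, regarded as a real vector space by restriction of scalars; its
`volume` is Lebesgue measure. -/
abbrev Model (n : ℕ) : Type := Fin n → ℂ

/-- Multiplication by `i` on `ℂⁿ`, as a real linear map. -/
def J (n : ℕ) : Model n →L[ℝ] Model n :=
  (Complex.I • ContinuousLinearMap.id ℂ (Model n)).restrictScalars ℝ

/-- Real `k`-forms on the vector space `ℂⁿ`. -/
abbrev Alt (n k : ℕ) : Type := Model n [⋀^Fin k]→L[ℝ] ℝ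

/-! ### Forms on open subsets of `ℂⁿ` -/

/-- `d^c f = (i/2) (∂̄ - ∂) f`, which for a real function `f` is the real 1-form
`v ↦ -(1/2) df (i v)`. -/
def dcLocal {n : ℕ} (f : Model n → ℝ) (z : Model n) : Alt n 1 :=
  ContinuousAlternatingMap.ofSubsingleton ℝ (Model n) ℝ (0 : Fin 1)
    (-(1 / 2 : ℝ) • (fderiv ℝ f z).comp (J n))

/-- `dd^c f = i ∂∂̄ f`: the exterior derivative of `d^c f`. -/
def ddcLocal {n : ℕ} (f : Model n → ℝ) (z : Model n) : Alt n 2 :=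
  extDeriv (dcLocal f) z

/-- The real basis `(e₁, i e₁, …, eₙ, i eₙ)` of `ℂⁿ`. -/
def stdFrame (n : ℕ) (p : Fin n × Fin 2) : Model n :=
  Pi.single p.1 (if p.2 = 0 then 1 else Complex.I)

/-- The value of the `2n`-form `η ∧ ⋯ ∧ η` (`n` factors) on `(e₁, i e₁, …, eₙ, i eₙ)`, that is
`2⁻ⁿ ∑_σ sgn σ ∏ⱼ η (b_{σ(j,0)}, b_{σ(j,1)})` for `b` this basis. As `(e₁, i e₁, …, eₙ, i eₙ)`
has unit volume and is positively oriented, this is the density of `ηⁿ` with respect to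
Lebesgue measure. -/
def topPower {n : ℕ} (η : Alt n 2) : ℝ :=
  (2 ^ n : ℝ)⁻¹ * ∑ σ : Equiv.Perm (Fin n × Fin 2), ((Equiv.Perm.sign σ : ℤ) : ℝ) *
    ∏ j : Fin n, η ![stdFrame n (σ (j, 0)), stdFrame n (σ (j, 1))]

/-! ### Forms on complex manifolds -/

section Manifold

variable {n : ℕ} {M : Type*} [TopologicalSpace M] [ChartedSpace (Model n) M]

variable (n M) in
/-- Real 2-forms on `M` (sections without any regularity). The tangent space at `x` is `ℂⁿ`,
through the preferred chart at `x`. -/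
abbrev TwoForm : Type _ := (x : M) → TangentSpace 𝓘(ℝ, Model n) x [⋀^Fin 2]→L[ℝ] ℝ

/-- The complex structure on the tangent spaces: multiplication by `i` in the preferred chart
(or in any chart, when the coordinate changes are holomorphic). -/
def tangentJ (x : M) :
    TangentSpace 𝓘(ℝ, Model n) x →L[ℝ] TangentSpace 𝓘(ℝ, Model n) x :=
  J n

/-- The expression of a 2-form in a chart `e`: its pullback by the inverse of `e`. -/
def TwoForm.inChart (η : TwoForm n M) (e : OpenPartialHomeomorph M (Model n)) (z : Model n) :
    Alt n 2 :=
  (η (e.symm z)).compContinuousLinearMap (mfderiv 𝓘(ℝ, Model n) 𝓘(ℝ, Model n) e.symm z)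

/-- Kähler forms: smooth closed positive real `(1,1)`-forms. -/
structure IsKahlerForm (η : TwoForm n M) : Prop where
  smooth : ∀ e ∈ atlas (Model n) M, ContDiffOn ℝ ∞ (η.inChart e) e.target
  closed : ∀ e ∈ atlas (Model n) M, ∀ z ∈ e.target, extDeriv (η.inChart e) z = 0
  type_one_one : ∀ (x : M) (u v : TangentSpace 𝓘(ℝ, Model n) x),
    η x ![tangentJ x u, tangentJ x v] = η x ![u, v]
  pos : ∀ (x : M) (u : TangentSpace 𝓘(ℝ, Model n) x), u ≠ 0 → 0 < η x ![u, tangentJ x u]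

/-- The 2-form `dd^c ψ = i ∂∂̄ψ` on `M`, computed at `x` in the preferred chart at `x`. -/
def ddc (ψ : M → ℝ) : TwoForm n M := fun x =>
  ddcLocal (ψ ∘ (chartAt (Model n) x).symm) (chartAt (Model n) x x)

/-- The distance `d_η` of the Riemannian metric `g (u, v) = η (u, J v)`: the infimum over `C¹`
paths from `x` to `y` of the length `∫ √(g (γ', γ'))`. -/
def distance (η : TwoForm n M) (x y : M) : ℝ≥0∞ :=
  letI : (p : M) → ENorm (TangentSpace 𝓘(ℝ, Model n) p) := fun p =>
    ⟨fun v => ENNReal.ofReal (Real.sqrt (η p ![v, tangentJ p v]))⟩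
  Manifold.riemannianEDist 𝓘(ℝ, Model n) x y

/-- The `C^α` norm `sup |ψ| + sup_{x, y} |ψ x - ψ y| / d_η (x, y) ^ α` of a function, with respect
to the metric of `η` (with `0 / 0 = 0` when `x = y`). -/
def holderNorm (η : TwoForm n M) (α : ℝ) (ψ : M → ℝ) : ℝ≥0∞ :=
  (⨆ x, ENNReal.ofReal |ψ x|) +
    ⨆ x, ⨆ y, ENNReal.ofReal |ψ x - ψ y| / distance η x y ^ α

/-- The measure `ηⁿ` on the domain of a chart `e`, extended by zero. -/
def chartMeasure [MeasurableSpace M] (η : TwoForm n M)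
    (e : OpenPartialHomeomorph M (Model n)) : Measure M :=
  ((volume.restrict e.target).withDensity
    fun z => ENNReal.ofReal (topPower (η.inChart e z))).map e.symm

/-- The measure `ηⁿ` on `M`. The measures `ηⁿ` on the domains of the charts agree on overlaps (for
holomorphic charts and `η` a Kähler form), so their supremum is the measure on `M` which
restricts to each of them. -/
def powerMeasure [MeasurableSpace M] (η : TwoForm n M) : Measure M :=
  ⨆ e ∈ atlas (Model n) M, chartMeasure η e

end Manifold

end KahlerDist

end

/-!
Both estimates rest on averaging the length of broken segments in a chart. Near a point of `M` the
metric `ω₀ + dd^c ψ` is dominated by the Levi form of the smooth plurisubharmonic function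
`φ = ψ + (A / 2) |z|²`. Two nearby points `x`, `y` of a chart are joined through any point `w` of a
small ball; averaging over `w` bounds the distance of `x` and `y`, times the volume of that ball, by
`meanLen φ ρ x 0 1 + meanLen φ ρ y 0 1`, where `meanLen` integrates the square root of the Levi form
over the segments issuing from a point (`distance_mul_volume_le`). There is no pointwise bound for
the Levi form; its averages suffice.

The square roots are controlled through the Lelong mass `t d/dt ∫_{|v| ≤ ρ} φ (x + t v) dv`. By
invariance of the ball under rotations `v ↦ exp (i θ) v`, its derivative is `t` times the integral
of the Levi form in radial directions (`hasDerivAt_lelong`). Hence it is nondecreasing in `t`, it is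
bounded by the growth of the means of `φ` (`lelong_le`), and by the inequality of arithmetic and
geometric means it bounds the part of `meanLen` with `t ∈ (2^{-k-1}, 2^{-k}]`
(`meanLen_dyadic_le`).

If `ψ` is Hölder of exponent `α`, these pieces decay geometrically and `meanLen` at scale `ρ` is
`O(ρ ^ (α / 2))` after division by the volume of the ball (`meanLen_le_of_holder`). Taking `ρ`
comparable with `|x - y|` gives the Hölder estimate in charts, and compactness and connectedness of
`M` make it global (`exists_distance_le_rpow`).

Without a Hölder bound, normalise `ψ` to have maximum `0`. The sub-mean value inequality, propagated
along chains of neighbourhoods, bounds `ψ` in `L¹` (`exists_lintegral_neg_le`), so that all Lelong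
masses at a fixed scale are bounded by a constant. Then the part of `meanLen` with `t > 2^{-k}` is
at most linear in `k`, while the integral over `x` of the part with `t ≤ 2^{-k}` is `O(2^{-k})`. So
the super-level sets of `meanLen` have exponentially small measure, and `exp (c meanLen)` is
integrable (`exists_lintegral_eexp_meanLen_le`). This is a local exponential integrability of the
distance, which again propagates along chains, now by averaging over the middle point of a broken
path (`exists_lintegral_eexp_le_of_connected`).

The measure `ωⁿ` enters only through an upper bound by a multiple of a finite measure which is
locally comparable with Lebesgue measure (`exists_reference_measure`).
-/


namespace KahlerDist

open Metric Filter Topology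

/-! ### Differentiation under the integral and rotation invariance -/

lemma hasDerivAt_setIntegral_of_continuous {E : Type*} [TopologicalSpace E] [T2Space E]
    [MeasurableSpace E] [BorelSpace E] {μ : Measure E} [IsFiniteMeasureOnCompacts μ]
    {K : Set E} (hK : IsCompact K) {F F' : ℝ → E → ℝ}
    (hF : ∀ t, Continuous (F t)) (hF' : Continuous (fun p : ℝ × E => F' p.1 p.2))
    (h : ∀ t v, HasDerivAt (fun s => F s v) (F' t v) t) (t₀ : ℝ) :
    HasDerivAt (fun t => ∫ v in K, F t v ∂μ) (∫ v in K, F' t₀ v ∂μ) t₀ := by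
  have hc : IsCompact (closedBall t₀ 1 ×ˢ K) := (isCompact_closedBall t₀ 1).prod hK
  obtain ⟨C, hC⟩ := hc.exists_bound_of_continuousOn hF'.continuousOn
  have hfin : IsFiniteMeasure (μ.restrict K) :=
    ⟨by simpa using hK.measure_lt_top⟩
  have hmeas : ∀ G : E → ℝ, Continuous G → AEStronglyMeasurable G (μ.restrict K) := fun G hG =>
    hG.continuousOn.aestronglyMeasurable_of_isCompact hK hK.measurableSet
  refine (hasDerivAt_integral_of_dominated_loc_of_deriv_le (bound := fun _ => C)
    (closedBall_mem_nhds t₀ one_pos) (Eventually.of_forall fun t => hmeas _ (hF t)) ?_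
    (hmeas _ (by fun_prop)) ?_ (integrable_const _) ?_).2
  · exact (hF t₀).continuousOn.integrableOn_compact hK
  · refine (ae_restrict_iff' hK.measurableSet).2 (Eventually.of_forall fun v hv t ht => ?_)
    exact hC (t, v) ⟨ht, hv⟩
  · exact Eventually.of_forall fun v t _ => h t v

lemma continuous_setIntegral_of_continuous {E : Type*} [TopologicalSpace E] [T2Space E]
    [MeasurableSpace E] [BorelSpace E] {μ : Measure E} [IsLocallyFiniteMeasure μ]
    {K : Set E} (hK : IsCompact K) {F : ℝ → E → ℝ}
    (hF : Continuous (fun p : ℝ × E => F p.1 p.2)) :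
    Continuous (fun t => ∫ v in K, F t v ∂μ) := by
  exact continuous_parametric_integral_of_continuous hF hK

variable {n : ℕ}

lemma J_apply (v : Model n) : J n v = Complex.I • v := rfl

lemma J_J (v : Model n) : J n (J n v) = -v := by
  simp [J_apply, smul_smul]

/-- Multiplication by `exp (iθ)` preserves Lebesgue measure on `ℂⁿ`. -/
lemma measurePreserving_smul_exp (θ : ℝ) :
    MeasurePreserving (fun v : Model n => Complex.exp (θ * Complex.I) • v) volume volume := by
  have h := volume_preserving_pi (ι := Fin n) (f := fun _ => (rotation (Circle.exp θ) : ℂ → ℂ))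
    (fun _ => (rotation (Circle.exp θ)).measurePreserving)
  have e : (fun v : Model n => Complex.exp (θ * Complex.I) • v) =
      fun a i => rotation (Circle.exp θ) (a i) := by
    funext v i
    simp [rotation_apply, Circle.coe_exp]
  rw [e]
  exact h

lemma setIntegral_smul_exp (k : Model n → ℝ) (ρ θ : ℝ) :
    ∫ w in closedBall (0 : Model n) ρ, k (Complex.exp (θ * Complex.I) • w) =
      ∫ w in closedBall (0 : Model n) ρ, k w := by
  have hne : Complex.exp (θ * Complex.I) ≠ 0 := Complex.exp_ne_zero _
  have h := (measurePreserving_smul_exp (n := n) θ).setIntegral_preimage_emb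
    (Homeomorph.smulOfNeZero _ hne).measurableEmbedding k (closedBall 0 ρ)
  rw [← h]
  congr 2
  ext w
  simp [norm_smul, Complex.norm_exp_ofReal_mul_I]

/-- The rotational derivative of a function has mean zero over balls centred at the origin. -/
lemma setIntegral_fderiv_J_eq_zero {k : Model n → ℝ} (hk : ContDiff ℝ 1 k) (ρ : ℝ) :
    ∫ w in closedBall (0 : Model n) ρ, fderiv ℝ k w (J n w) = 0 := by
  have hd : ∀ (t : ℝ) (w : Model n), HasDerivAt
      (fun s : ℝ => k (Complex.exp (s * Complex.I) • w))
      (fderiv ℝ k (Complex.exp (t * Complex.I) • w) (J n (Complex.exp (t * Complex.I) • w))) t := by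
    intro t w
    have h1 : HasDerivAt (fun s : ℝ => Complex.exp (s * Complex.I))
        (Complex.exp (t * Complex.I) * Complex.I) t := by
      have := ((Complex.ofRealCLM.hasDerivAt (x := t)).mul_const Complex.I).cexp
      simpa using this
    have h2 := h1.smul_const w
    have h3 := ((hk.differentiable one_ne_zero
      (Complex.exp (t * Complex.I) • w)).hasFDerivAt).comp_hasDerivAt t h2
    rw [J_apply, smul_smul, mul_comm Complex.I]
    exact h3
  have h := hasDerivAt_setIntegral_of_continuous
    (μ := (volume : Measure (Model n))) (isCompact_closedBall (0 : Model n) ρ)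
    (F := fun s w => k (Complex.exp (s * Complex.I) • w))
    (F' := fun t w =>
      fderiv ℝ k (Complex.exp (t * Complex.I) • w) (J n (Complex.exp (t * Complex.I) • w)))
    (fun t => hk.continuous.comp (continuous_const_smul _))
    (by
      have : Continuous fun p : ℝ × Model n => Complex.exp (p.1 * Complex.I) • p.2 := by fun_prop
      exact ((hk.continuous_fderiv one_ne_zero).comp this).clm_apply ((J n).continuous.comp this))
    hd 0
  have h' := h.unique ((hasDerivAt_const (0 : ℝ) (∫ w in closedBall (0 : Model n) ρ, k w)).congr_of_eventuallyEq
    (Eventually.of_forall fun t => setIntegral_smul_exp k ρ t))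
  simpa using h'

/-! ### The Levi form and means over balls -/

/-- The second derivative of `φ` at `z`, evaluated at `u`, `v`. -/
noncomputable def hess (φ : Model n → ℝ) (z u v : Model n) : ℝ := fderiv ℝ (fderiv ℝ φ) z u v

/-- The Levi form of `φ` at `z` on `v`: the Laplacian at `0` of `ζ ↦ φ (z + ζ v)`, which is
`2 dd^c φ (v, i v)`. -/
noncomputable def levi (φ : Model n → ℝ) (z v : Model n) : ℝ :=
  hess φ z v v + hess φ z (J n v) (J n v)

section

variable {φ : Model n → ℝ}

lemma continuous_hess (hφ : ContDiff ℝ 2 φ) :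
    Continuous fun p : Model n × Model n × Model n => hess φ p.1 p.2.1 p.2.2 := by
  have h1 : ContDiff ℝ 1 (fderiv ℝ φ) := hφ.fderiv_right (by norm_num)
  have h2 : Continuous (fderiv ℝ (fderiv ℝ φ)) := h1.continuous_fderiv one_ne_zero
  unfold hess
  fun_prop

lemma continuous_levi (hφ : ContDiff ℝ 2 φ) :
    Continuous fun p : Model n × Model n => levi φ p.1 p.2 := by
  have h := continuous_hess hφ
  have h1 : Continuous fun p : Model n × Model n => hess φ p.1 p.2 p.2 :=
    h.comp (continuous_fst.prodMk (continuous_snd.prodMk continuous_snd))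
  have h2 : Continuous fun p : Model n × Model n => hess φ p.1 (J n p.2) (J n p.2) :=
    h.comp (continuous_fst.prodMk (((J n).continuous.comp continuous_snd).prodMk
      ((J n).continuous.comp continuous_snd)))
  exact h1.add h2

variable (φ) in
/-- The integral of `v ↦ φ (x + tv)` over the ball of radius `ρ`: up to the factor `t ^ (2n)`, the
integral of `φ` over the ball of radius `tρ` about `x`. -/
noncomputable def ballInt (ρ : ℝ) (x : Model n) (t : ℝ) : ℝ :=
  ∫ v in closedBall (0 : Model n) ρ, φ (x + t • v)

variable (φ) in
/-- The Lelong mass `t d/dt (ballInt φ ρ x t)`. -/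
noncomputable def lelong (ρ : ℝ) (x : Model n) (t : ℝ) : ℝ :=
  t * ∫ v in closedBall (0 : Model n) ρ, fderiv ℝ φ (x + t • v) v

variable (φ) in
/-- The integral over `v` in the ball of radius `ρ` of the Levi form of `φ` at `x + tv` in the
radial direction `v`. -/
noncomputable def leviInt (ρ : ℝ) (x : Model n) (t : ℝ) : ℝ :=
  ∫ v in closedBall (0 : Model n) ρ, levi φ (x + t • v) v

lemma continuous_leviInt (hφ : ContDiff ℝ 2 φ) (ρ : ℝ) (x : Model n) :
    Continuous (leviInt φ ρ x) := by
  refine continuous_setIntegral_of_continuous (isCompact_closedBall (0 : Model n) ρ) ?_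
  have : Continuous fun p : ℝ × Model n => (x + p.1 • p.2, p.2) := by fun_prop
  exact (continuous_levi hφ).comp this

lemma hasDerivAt_comp_line (hφ : ContDiff ℝ 2 φ) (x v : Model n) (t : ℝ) :
    HasDerivAt (fun s : ℝ => φ (x + s • v)) (fderiv ℝ φ (x + t • v) v) t := by
  have h2 : HasDerivAt (fun s : ℝ => x + s • v) v t := by
    simpa using ((hasDerivAt_id t).smul_const v).const_add x
  exact ((hφ.differentiable two_ne_zero (x + t • v)).hasFDerivAt).comp_hasDerivAt t h2

lemma hasDerivAt_fderiv_comp_line (hφ : ContDiff ℝ 2 φ) (x v : Model n) (t : ℝ) :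
    HasDerivAt (fun s : ℝ => fderiv ℝ φ (x + s • v) v) (hess φ (x + t • v) v v) t := by
  have h1 : ContDiff ℝ 1 (fderiv ℝ φ) := hφ.fderiv_right (by norm_num)
  have h2 : HasDerivAt (fun s : ℝ => x + s • v) v t := by
    simpa using ((hasDerivAt_id t).smul_const v).const_add x
  have h3 := ((h1.differentiable one_ne_zero (x + t • v)).hasFDerivAt).comp_hasDerivAt t h2
  exact h3.clm_apply (hasDerivAt_const t v) |>.congr_deriv (by simp [hess])

lemma hasDerivAt_ballInt (hφ : ContDiff ℝ 2 φ) (ρ : ℝ) (x : Model n) (t : ℝ) :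
    HasDerivAt (ballInt φ ρ x)
      (∫ v in closedBall (0 : Model n) ρ, fderiv ℝ φ (x + t • v) v) t := by
  have hc : Continuous (fderiv ℝ φ) := hφ.continuous_fderiv two_ne_zero
  have hc' := hφ.continuous
  exact hasDerivAt_setIntegral_of_continuous (isCompact_closedBall (0 : Model n) ρ)
    (F := fun s v => φ (x + s • v)) (F' := fun s v => fderiv ℝ φ (x + s • v) v)
    (fun t => by fun_prop) (by fun_prop) (fun t v => hasDerivAt_comp_line hφ x v t) t

lemma integrable_of_continuous {K : Set (Model n)} (hK : IsCompact K) {G : Model n → ℝ}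
    (hG : Continuous G) : Integrable G (volume.restrict K) :=
  hG.continuousOn.integrableOn_compact hK

/-- The derivative of the Lelong mass is `t` times the integral of the Levi form in the radial
directions: the second derivatives in the directions `i v`, which the Levi form has in addition to
the radial ones, are recovered by an integration by parts along the rotations `v ↦ exp (iθ) v`. -/
lemma hasDerivAt_lelong (hφ : ContDiff ℝ 2 φ) (ρ : ℝ) (x : Model n) (t : ℝ) :
    HasDerivAt (lelong φ ρ x) (t * leviInt φ ρ x t) t := by
  set K := closedBall (0 : Model n) ρ with hKdef
  have hK : IsCompact K := isCompact_closedBall (0 : Model n) ρ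
  have h1 : ContDiff ℝ 1 (fderiv ℝ φ) := hφ.fderiv_right (by norm_num)
  have hc : Continuous (fderiv ℝ φ) := h1.continuous
  have hh := continuous_hess hφ
  have hp : HasDerivAt (fun s => ∫ v in K, fderiv ℝ φ (x + s • v) v)
      (∫ v in K, hess φ (x + t • v) v v) t := by
    refine hasDerivAt_setIntegral_of_continuous hK (F := fun s v => fderiv ℝ φ (x + s • v) v)
      (F' := fun s v => hess φ (x + s • v) v v) (fun t => by fun_prop) ?_
      (fun t v => hasDerivAt_fderiv_comp_line hφ x v t) t
    exact hh.comp (f := fun p : ℝ × Model n => (x + p.1 • p.2, p.2, p.2)) (by fun_prop)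
  -- the angular derivative of `w ↦ Dφ (x + t w) (i w)` integrates to zero
  have hrot : ∫ v in K, (t * hess φ (x + t • v) (J n v) (J n v) - fderiv ℝ φ (x + t • v) v)
      = 0 := by
    have hk : ContDiff ℝ 1 fun w => fderiv ℝ φ (x + t • w) (J n w) := by
      have : ContDiff ℝ 1 fun w : Model n => x + t • w := by fun_prop
      exact (h1.comp this).clm_apply (J n).contDiff
    rw [← setIntegral_fderiv_J_eq_zero hk ρ]
    refine integral_congr_ae (Eventually.of_forall fun w => ?_)
    have e1 : HasFDerivAt (fun w : Model n => x + t • w)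
        (t • ContinuousLinearMap.id ℝ (Model n)) w :=
      ((hasFDerivAt_id w).const_smul t).const_add x
    have e2 := ((h1.differentiable one_ne_zero (x + t • w)).hasFDerivAt).comp w e1
    have e3 := e2.clm_apply ((J n).hasFDerivAt (x := w))
    have e4 := e3.fderiv
    simp only [Function.comp_def] at e4
    simp only [e4]
    simp [hess, J_J]
    ring
  have i1 : Integrable (fun v => hess φ (x + t • v) v v) (volume.restrict K) :=
    integrable_of_continuous hK
      (hh.comp (f := fun v : Model n => (x + t • v, v, v)) (by fun_prop))
  have i2 : Integrable (fun v => hess φ (x + t • v) (J n v) (J n v)) (volume.restrict K) :=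
    integrable_of_continuous hK
      (hh.comp (f := fun v : Model n => (x + t • v, J n v, J n v))
        (by have := (J n).continuous; fun_prop))
  have i3 : Integrable (fun v => fderiv ℝ φ (x + t • v) v) (volume.restrict K) :=
    integrable_of_continuous hK (by fun_prop)
  rw [integral_sub (i2.const_mul t) i3, integral_const_mul, sub_eq_zero] at hrot
  have h := (hasDerivAt_id t).mul hp
  refine h.congr_deriv ?_
  simp only [leviInt, levi, id]
  rw [integral_add i1 i2, mul_add, hrot]
  ring

lemma lelong_zero (ρ : ℝ) (x : Model n) : lelong φ ρ x 0 = 0 := by simp [lelong]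

variable {ρ T : ℝ} {x : Model n}

lemma leviInt_nonneg {t : ℝ}
    (hpos : ∀ v ∈ closedBall (0 : Model n) ρ, 0 ≤ levi φ (x + t • v) v) :
    0 ≤ leviInt φ ρ x t :=
  setIntegral_nonneg measurableSet_closedBall hpos

/-- Lelong masses are nondecreasing in the radius. -/
lemma monotoneOn_lelong (hφ : ContDiff ℝ 2 φ)
    (hpos : ∀ t ∈ Icc 0 T, ∀ v ∈ closedBall (0 : Model n) ρ, 0 ≤ levi φ (x + t • v) v) :
    MonotoneOn (lelong φ ρ x) (Icc 0 T) := by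
  have hd := hasDerivAt_lelong hφ ρ x
  refine monotoneOn_of_deriv_nonneg (convex_Icc 0 T)
    (fun t _ => (hd t).continuousAt.continuousWithinAt)
    (fun t _ => (hd t).differentiableAt.differentiableWithinAt) fun t ht => ?_
  rw [interior_Icc] at ht
  rw [(hd t).deriv]
  exact mul_nonneg ht.1.le (leviInt_nonneg (hpos t ⟨ht.1.le, ht.2.le⟩))

lemma lelong_nonneg (hφ : ContDiff ℝ 2 φ)
    (hpos : ∀ t ∈ Icc 0 T, ∀ v ∈ closedBall (0 : Model n) ρ, 0 ≤ levi φ (x + t • v) v)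
    {t : ℝ} (ht : t ∈ Icc 0 T) : 0 ≤ lelong φ ρ x t := by
  have := monotoneOn_lelong hφ hpos ⟨le_rfl, ht.1.trans ht.2⟩ ht ht.1
  rwa [lelong_zero] at this

/-- The Lelong mass at scale `t` is controlled by the growth of the means between `t` and `2t`. -/
lemma lelong_le (hφ : ContDiff ℝ 2 φ)
    (hpos : ∀ t ∈ Icc 0 T, ∀ v ∈ closedBall (0 : Model n) ρ, 0 ≤ levi φ (x + t • v) v)
    {t : ℝ} (ht : 0 < t) (htT : 2 * t ≤ T) :
    lelong φ ρ x t ≤ 2 * (ballInt φ ρ x (2 * t) - ballInt φ ρ x t) := by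
  have hd := hasDerivAt_ballInt hφ ρ x
  -- mean value theorem on `[t, 2t]`, where the Lelong mass is at least its value at `t`
  obtain ⟨c, hc, hce⟩ := exists_hasDerivAt_eq_slope (ballInt φ ρ x) _ (show t < 2 * t by linarith)
    (fun t _ => (hd t).continuousAt.continuousWithinAt) (fun t _ => hd t)
  have hc0 : 0 < c := ht.trans hc.1
  have h1 : lelong φ ρ x t ≤ lelong φ ρ x c :=
    monotoneOn_lelong hφ hpos ⟨ht.le, by linarith⟩ ⟨hc0.le, by linarith [hc.2]⟩ hc.1.le
  have h0 : 0 ≤ lelong φ ρ x c := lelong_nonneg hφ hpos ⟨hc0.le, by linarith [hc.2]⟩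
  have h2 : lelong φ ρ x c = c / t * (ballInt φ ρ x (2 * t) - ballInt φ ρ x t) := by
    rw [lelong, hce]; field_simp; ring
  have h3 : c / t ≤ 2 := by rw [div_le_iff₀ ht]; exact hc.2.le
  have h4 : 0 < c / t := by positivity
  have h5 : 0 ≤ ballInt φ ρ x (2 * t) - ballInt φ ρ x t := by
    rw [h2] at h0; exact nonneg_of_mul_nonneg_right h0 h4
  rw [h2] at h1
  exact h1.trans (mul_le_mul_of_nonneg_right h3 h5)

/-- Sub-mean value property. -/
lemma ballInt_mono (hφ : ContDiff ℝ 2 φ)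
    (hpos : ∀ t ∈ Icc 0 T, ∀ v ∈ closedBall (0 : Model n) ρ, 0 ≤ levi φ (x + t • v) v)
    {t : ℝ} (ht : t ∈ Icc 0 T) : ballInt φ ρ x 0 ≤ ballInt φ ρ x t := by
  have hd := hasDerivAt_ballInt hφ ρ x
  refine monotoneOn_of_deriv_nonneg (convex_Icc 0 T)
    (fun t _ => (hd t).continuousAt.continuousWithinAt)
    (fun t _ => (hd t).differentiableAt.differentiableWithinAt) (fun t ht => ?_)
    ⟨le_rfl, ht.1.trans ht.2⟩ ht ht.1
  rw [interior_Icc] at ht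
  rw [(hd t).deriv]
  have := lelong_nonneg hφ hpos ⟨ht.1.le, ht.2.le⟩
  exact nonneg_of_mul_nonneg_right this ht.1

lemma integral_mul_leviInt (hφ : ContDiff ℝ 2 φ) (ρ : ℝ) (x : Model n) (a b : ℝ) :
    ∫ t in a..b, t * leviInt φ ρ x t = lelong φ ρ x b - lelong φ ρ x a :=
  intervalIntegral.integral_eq_sub_of_hasDerivAt (fun t _ => hasDerivAt_lelong hφ ρ x t)
    ((continuous_id.mul (continuous_leviInt hφ ρ x)).intervalIntegrable a b)

end

variable {n : ℕ}

/-! ### Mean lengths of radial segments -/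

/-- The integral over `v` in the ball of radius `ρ` of the length of the part `a < t ≤ b` of the
segment `t ↦ x + tv`, measured by the square root of the Levi form of `φ`. -/
noncomputable def meanLen (φ : Model n → ℝ) (ρ : ℝ) (x : Model n) (a b : ℝ) : ℝ≥0∞ :=
  ∫⁻ t in Ioc a b, ∫⁻ v in closedBall (0 : Model n) ρ, ENNReal.ofReal (√(levi φ (x + t • v) v))

lemma sqrt_le_of_pos {L l : ℝ} (hL : 0 ≤ L) (hl : 0 < l) : √L ≤ (l * L + 1 / l) / 2 := by
  have h : √L * √L = L := Real.mul_self_sqrt hL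
  have h2 : (l * L + 1 / l) / 2 - √L = (l * √L - 1) ^ 2 / (2 * l) := by
    field_simp
    nlinarith
  have : 0 ≤ (l * √L - 1) ^ 2 / (2 * l) := by positivity
  linarith

section

variable {φ : Model n → ℝ} {ρ T : ℝ} {x : Model n}

lemma volume_closedBall_ne_top (x : Model n) (ρ : ℝ) : volume (closedBall x ρ) ≠ ⊤ :=
  (isCompact_closedBall x ρ).measure_lt_top.ne

lemma continuous_levi_ray (hφ : ContDiff ℝ 2 φ) (x : Model n) (t : ℝ) :
    Continuous fun v => levi φ (x + t • v) v :=
  (continuous_levi hφ).comp (f := fun v : Model n => (x + t • v, v)) (by fun_prop)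

lemma lintegral_levi_eq (hφ : ContDiff ℝ 2 φ) {t : ℝ}
    (hpos : ∀ v ∈ closedBall (0 : Model n) ρ, 0 ≤ levi φ (x + t • v) v) :
    ∫⁻ v in closedBall (0 : Model n) ρ, ENNReal.ofReal (levi φ (x + t • v) v) =
      ENNReal.ofReal (leviInt φ ρ x t) := by
  rw [leviInt, ofReal_integral_eq_lintegral_ofReal
    (integrable_of_continuous (isCompact_closedBall _ _) (continuous_levi_ray hφ x t))]
  exact (ae_restrict_iff' measurableSet_closedBall).2 (Eventually.of_forall hpos)

/-- On a dyadic annulus the mean length is bounded, through the inequality of the arithmetic and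
geometric means with a free weight `s`, by the Lelong mass. -/
lemma meanLen_dyadic_le (hφ : ContDiff ℝ 2 φ)
    (hpos : ∀ t ∈ Icc 0 T, ∀ v ∈ closedBall (0 : Model n) ρ, 0 ≤ levi φ (x + t • v) v)
    {a s : ℝ} (ha : 0 < a) (haT : 2 * a ≤ T) (hs : 0 < s) :
    meanLen φ ρ x a (2 * a) ≤ ENNReal.ofReal
      ((s * lelong φ ρ x (2 * a) + volume.real (closedBall (0 : Model n) ρ) / s) / 2) := by
  set K := closedBall (0 : Model n) ρ with hKdef
  have hK : IsCompact K := isCompact_closedBall _ _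
  set β := volume.real K with hβ
  have hβ0 : 0 ≤ β := measureReal_nonneg
  -- the weight `s * t` turns the square root into the integrand `t * leviInt` of the Lelong mass
  have step : ∀ t ∈ Ioc a (2 * a),
      ∫⁻ v in K, ENNReal.ofReal (√(levi φ (x + t • v) v)) ≤
        ENNReal.ofReal ((s * (t * leviInt φ ρ x t) + β / (s * a)) / 2) := by
    intro t ht
    have ht0 : 0 < t := ha.trans ht.1
    have hp := hpos t ⟨ht0.le, ht.2.trans haT⟩
    have hc := continuous_levi_ray hφ x t
    have hi : Integrable (fun v => (s * t * levi φ (x + t • v) v + 1 / (s * a)) / 2)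
        (volume.restrict K) := integrable_of_continuous hK (by fun_prop)
    calc ∫⁻ v in K, ENNReal.ofReal (√(levi φ (x + t • v) v))
        ≤ ∫⁻ v in K, ENNReal.ofReal ((s * t * levi φ (x + t • v) v + 1 / (s * a)) / 2) := by
          refine setLIntegral_mono' measurableSet_closedBall fun v hv => ?_
          refine ENNReal.ofReal_le_ofReal ((sqrt_le_of_pos (hp v hv)
            (show 0 < s * t by positivity)).trans ?_)
          have : 1 / (s * t) ≤ 1 / (s * a) := by
            apply one_div_le_one_div_of_le (by positivity)
            exact mul_le_mul_of_nonneg_left ht.1.le hs.le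
          linarith
      _ = ENNReal.ofReal (∫ v in K, (s * t * levi φ (x + t • v) v + 1 / (s * a)) / 2) := by
          rw [ofReal_integral_eq_lintegral_ofReal hi]
          refine (ae_restrict_iff' measurableSet_closedBall).2 (Eventually.of_forall fun v hv => ?_)
          have := hp v hv
          simp only [Pi.zero_apply]
          positivity
      _ = _ := by
          congr 1
          have h1 : Integrable (fun v => s * t * levi φ (x + t • v) v) (volume.restrict K) :=
            integrable_of_continuous hK (by fun_prop)
          have h2 : Integrable (fun _ : Model n => 1 / (s * a)) (volume.restrict K) :=
            integrable_of_continuous hK continuous_const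
          rw [integral_div, integral_add h1 h2, integral_const_mul]
          simp only [leviInt, setIntegral_const, smul_eq_mul, ← hβ, ← hKdef]
          ring
  have hcont : Continuous fun t => (s * (t * leviInt φ ρ x t) + β / (s * a)) / 2 := by
    have := continuous_leviInt hφ ρ x
    fun_prop
  have hint : IntegrableOn (fun t => (s * (t * leviInt φ ρ x t) + β / (s * a)) / 2)
      (Ioc a (2 * a)) := hcont.integrableOn_Ioc
  calc meanLen φ ρ x a (2 * a)
      ≤ ∫⁻ t in Ioc a (2 * a),
          ENNReal.ofReal ((s * (t * leviInt φ ρ x t) + β / (s * a)) / 2) :=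
        setLIntegral_mono' measurableSet_Ioc step
    _ = ENNReal.ofReal
          (∫ t in Ioc a (2 * a), (s * (t * leviInt φ ρ x t) + β / (s * a)) / 2) := by
        rw [ofReal_integral_eq_lintegral_ofReal hint]
        refine (ae_restrict_iff' measurableSet_Ioc).2 (Eventually.of_forall fun t ht => ?_)
        have ht0 : 0 < t := ha.trans ht.1
        have := leviInt_nonneg (hpos t ⟨ht0.le, ht.2.trans haT⟩)
        simp only [Pi.zero_apply]
        positivity
    _ ≤ _ := by
        refine ENNReal.ofReal_le_ofReal ?_
        rw [← intervalIntegral.integral_of_le (by linarith), intervalIntegral.integral_div,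
          intervalIntegral.integral_add (Continuous.intervalIntegrable (by
            have := continuous_leviInt hφ ρ x
            fun_prop) _ _) (by simp),
          intervalIntegral.integral_const_mul, integral_mul_leviInt hφ]
        have h0 : 0 ≤ lelong φ ρ x a := lelong_nonneg hφ hpos ⟨ha.le, by linarith⟩
        have h1 : (2 * a - a) • (β / (s * a)) = β / s := by
          simp only [smul_eq_mul]; field_simp; ring
        rw [intervalIntegral.integral_const, h1]
        have := mul_nonneg hs.le h0
        linarith

lemma meanLen_le_add (a b c : ℝ) :
    meanLen φ ρ x a c ≤ meanLen φ ρ x a b + meanLen φ ρ x b c :=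
  (lintegral_mono_set Ioc_subset_Ioc_union_Ioc).trans (lintegral_union_le _ _ _)

lemma meanLen_le_tsum :
    meanLen φ ρ x 0 1 ≤ ∑' k : ℕ, meanLen φ ρ x ((1 / 2) ^ (k + 1)) ((1 / 2) ^ k) := by
  refine (lintegral_mono_set ?_).trans (lintegral_iUnion_le _ _)
  intro t ht
  have h : ∃ k : ℕ, ((1 : ℝ) / 2) ^ k < t :=
    exists_pow_lt_of_lt_one ht.1 (by norm_num)
  classical
  have hk := Nat.find_spec h
  obtain ⟨k, hk'⟩ : ∃ k, Nat.find h = k + 1 := by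
    refine Nat.exists_eq_succ_of_ne_zero fun h0 => ?_
    rw [h0, pow_zero] at hk
    exact absurd ht.2 (not_le.2 hk)
  rw [hk'] at hk
  refine mem_iUnion.2 ⟨k, hk, ?_⟩
  exact not_lt.1 (Nat.find_min h (by omega))

/-- Mean segment lengths for the Levi form of an `α`-Hölder function are of order `ρ ^ (α / 2)`. -/
lemma meanLen_le_of_holder {α H : ℝ} (hα : 0 < α) (hH : 0 ≤ H) (hρ : 0 < ρ)
    (hφ : ContDiff ℝ 2 φ)
    (hpos : ∀ t ∈ Icc (0 : ℝ) 2, ∀ v ∈ closedBall (0 : Model n) ρ, 0 ≤ levi φ (x + t • v) v)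
    (hhol : ∀ y ∈ closedBall x (2 * ρ), ∀ z ∈ closedBall x (2 * ρ),
      |φ y - φ z| ≤ H * ‖y - z‖ ^ α) :
    meanLen φ ρ x 0 1 ≤ ENNReal.ofReal ((4 * H + 1) / (1 - (1 / 2) ^ (α / 2)) *
      volume.real (closedBall (0 : Model n) ρ) * ρ ^ (α / 2)) := by
  set K := closedBall (0 : Model n) ρ with hKdef
  have hK : IsCompact K := isCompact_closedBall _ _
  set β := volume.real K with hβ
  have hβ0 : 0 ≤ β := measureReal_nonneg
  set r : ℝ := (1 / 2) ^ (α / 2) with hr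
  have hr0 : 0 ≤ r := by positivity
  have hr1 : r < 1 := Real.rpow_lt_one (by norm_num) (by norm_num) (by positivity)
  -- the Lelong mass at scale `t` is `O((tρ) ^ α)`
  have growth : ∀ t, 0 < t → t ≤ 1 → lelong φ ρ x t ≤ 2 * (β * (H * (t * ρ) ^ α)) := by
    intro t ht ht1
    refine (lelong_le hφ hpos ht (by linarith)).trans ?_
    refine mul_le_mul_of_nonneg_left ?_ zero_le_two
    have hc := hφ.continuous
    have i : ∀ u : ℝ, Integrable (fun v => φ (x + u • v)) (volume.restrict K) := fun u =>
      integrable_of_continuous hK (by fun_prop)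
    rw [ballInt, ballInt, ← integral_sub (i _) (i _)]
    calc ∫ v in K, (φ (x + (2 * t) • v) - φ (x + t • v))
        ≤ ∫ v in K, H * (t * ρ) ^ α := by
          refine setIntegral_mono_on ((i _).sub (i _))
            (integrable_of_continuous hK continuous_const) measurableSet_closedBall fun v hv => ?_
          have hv' : ‖v‖ ≤ ρ := by simpa [K] using hv
          have hm : ∀ u : ℝ, 0 ≤ u → u ≤ 2 → x + u • v ∈ closedBall x (2 * ρ) := by
            intro u hu hu2
            simp only [mem_closedBall, dist_self_add_left, norm_smul, Real.norm_eq_abs,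
              abs_of_nonneg hu]
            gcongr
          refine (le_abs_self _).trans ((hhol _ (hm _ (by positivity) (by linarith)) _
            (hm _ ht.le (by linarith))).trans ?_)
          refine mul_le_mul_of_nonneg_left ?_ hH
          refine Real.rpow_le_rpow (norm_nonneg _) ?_ hα.le
          have : x + (2 * t) • v - (x + t • v) = t • v := by
            rw [two_mul, add_smul]; abel
          rw [this, norm_smul, Real.norm_eq_abs, abs_of_pos ht]
          gcongr
      _ = β * (H * (t * ρ) ^ α) := by simp [← hβ]
  -- the dyadic pieces decay geometrically; `s = (bρ) ^ (-α / 2)` balances the two terms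
  have hdy : ∀ k : ℕ, meanLen φ ρ x ((1 / 2) ^ (k + 1)) ((1 / 2) ^ k) ≤
      ENNReal.ofReal ((4 * H + 1) * β * ρ ^ (α / 2) * r ^ k) := by
    intro k
    have hb0 : (0 : ℝ) < (1 / 2) ^ k := by positivity
    have hb1 : ((1 : ℝ) / 2) ^ k ≤ 1 := pow_le_one₀ (by norm_num) (by norm_num)
    have e2 : 2 * ((1 : ℝ) / 2) ^ (k + 1) = (1 / 2) ^ k := by rw [pow_succ]; ring
    set b : ℝ := (1 / 2) ^ k
    set q := (b * ρ) ^ (α / 2) with hq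
    have hq0 : 0 < q := by positivity
    have h := meanLen_dyadic_le hφ hpos (a := (1 / 2) ^ (k + 1)) (s := q⁻¹) (by positivity)
      (by rw [e2]; linarith) (by positivity)
    rw [e2] at h
    refine h.trans (ENNReal.ofReal_le_ofReal ?_)
    have hqq : (b * ρ) ^ α = q * q := by
      rw [hq, ← Real.rpow_add (by positivity)]; congr 1; ring
    have hqr : q = ρ ^ (α / 2) * r ^ k := by
      rw [hq, Real.mul_rpow hb0.le hρ.le, mul_comm]
      congr 1
      rw [hr, ← Real.rpow_natCast, ← Real.rpow_mul (by norm_num), mul_comm, Real.rpow_mul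
        (by norm_num), Real.rpow_natCast]
    have hg := growth b hb0 hb1
    rw [hqq] at hg
    have h3 : q⁻¹ * lelong φ ρ x b ≤ 2 * (β * (H * q)) := by
      calc q⁻¹ * lelong φ ρ x b ≤ q⁻¹ * (2 * (β * (H * (q * q)))) := by gcongr
        _ = 2 * (β * (H * q)) := by field_simp
    have h4 : β / q⁻¹ = β * q := by field_simp
    rw [show (4 * H + 1) * β * ρ ^ (α / 2) * r ^ k = (4 * H + 1) * β * q by rw [hqr]; ring, h4]
    have : 0 ≤ H * β * q := by positivity
    have : 0 ≤ β * q := by positivity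
    nlinarith
  refine meanLen_le_tsum.trans ((ENNReal.tsum_le_tsum hdy).trans ?_)
  rw [← ENNReal.ofReal_tsum_of_nonneg (fun k => by positivity)
    ((summable_geometric_of_lt_one hr0 hr1).mul_left _), tsum_mul_left,
    tsum_geometric_of_lt_one hr0 hr1]
  refine ENNReal.ofReal_le_ofReal (le_of_eq ?_)
  field_simp

end

/-! ### Exponential integrability of mean lengths -/

/-- The exponential function on `[0, ∞]`. -/
noncomputable def eexp (x : ℝ≥0∞) : ℝ≥0∞ := EReal.exp (x : EReal)

lemma eexp_mono : Monotone eexp := fun _ _ h =>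
  EReal.exp_monotone (EReal.coe_ennreal_le_coe_ennreal_iff.2 h)

lemma measurable_eexp : Measurable eexp := eexp_mono.measurable

lemma eexp_ofReal {r : ℝ} (hr : 0 ≤ r) :
    eexp (ENNReal.ofReal r) = ENNReal.ofReal (Real.exp r) := by
  rw [eexp, EReal.coe_ennreal_ofReal, max_eq_left hr, EReal.exp_coe]

lemma eexp_half_add_le (x y : ℝ≥0∞) : eexp ((x + y) / 2) ≤ eexp x + eexp y := by
  rcases le_total x y with h | h
  · refine (eexp_mono ?_).trans le_add_self
    rw [ENNReal.div_le_iff two_ne_zero ENNReal.ofNat_ne_top, mul_two]; gcongr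
  · refine (eexp_mono ?_).trans le_self_add
    rw [ENNReal.div_le_iff two_ne_zero ENNReal.ofNat_ne_top, mul_two]; gcongr

/-- Layer-cake bound for an exponential by the indicators of super-level sets. -/
lemma eexp_le_tsum_indicator {c A : ℝ} (hc : 0 < c) (hA : 0 < A) (y : ℝ≥0∞) :
    eexp (ENNReal.ofReal c * y) ≤ ENNReal.ofReal (Real.exp c) +
      ∑' k : ℕ, ENNReal.ofReal (Real.exp (c * (A * (k + 1) + 1))) *
        (if ENNReal.ofReal (A * k + 1) < y then 1 else 0) := by
  classical
  by_cases hy : y = ⊤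
  · subst hy
    simp only [ENNReal.ofReal_lt_top, if_true, mul_one]
    have : ∑' k : ℕ, ENNReal.ofReal (Real.exp (c * (A * (k + 1) + 1))) = ⊤ := by
      refine ENNReal.eq_top_of_forall_nnreal_le fun r => ?_
      refine le_trans ?_ (ENNReal.tsum_le_tsum (f := fun _ : ℕ => (1 : ℝ≥0∞)) fun k => ?_)
      · rw [ENNReal.tsum_const_eq_top_of_ne_zero one_ne_zero]; exact le_top
      · rw [← ENNReal.ofReal_one]
        exact ENNReal.ofReal_le_ofReal (Real.one_le_exp (by positivity))
    rw [this]; simp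
  · obtain ⟨r, hr, rfl⟩ : ∃ r : ℝ, 0 ≤ r ∧ y = ENNReal.ofReal r :=
      ⟨y.toReal, ENNReal.toReal_nonneg, (ENNReal.ofReal_toReal hy).symm⟩
    rw [← ENNReal.ofReal_mul hc.le, eexp_ofReal (by positivity)]
    have h : ∃ k : ℕ, r ≤ A * k + 1 := by
      obtain ⟨k, hk⟩ := exists_nat_ge (r / A)
      rw [div_le_iff₀ hA] at hk
      exact ⟨k, by linarith⟩
    have hk := Nat.find_spec h
    rcases hk' : Nat.find h with _ | k
    · rw [hk'] at hk
      refine (ENNReal.ofReal_le_ofReal (Real.exp_le_exp.2 ?_)).trans le_self_add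
      simp only [Nat.cast_zero, mul_zero, zero_add] at hk
      nlinarith
    · rw [hk'] at hk
      have h2 := Nat.find_min h (m := k) (by omega)
      refine le_trans ?_ (le_trans (ENNReal.le_tsum k) le_add_self)
      rw [if_pos ((ENNReal.ofReal_lt_ofReal_iff_of_nonneg (by positivity)).2 (not_le.1 h2)),
        mul_one]
      refine ENNReal.ofReal_le_ofReal (Real.exp_le_exp.2 ?_)
      push_cast at hk
      exact mul_le_mul_of_nonneg_left hk hc.le

lemma setLIntegral_comp_add_le {A B : Set (Model n)} (hA : MeasurableSet A) (hB : MeasurableSet B)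
    (w : Model n) (h : ∀ x ∈ A, x + w ∈ B) (g : Model n → ℝ≥0∞) :
    ∫⁻ x in A, g (x + w) ≤ ∫⁻ z in B, g z := by
  calc ∫⁻ x in A, g (x + w) = ∫⁻ x, A.indicator (fun x => g (x + w)) x :=
        (lintegral_indicator hA _).symm
    _ ≤ ∫⁻ x, B.indicator g (x + w) := by
        refine lintegral_mono fun x => ?_
        by_cases hx : x ∈ A
        · simp [hx, h x hx]
        · simp [hx]
    _ = ∫⁻ x, B.indicator g x := lintegral_add_right_eq_self _ w
    _ = _ := lintegral_indicator hB _

section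

variable {φ : Model n → ℝ} {R M : ℝ} {z₀ : Model n}

lemma levi_ray_nonneg {S R : ℝ} {T : ℝ}
    (hpos : ∀ z ∈ closedBall z₀ (S + T * R), ∀ v, 0 ≤ levi φ z v) {x : Model n}
    (hx : x ∈ closedBall z₀ S) :
    ∀ t ∈ Icc 0 T, ∀ v ∈ closedBall (0 : Model n) R, 0 ≤ levi φ (x + t • v) v := by
  intro t ht v hv
  refine hpos _ ?_ v
  have hv' : ‖v‖ ≤ R := by simpa using hv
  rw [mem_closedBall, dist_eq_norm] at hx ⊢
  calc ‖x + t • v - z₀‖ = ‖(x - z₀) + t • v‖ := by congr 1; abel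
    _ ≤ ‖x - z₀‖ + ‖t • v‖ := norm_add_le _ _
    _ ≤ S + T * R := by
      rw [norm_smul, Real.norm_eq_abs, abs_of_nonneg ht.1]
      have := mul_le_mul ht.2 hv' (norm_nonneg _) (ht.1.trans ht.2)
      linarith

/-- A bound for the Lelong masses at unit scale bounds the total mass of the Levi form: after
averaging over the centres, the Levi form at distance `t` in direction `v` becomes the Levi form
itself, up to a translation. -/
lemma lintegral_levi_le (hφ : ContDiff ℝ 2 φ)
    (hpos : ∀ z ∈ closedBall z₀ (4 * R), ∀ v, 0 ≤ levi φ z v)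
    (hM : ∀ x ∈ closedBall z₀ (3 * R), lelong φ R x 1 ≤ M) :
    ∫⁻ v in closedBall (0 : Model n) R, ∫⁻ z in closedBall z₀ (2 * R),
      ENNReal.ofReal (levi φ z v) ≤
      4 * (ENNReal.ofReal M * volume (closedBall z₀ (3 * R))) := by
  set K := closedBall (0 : Model n) R
  set B := closedBall z₀ (3 * R)
  set S := ∫⁻ v in K, ∫⁻ z in closedBall z₀ (2 * R), ENNReal.ofReal (levi φ z v) with hS
  have hp : ∀ x ∈ B, ∀ t ∈ Icc (0 : ℝ) 1, ∀ v ∈ closedBall (0 : Model n) R,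
      0 ≤ levi φ (x + t • v) v := fun x hx =>
    levi_ray_nonneg (T := 1) (S := 3 * R) (by convert hpos using 3; ring_nf) hx
  have hcl := continuous_levi hφ
  have h1 : ∀ t ∈ Ioc (1 / 2 : ℝ) 1, S ≤ ∫⁻ x in B, ENNReal.ofReal (2 * (t * leviInt φ R x t)) := by
    intro t ht
    have ht0 : 0 < t := by linarith [ht.1]
    calc S ≤ ∫⁻ v in K, ∫⁻ x in B, ENNReal.ofReal (levi φ (x + t • v) v) := by
          refine setLIntegral_mono' measurableSet_closedBall fun v hv => ?_
          have := setLIntegral_comp_add_le (A := closedBall z₀ (2 * R)) (B := B)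
            measurableSet_closedBall measurableSet_closedBall (-(t • v)) (fun x hx => by
              have hv' : ‖v‖ ≤ R := by simpa [K] using hv
              rw [mem_closedBall, dist_eq_norm] at hx ⊢
              calc ‖x + -(t • v) - z₀‖ = ‖(x - z₀) - t • v‖ := by congr 1; abel
                _ ≤ ‖x - z₀‖ + ‖t • v‖ := norm_sub_le _ _
                _ ≤ 3 * R := by
                  rw [norm_smul, Real.norm_eq_abs, abs_of_pos ht0]
                  have := mul_le_mul ht.2 hv' (norm_nonneg _) zero_le_one
                  linarith)
            (fun x => ENNReal.ofReal (levi φ (x + t • v) v))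
          simpa using this
      _ = ∫⁻ x in B, ∫⁻ v in K, ENNReal.ofReal (levi φ (x + t • v) v) := by
          refine lintegral_lintegral_swap (Continuous.measurable ?_).aemeasurable
          exact ENNReal.continuous_ofReal.comp
            (hcl.comp (f := fun p : Model n × Model n => (p.2 + t • p.1, p.1)) (by fun_prop))
      _ ≤ _ := by
          refine setLIntegral_mono' measurableSet_closedBall fun x hx => ?_
          have hp' := hp x hx t ⟨ht0.le, ht.2⟩
          rw [lintegral_levi_eq hφ hp']
          refine ENNReal.ofReal_le_ofReal ?_
          have := leviInt_nonneg hp'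
          nlinarith [ht.1]
  have hcI : Continuous fun p : ℝ × Model n => leviInt φ R p.2 p.1 := by
    refine continuous_parametric_integral_of_continuous (μ := volume)
      (f := fun (p : ℝ × Model n) v => levi φ (p.2 + p.1 • v) v) ?_ (isCompact_closedBall _ _)
    exact hcl.comp (f := fun q : (ℝ × Model n) × Model n => (q.1.2 + q.1.1 • q.2, q.2))
      (by fun_prop)
  -- integrate over `1/2 < t ≤ 1`, where the right-hand side is a difference of Lelong masses
  have h2 : ENNReal.ofReal (1 / 2) * S ≤ ENNReal.ofReal (2 * M) * volume B := by
    calc ENNReal.ofReal (1 / 2) * S = ∫⁻ _ in Ioc (1 / 2 : ℝ) 1, S := by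
          rw [setLIntegral_const, Real.volume_Ioc, mul_comm]; norm_num
      _ ≤ ∫⁻ t in Ioc (1 / 2 : ℝ) 1, ∫⁻ x in B, ENNReal.ofReal (2 * (t * leviInt φ R x t)) :=
          setLIntegral_mono' measurableSet_Ioc h1
      _ = ∫⁻ x in B, ∫⁻ t in Ioc (1 / 2 : ℝ) 1, ENNReal.ofReal (2 * (t * leviInt φ R x t)) := by
          refine lintegral_lintegral_swap (Continuous.measurable ?_).aemeasurable
          have : Continuous fun p : ℝ × Model n => 2 * (p.1 * leviInt φ R p.2 p.1) := by fun_prop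
          exact ENNReal.continuous_ofReal.comp this
      _ ≤ ∫⁻ x in B, ENNReal.ofReal (2 * M) := by
          refine setLIntegral_mono' measurableSet_closedBall fun x hx => ?_
          have hc : Continuous fun t => 2 * (t * leviInt φ R x t) := by
            have := continuous_leviInt hφ R x
            fun_prop
          rw [← ofReal_integral_eq_lintegral_ofReal hc.integrableOn_Ioc]
          · refine ENNReal.ofReal_le_ofReal ?_
            rw [← intervalIntegral.integral_of_le (by norm_num),
              intervalIntegral.integral_const_mul, integral_mul_leviInt hφ]
            have := lelong_nonneg hφ (hp x hx) (t := 1 / 2) ⟨by norm_num, by norm_num⟩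
            have := hM x hx
            linarith
          · refine (ae_restrict_iff' measurableSet_Ioc).2 (Eventually.of_forall fun t ht => ?_)
            have ht0 : 0 < t := by linarith [ht.1]
            have := leviInt_nonneg (hp x hx t ⟨ht0.le, ht.2⟩)
            simp only [Pi.zero_apply]
            positivity
      _ = _ := by rw [setLIntegral_const]
  calc S = 2 * (ENNReal.ofReal (1 / 2) * S) := by
        rw [← mul_assoc, ← ENNReal.ofReal_ofNat 2, ← ENNReal.ofReal_mul (by norm_num)]
        norm_num
    _ ≤ 2 * (ENNReal.ofReal (2 * M) * volume B) := by gcongr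
    _ = _ := by
        rw [ENNReal.ofReal_mul zero_le_two, ENNReal.ofReal_ofNat]; ring

lemma measurable_meanLen (hφ : ContDiff ℝ 2 φ) (ρ a b : ℝ) :
    Measurable fun x => meanLen φ ρ x a b := by
  have hc : Continuous fun q : (Model n × ℝ) × Model n =>
      ENNReal.ofReal (√(levi φ (q.1.1 + q.1.2 • q.2) q.2)) :=
    ENNReal.continuous_ofReal.comp (Real.continuous_sqrt.comp ((continuous_levi hφ).comp
      (f := fun q : (Model n × ℝ) × Model n => (q.1.1 + q.1.2 • q.2, q.2)) (by fun_prop)))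
  have h1 : Measurable fun p : Model n × ℝ => ∫⁻ v in closedBall (0 : Model n) ρ,
      ENNReal.ofReal (√(levi φ (p.1 + p.2 • v) v)) :=
    hc.measurable.lintegral_prod_right' (ν := volume.restrict (closedBall (0 : Model n) ρ))
  exact h1.lintegral_prod_right' (ν := volume.restrict (Ioc a b))

/-- The mean length of the initial parts `t ≤ δ` of the segments, integrated over the centre, is
`O(δ)`. -/
lemma lintegral_meanLen_le (hR : 0 < R) (hφ : ContDiff ℝ 2 φ)
    (hpos : ∀ z ∈ closedBall z₀ (4 * R), ∀ v, 0 ≤ levi φ z v)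
    (hM : ∀ x ∈ closedBall z₀ (3 * R), lelong φ R x 1 ≤ M) {δ : ℝ} (hδ1 : δ ≤ 1) :
    ∫⁻ x in closedBall z₀ R, meanLen φ R x 0 δ ≤ ENNReal.ofReal δ *
      (volume (closedBall (0 : Model n) R) * volume (closedBall z₀ (2 * R)) +
        4 * (ENNReal.ofReal M * volume (closedBall z₀ (3 * R)))) := by
  set K := closedBall (0 : Model n) R
  have hcl := continuous_levi hφ
  have hc : Continuous fun q : (Model n × ℝ) × Model n =>
      ENNReal.ofReal (√(levi φ (q.1.1 + q.1.2 • q.2) q.2)) :=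
    ENNReal.continuous_ofReal.comp (Real.continuous_sqrt.comp (hcl.comp
      (f := fun q : (Model n × ℝ) × Model n => (q.1.1 + q.1.2 • q.2, q.2)) (by fun_prop)))
  have h1 : ∀ t ∈ Ioc 0 δ, ∫⁻ x in closedBall z₀ R, ∫⁻ v in K,
      ENNReal.ofReal (√(levi φ (x + t • v) v)) ≤
      volume K * volume (closedBall z₀ (2 * R)) +
        4 * (ENNReal.ofReal M * volume (closedBall z₀ (3 * R))) := by
    intro t ht
    rw [lintegral_lintegral_swap]
    swap
    · exact (hc.comp (f := fun p : Model n × Model n => ((p.1, t), p.2))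
        (by fun_prop)).measurable.aemeasurable
    calc ∫⁻ v in K, ∫⁻ x in closedBall z₀ R, ENNReal.ofReal (√(levi φ (x + t • v) v))
        ≤ ∫⁻ v in K, ∫⁻ z in closedBall z₀ (2 * R), ENNReal.ofReal (√(levi φ z v)) := by
          refine setLIntegral_mono' measurableSet_closedBall fun v hv => ?_
          refine setLIntegral_comp_add_le measurableSet_closedBall measurableSet_closedBall
            (t • v) (fun x hx => ?_) (fun z => ENNReal.ofReal (√(levi φ z v)))
          have hv' : ‖v‖ ≤ R := by simpa [K] using hv
          rw [mem_closedBall, dist_eq_norm] at hx ⊢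
          calc ‖x + t • v - z₀‖ = ‖(x - z₀) + t • v‖ := by congr 1; abel
            _ ≤ ‖x - z₀‖ + ‖t • v‖ := norm_add_le _ _
            _ ≤ 2 * R := by
              rw [norm_smul, Real.norm_eq_abs, abs_of_pos ht.1]
              have := mul_le_mul (ht.2.trans hδ1) hv' (norm_nonneg _) zero_le_one
              linarith
      _ ≤ ∫⁻ v in K, (volume (closedBall z₀ (2 * R)) +
            ∫⁻ z in closedBall z₀ (2 * R), ENNReal.ofReal (levi φ z v)) := by
          refine lintegral_mono fun v => ?_
          rw [← setLIntegral_one, ← lintegral_add_left measurable_const]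
          refine setLIntegral_mono' measurableSet_closedBall fun z hz => ?_
          have hp := hpos z (closedBall_subset_closedBall (by linarith) hz) v
          rw [← ENNReal.ofReal_one, ← ENNReal.ofReal_add zero_le_one hp]
          refine ENNReal.ofReal_le_ofReal ((sqrt_le_of_pos hp one_pos).trans ?_)
          linarith
      _ ≤ _ := by
          rw [lintegral_add_left measurable_const, setLIntegral_const, mul_comm]
          gcongr
          exact lintegral_levi_le hφ hpos hM
  unfold meanLen
  rw [lintegral_lintegral_swap]
  swap
  · have h := hc.measurable.lintegral_prod_right' (ν := volume.restrict K)
    exact h.aemeasurable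
  refine (setLIntegral_mono' measurableSet_Ioc h1).trans ?_
  rw [setLIntegral_const, Real.volume_Ioc, sub_zero, mul_comm]

/-- Each of the `k` outermost dyadic pieces of the mean length is bounded by `A`, as the Lelong
masses are nondecreasing in the radius. -/
lemma meanLen_le_nat_mul_add (hR : 0 < R) (hφ : ContDiff ℝ 2 φ)
    (hpos : ∀ z ∈ closedBall z₀ (4 * R), ∀ v, 0 ≤ levi φ z v)
    (hM : ∀ x ∈ closedBall z₀ (3 * R), lelong φ R x 1 ≤ M)
    {x : Model n} (hx : x ∈ closedBall z₀ R) {A : ℝ} (hA0 : 0 ≤ A)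
    (hA : M + volume.real (closedBall (0 : Model n) R) ≤ A) (k : ℕ) :
    meanLen φ R x 0 1 ≤ ENNReal.ofReal (A * k) + meanLen φ R x 0 ((1 / 2) ^ k) := by
  have hx3 : x ∈ closedBall z₀ (3 * R) := closedBall_subset_closedBall (by linarith) hx
  have hp : ∀ t ∈ Icc (0 : ℝ) 1, ∀ v ∈ closedBall (0 : Model n) R, 0 ≤ levi φ (x + t • v) v :=
    levi_ray_nonneg (T := 1) (S := 3 * R) (by convert hpos using 3; ring_nf) hx3
  induction k with
  | zero => simp
  | succ k ih =>
    have hb0 : (0 : ℝ) < (1 / 2) ^ k := by positivity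
    have hb1 : ((1 : ℝ) / 2) ^ k ≤ 1 := pow_le_one₀ (by norm_num) (by norm_num)
    have e2 : 2 * ((1 : ℝ) / 2) ^ (k + 1) = (1 / 2) ^ k := by rw [pow_succ]; ring
    have h := meanLen_dyadic_le hφ hp (a := (1 / 2) ^ (k + 1)) (s := 1) (by positivity)
      (by rw [e2]; linarith) one_pos
    rw [e2] at h
    have hm : lelong φ R x ((1 / 2) ^ k) ≤ M :=
      (monotoneOn_lelong hφ hp ⟨hb0.le, hb1⟩ ⟨zero_le_one, le_rfl⟩ hb1).trans (hM x hx3)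
    have h2 : meanLen φ R x ((1 / 2) ^ (k + 1)) ((1 / 2) ^ k) ≤ ENNReal.ofReal A := by
      refine h.trans (ENNReal.ofReal_le_ofReal ?_)
      rw [one_mul, div_one]; linarith
    calc meanLen φ R x 0 1 ≤ ENNReal.ofReal (A * k) + meanLen φ R x 0 ((1 / 2) ^ k) := ih
      _ ≤ ENNReal.ofReal (A * k) + (meanLen φ R x 0 ((1 / 2) ^ (k + 1)) + ENNReal.ofReal A) := by
          gcongr
          exact (meanLen_le_add _ _ _).trans (by gcongr)
      _ = _ := by
          rw [add_comm (meanLen _ _ _ _ _), ← add_assoc, ← ENNReal.ofReal_add (by positivity) hA0]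
          push_cast
          ring_nf

/-- Mean segment lengths are exponentially integrable, with constants depending only on a bound
for the Lelong masses at unit scale: splitting the segments at `t = 2⁻ᵏ`, the outer part is
`O(k)` pointwise and the inner part is `O(2⁻ᵏ)` in `L¹`, so that the set where the length exceeds
`A k + 1` has measure `O(2⁻ᵏ)`. -/
theorem exists_lintegral_eexp_meanLen_le (z₀ : Model n) (hR : 0 < R) (hM0 : 0 ≤ M) :
    ∃ c : ℝ, 0 < c ∧ ∃ C : ℝ≥0∞, C ≠ ⊤ ∧ ∀ φ : Model n → ℝ, ContDiff ℝ 2 φ →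
      (∀ z ∈ closedBall z₀ (4 * R), ∀ v, 0 ≤ levi φ z v) →
      (∀ x ∈ closedBall z₀ (3 * R), lelong φ R x 1 ≤ M) →
      ∫⁻ x in closedBall z₀ R, eexp (ENNReal.ofReal c * meanLen φ R x 0 1) ≤ C := by
  set β := volume.real (closedBall (0 : Model n) R)
  have hβ0 : 0 ≤ β := measureReal_nonneg
  set A := M + β + 1 with hAdef
  have hA : 0 < A := by positivity
  set c := 1 / (2 * A) with hc
  have hc0 : 0 < c := by positivity
  set C₁ := volume (closedBall (0 : Model n) R) * volume (closedBall z₀ (2 * R)) +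
        4 * (ENNReal.ofReal M * volume (closedBall z₀ (3 * R))) with hC₁
  have hC₁t : C₁ ≠ ⊤ := by
    have h := volume_closedBall_ne_top (n := n)
    refine ENNReal.add_ne_top.2 ⟨ENNReal.mul_ne_top (h _ _) (h _ _), ?_⟩
    exact ENNReal.mul_ne_top (by simp) (ENNReal.mul_ne_top (by simp) (h _ _))
  have hcA : c * A = 1 / 2 := by rw [hc]; field_simp
  -- `c` is chosen so that `exp (c A k) * 2⁻ᵏ = qᵏ` is summable
  set q := Real.exp (1 / 2) / 2 with hq
  have hq0 : 0 ≤ q := by positivity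
  have hq1 : q < 1 := by
    have h1 : Real.exp (1 / 2) * Real.exp (1 / 2) = Real.exp 1 := by
      rw [← Real.exp_add]; norm_num
    have h2 := Real.exp_one_lt_d9
    have h3 := Real.exp_pos (1 / 2)
    have : Real.exp (1 / 2) < 2 := by nlinarith
    rw [hq]; linarith
  set C₂ := ENNReal.ofReal (Real.exp (1 / 2 + c)) * C₁ * ENNReal.ofReal (1 - q)⁻¹ with hC₂
  refine ⟨c, hc0, ENNReal.ofReal (Real.exp c) * volume (closedBall z₀ R) + C₂, ?_, ?_⟩
  · refine ENNReal.add_ne_top.2 ⟨ENNReal.mul_ne_top (by simp) (volume_closedBall_ne_top _ _), ?_⟩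
    exact ENNReal.mul_ne_top (ENNReal.mul_ne_top (by simp) hC₁t) (by simp)
  intro φ hφ hpos hM
  set B := closedBall z₀ R
  have hmeas := measurable_meanLen hφ R 0
  have hset : ∀ k : ℕ, MeasurableSet {x | ENNReal.ofReal (A * k + 1) < meanLen φ R x 0 1} :=
    fun k => measurableSet_lt measurable_const (hmeas 1)
  -- where the length exceeds `A k + 1`, the inner part exceeds `1`: apply Chebyshev's inequality
  have hlevel : ∀ k : ℕ, volume.restrict B {x | ENNReal.ofReal (A * k + 1) < meanLen φ R x 0 1} ≤
      ENNReal.ofReal ((1 / 2) ^ k) * C₁ := by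
    intro k
    have hb1 : ((1 : ℝ) / 2) ^ k ≤ 1 := pow_le_one₀ (by norm_num) (by norm_num)
    refine le_trans ?_ (lintegral_meanLen_le hR hφ hpos hM hb1)
    have hcheb := mul_meas_ge_le_lintegral (μ := volume.restrict B) (hmeas ((1 / 2) ^ k)) 1
    rw [one_mul] at hcheb
    refine le_trans ?_ hcheb
    rw [Measure.restrict_apply (hset k), Measure.restrict_apply
      (measurableSet_le measurable_const (hmeas _))]
    refine measure_mono fun x hx => ⟨?_, hx.2⟩
    have h1 := meanLen_le_nat_mul_add hR hφ hpos hM hx.2 hA.le (by rw [hAdef]; linarith) k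
    have h2 : ENNReal.ofReal (A * k + 1) < meanLen φ R x 0 1 := hx.1
    rw [ENNReal.ofReal_add (by positivity) zero_le_one, ENNReal.ofReal_one] at h2
    by_contra hlt
    have hlt' : meanLen φ R x 0 ((1 / 2) ^ k) < 1 := not_le.1 hlt
    exact absurd (h2.trans_le h1) (not_lt.2 (by gcongr))
  calc ∫⁻ x in B, eexp (ENNReal.ofReal c * meanLen φ R x 0 1)
      ≤ ∫⁻ x in B, (ENNReal.ofReal (Real.exp c) +
          ∑' k : ℕ, ENNReal.ofReal (Real.exp (c * (A * (k + 1) + 1))) *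
            {x | ENNReal.ofReal (A * k + 1) < meanLen φ R x 0 1}.indicator 1 x) := by
        refine lintegral_mono fun x => (eexp_le_tsum_indicator hc0 hA _).trans (le_of_eq ?_)
        simp [indicator_apply]
    _ = ENNReal.ofReal (Real.exp c) * volume B +
          ∑' k : ℕ, ENNReal.ofReal (Real.exp (c * (A * (k + 1) + 1))) *
            volume.restrict B {x | ENNReal.ofReal (A * k + 1) < meanLen φ R x 0 1} := by
        rw [lintegral_add_left measurable_const, setLIntegral_const, lintegral_tsum]
        · congr 1
          refine tsum_congr fun k => ?_
          rw [lintegral_const_mul _ (measurable_one.indicator (hset k)),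
            lintegral_indicator_one (hset k)]
        · exact fun k => (((measurable_one.indicator (hset k)).const_mul _)).aemeasurable
    _ ≤ ENNReal.ofReal (Real.exp c) * volume B +
          ∑' k : ℕ, ENNReal.ofReal (Real.exp (1 / 2 + c)) * C₁ * ENNReal.ofReal (q ^ k) := by
        refine add_le_add le_rfl (ENNReal.tsum_le_tsum fun k => ?_)
        calc _ ≤ ENNReal.ofReal (Real.exp (c * (A * (k + 1) + 1))) *
              (ENNReal.ofReal ((1 / 2) ^ k) * C₁) := by gcongr; exact hlevel k
          _ = _ := by
            have e : c * (A * (k + 1) + 1) = k * (1 / 2) + (1 / 2 + c) := by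
              calc c * (A * (k + 1) + 1) = (c * A) * (k + 1) + c := by ring
                _ = _ := by rw [hcA]; ring
            have : ENNReal.ofReal (Real.exp (c * (A * (k + 1) + 1))) *
                ENNReal.ofReal ((1 / 2) ^ k) =
                ENNReal.ofReal (Real.exp (1 / 2 + c)) * ENNReal.ofReal (q ^ k) := by
              rw [← ENNReal.ofReal_mul (Real.exp_pos _).le,
                ← ENNReal.ofReal_mul (Real.exp_pos _).le, e, Real.exp_add, Real.exp_nat_mul, hq,
                div_pow, div_pow, one_pow]
              congr 1
              ring
            rw [← mul_assoc, this]
            ring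
    _ = _ := by
        rw [ENNReal.tsum_mul_left, ← ENNReal.ofReal_tsum_of_nonneg (fun k => by positivity)
          (summable_geometric_of_lt_one hq0 hq1), tsum_geometric_of_lt_one hq0 hq1]

end

/-! ### Charts of a complex manifold -/

section Charts

variable {n : ℕ}

/-- `dd^c f (v, i v)` is half the Levi form. -/
lemma ddcLocal_apply_J {f : Model n → ℝ} {z : Model n} (hf : ContDiffAt ℝ 2 f z) (v : Model n) :
    ddcLocal f z ![v, J n v] = levi f z v / 2 := by
  have h1 : DifferentiableAt ℝ (fderiv ℝ f) z :=
    (hf.fderiv_right (m := 1) (by norm_num)).differentiableAt one_ne_zero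
  have h2 : DifferentiableAt ℝ (dcLocal f) z := by
    unfold dcLocal
    have h3 : DifferentiableAt ℝ (fun y => -(1 / 2 : ℝ) • (fderiv ℝ f y).comp (J n)) z :=
      DifferentiableAt.fun_const_smul (h1.clm_comp (differentiableAt_const _)) _
    exact (ContinuousAlternatingMap.ofSubsingletonLIE (𝕜 := ℝ) (E := Model n) (F := ℝ)
      (0 : Fin 1)).toContinuousLinearEquiv.differentiableAt.comp z h3
  have h4 : ∀ u w : Model n, fderiv ℝ (fun y => dcLocal f y ![u]) z w =
      -(1 / 2) * hess f z w (J n u) := by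
    intro u w
    have e : (fun y => dcLocal f y ![u]) = fun y => -(1 / 2 : ℝ) * fderiv ℝ f y (J n u) := by
      funext y; simp [dcLocal]
    rw [e]
    have h5 := (h1.hasFDerivAt.clm_apply (hasFDerivAt_const (J n u) z)).const_mul (-(1 / 2 : ℝ))
    rw [h5.fderiv]
    simp [hess]
  rw [ddcLocal, extDeriv_apply h2, Fin.sum_univ_two]
  have e0 : (0 : Fin 2).removeNth ![v, J n v] = ![J n v] := by
    ext i; fin_cases i; rfl
  have e1 : (1 : Fin 2).removeNth ![v, J n v] = ![v] := by
    ext i; fin_cases i; rfl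
  rw [e0, e1, h4, h4]
  simp [levi, hess, J_J]
  ring

lemma ContDiffAt.levi_congr {f g : Model n → ℝ} {z : Model n} (h : f =ᶠ[𝓝 z] g) (v : Model n) :
    levi f z v = levi g z v := by
  simp only [levi, hess, h.fderiv.fderiv_eq]

/-- The Levi form is invariant under holomorphic changes of coordinates. -/
lemma levi_comp_holomorphic {f : Model n → ℝ} {T : Model n → Model n} {z : Model n}
    (hf : ContDiffAt ℝ 2 f (T z)) (hT : ContDiffAt ℂ ω T z) (v : Model n) :
    levi (f ∘ T) z v = levi f (T z) (fderiv ℝ T z v) := by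
  have hT1 : ∀ᶠ y in 𝓝 z, ContDiffAt ℂ ω T y := hT.eventually (by simp)
  have hTr : ContDiffAt ℝ 2 T z := (hT.restrict_scalars ℝ).of_le le_top
  have hres : ∀ᶠ y in 𝓝 z, fderiv ℝ T y = (fderiv ℂ T y).restrictScalars ℝ := by
    filter_upwards [hT1] with y hy
    exact (hy.differentiableAt (by simp)).fderiv_restrictScalars ℝ
  have hJ : ∀ᶠ y in 𝓝 z, ∀ u, fderiv ℝ T y (J n u) = J n (fderiv ℝ T y u) := by
    filter_upwards [hres] with y hy u
    simp [hy, J_apply]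
  have hdT : DifferentiableAt ℝ (fderiv ℝ T) z :=
    (hTr.fderiv_right (m := 1) (by norm_num)).differentiableAt one_ne_zero
  have hdf : DifferentiableAt ℝ (fderiv ℝ f) (T z) :=
    (hf.fderiv_right (m := 1) (by norm_num)).differentiableAt one_ne_zero
  have hTd : DifferentiableAt ℝ T z := hTr.differentiableAt two_ne_zero
  have hfe : ∀ᶠ y in 𝓝 z, DifferentiableAt ℝ f (T y) ∧ DifferentiableAt ℝ T y := by
    have h1 : ∀ᶠ y in 𝓝 z, ContDiffAt ℝ 2 f (T y) :=
      hTd.continuousAt.eventually (hf.eventually (by simp))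
    filter_upwards [h1, hTr.eventually (by simp)] with y hy hy'
    exact ⟨hy.differentiableAt two_ne_zero, hy'.differentiableAt two_ne_zero⟩
  have hfd : fderiv ℝ (f ∘ T) =ᶠ[𝓝 z] fun y => (fderiv ℝ f (T y)).comp (fderiv ℝ T y) := by
    filter_upwards [hfe] with y hy
    exact fderiv_comp y hy.1 hy.2
  -- the chain rule for the second derivative
  have hh : ∀ u, hess (f ∘ T) z u u = hess f (T z) (fderiv ℝ T z u) (fderiv ℝ T z u) +
      fderiv ℝ f (T z) (fderiv ℝ (fderiv ℝ T) z u u) := by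
    intro u
    have h1 : HasFDerivAt (fun y => fderiv ℝ f (T y))
        ((fderiv ℝ (fderiv ℝ f) (T z)).comp (fderiv ℝ T z)) z :=
      hdf.hasFDerivAt.comp z hTd.hasFDerivAt
    have h2 := h1.clm_comp hdT.hasFDerivAt
    rw [hess, hfd.fderiv_eq, h2.fderiv]
    simp [hess]
    ring
  -- the second derivative of a holomorphic map is complex bilinear
  have hTJ : ∀ u, fderiv ℝ (fderiv ℝ T) z (J n u) (J n u) = -fderiv ℝ (fderiv ℝ T) z u u := by
    intro u
    have hc : DifferentiableAt ℂ (fderiv ℂ T) z :=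
      (hT.fderiv_right (m := ω) (by simp)).differentiableAt (by simp)
    have h3 : fderiv ℝ (fderiv ℝ T) z =
        (ContinuousLinearMap.restrictScalarsL ℂ (Model n) (Model n) ℝ ℝ).comp
          ((fderiv ℂ (fderiv ℂ T) z).restrictScalars ℝ) := by
      rw [(show fderiv ℝ T =ᶠ[𝓝 z] fun y => (fderiv ℂ T y).restrictScalars ℝ from hres).fderiv_eq]
      rw [← hc.fderiv_restrictScalars ℝ]
      have := (ContinuousLinearMap.restrictScalarsL ℂ (Model n) (Model n) ℝ ℝ).hasFDerivAt.comp z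
        (hc.restrictScalars ℝ).hasFDerivAt
      exact this.fderiv
    rw [h3]
    simp [J_apply, smul_smul]
  rw [levi, hh, hh, hTJ, hJ.self_of_nhds, levi]
  simp
  ring

variable {M : Type*} [TopologicalSpace M] [ChartedSpace (Model n) M]

lemma contDiffOn_transition [IsManifold 𝓘(ℂ, Model n) ω M]
    {e e' : OpenPartialHomeomorph M (Model n)} (he : e ∈ atlas (Model n) M)
    (he' : e' ∈ atlas (Model n) M) :
    ContDiffOn ℂ ω (e' ∘ e.symm) (e.symm ≫ₕ e').source := by
  have h := StructureGroupoid.compatible (contDiffGroupoid ω 𝓘(ℂ, Model n)) he he'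
  exact (contMDiffOn_of_mem_contDiffGroupoid h).contDiffOn

lemma contDiffAt_transition [IsManifold 𝓘(ℂ, Model n) ω M]
    {e e' : OpenPartialHomeomorph M (Model n)} (he : e ∈ atlas (Model n) M)
    (he' : e' ∈ atlas (Model n) M) {z : Model n} (hz : z ∈ e.target)
    (hz' : e.symm z ∈ e'.source) : ContDiffAt ℂ ω (e' ∘ e.symm) z :=
  (contDiffOn_transition he he').contDiffAt ((e.symm ≫ₕ e').open_source.mem_nhds
    (by simp [hz, hz']))

variable (n M) in
lemma isManifold_real [IsManifold 𝓘(ℂ, Model n) ω M] : IsManifold 𝓘(ℝ, Model n) ∞ M := by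
  refine isManifold_of_contDiffOn _ _ _ fun e e' he he' => ?_
  have h := ((contDiffOn_transition he he').restrict_scalars ℝ).of_le (m := ∞) le_top
  simpa using h

variable [IsManifold 𝓘(ℂ, Model n) ω M]

lemma contMDiffOn_symm_atlas {e : OpenPartialHomeomorph M (Model n)} (he : e ∈ atlas (Model n) M) :
    ContMDiffOn 𝓘(ℝ, Model n) 𝓘(ℝ, Model n) ∞ e.symm e.target := by
  have := isManifold_real n M
  exact contMDiffOn_symm_of_mem_maximalAtlas (IsManifold.subset_maximalAtlas he)

lemma mdifferentiableAt_symm {e : OpenPartialHomeomorph M (Model n)} (he : e ∈ atlas (Model n) M)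
    {z : Model n} (hz : z ∈ e.target) :
    MDifferentiableAt 𝓘(ℝ, Model n) 𝓘(ℝ, Model n) e.symm z :=
  ((contMDiffOn_symm_atlas he).contMDiffAt (e.open_target.mem_nhds hz)).mdifferentiableAt (by simp)

lemma mfderiv_symm_eq {e : OpenPartialHomeomorph M (Model n)} (he : e ∈ atlas (Model n) M)
    {z : Model n} (hz : z ∈ e.target) :
    mfderiv 𝓘(ℝ, Model n) 𝓘(ℝ, Model n) e.symm z =
      fderiv ℝ (chartAt (Model n) (e.symm z) ∘ e.symm) z := by
  rw [(mdifferentiableAt_symm he hz).mfderiv]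
  simp [writtenInExtChartAt, Function.comp_def, chartAt_self_eq]
  rfl

lemma fderiv_transition_J {e e' : OpenPartialHomeomorph M (Model n)} (he : e ∈ atlas (Model n) M)
    (he' : e' ∈ atlas (Model n) M) {z : Model n} (hz : z ∈ e.target)
    (hz' : e.symm z ∈ e'.source) (v : Model n) :
    fderiv ℝ (e' ∘ e.symm) z (J n v) = J n (fderiv ℝ (e' ∘ e.symm) z v) := by
  rw [((contDiffAt_transition he he' hz hz').differentiableAt (by simp)).fderiv_restrictScalars ℝ]
  simp [J_apply]

/-- The expression of a 2-form in a chart, on a pair `(v, i v)`: the derivative of the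
inverse chart is complex linear. -/
lemma inChart_apply_J (η : TwoForm n M) {e : OpenPartialHomeomorph M (Model n)}
    (he : e ∈ atlas (Model n) M) {z : Model n} (hz : z ∈ e.target) (v : Model n) :
    η.inChart e z ![v, J n v] =
      η (e.symm z) ![mfderiv 𝓘(ℝ, Model n) 𝓘(ℝ, Model n) e.symm z v,
        tangentJ (e.symm z) (mfderiv 𝓘(ℝ, Model n) 𝓘(ℝ, Model n) e.symm z v)] := by
  have h : mfderiv 𝓘(ℝ, Model n) 𝓘(ℝ, Model n) e.symm z (J n v) =
      tangentJ (e.symm z) (mfderiv 𝓘(ℝ, Model n) 𝓘(ℝ, Model n) e.symm z v) := by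
    rw [mfderiv_symm_eq he hz]
    exact fderiv_transition_J he (chart_mem_atlas _ _) hz (mem_chart_source _ _) v
  rw [← h]
  refine congrArg (η (e.symm z)) ?_
  funext i
  fin_cases i <;> rfl

lemma contDiffOn_comp_symm {ψ : M → ℝ} (hψ : ContMDiff 𝓘(ℝ, Model n) 𝓘(ℝ, ℝ) ∞ ψ)
    {e : OpenPartialHomeomorph M (Model n)} (he : e ∈ atlas (Model n) M) :
    ContDiffOn ℝ ∞ (ψ ∘ e.symm) e.target :=
  (hψ.comp_contMDiffOn (contMDiffOn_symm_atlas he)).contDiffOn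

lemma contDiffAt_comp_symm {ψ : M → ℝ} (hψ : ContMDiff 𝓘(ℝ, Model n) 𝓘(ℝ, ℝ) ∞ ψ)
    {e : OpenPartialHomeomorph M (Model n)} (he : e ∈ atlas (Model n) M) {z : Model n}
    (hz : z ∈ e.target) : ContDiffAt ℝ 2 (ψ ∘ e.symm) z :=
  ((contDiffOn_comp_symm hψ he).contDiffAt (e.open_target.mem_nhds hz)).of_le
    (WithTop.coe_le_coe.2 (le_top : (2 : ℕ∞) ≤ ⊤))

/-- In any chart, `dd^c ψ` is computed by the same formula as in the preferred charts. -/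
lemma ddc_inChart_apply_J {ψ : M → ℝ} (hψ : ContMDiff 𝓘(ℝ, Model n) 𝓘(ℝ, ℝ) ∞ ψ)
    {e : OpenPartialHomeomorph M (Model n)} (he : e ∈ atlas (Model n) M) {z : Model n}
    (hz : z ∈ e.target) (v : Model n) :
    (ddc ψ).inChart e z ![v, J n v] = levi (ψ ∘ e.symm) z v / 2 := by
  set x := e.symm z with hx
  set e' := chartAt (Model n) x with he'
  have he'm : e' ∈ atlas (Model n) M := chart_mem_atlas _ _
  have hxs : e.symm z ∈ e'.source := mem_chart_source _ x
  rw [inChart_apply_J _ he hz, mfderiv_symm_eq he hz]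
  have h1 : ContDiffAt ℝ 2 (ψ ∘ e'.symm) (e' x) :=
    contDiffAt_comp_symm hψ he'm (e'.map_source hxs)
  refine (ddcLocal_apply_J h1 _).trans ?_
  have h2 := levi_comp_holomorphic (f := ψ ∘ e'.symm) (T := e' ∘ e.symm) (z := z) h1
    (contDiffAt_transition he he'm hz hxs) v
  have h3 : (ψ ∘ e'.symm) ∘ (e' ∘ e.symm) =ᶠ[𝓝 z] ψ ∘ e.symm := by
    have : (e.symm ≫ₕ e').source ∈ 𝓝 z := (e.symm ≫ₕ e').open_source.mem_nhds (by simp [hz, hxs])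
    filter_upwards [this] with y hy
    simp only [OpenPartialHomeomorph.trans_source, mem_inter_iff, mem_preimage] at hy
    simp [e'.left_inv hy.2]
  rw [← ContDiffAt.levi_congr h3, h2]
  rfl

omit [IsManifold 𝓘(ℂ, Model n) ω M] in
lemma add_inChart (η θ : TwoForm n M) (e : OpenPartialHomeomorph M (Model n)) (z : Model n) :
    (η + θ).inChart e z = η.inChart e z + θ.inChart e z := by
  ext v; rfl

end Charts

/-! ### The distance of a 2-form -/

section Distance

variable {n : ℕ} {M : Type*} [TopologicalSpace M] [ChartedSpace (Model n) M]

/-- The extended norm `√(η (v, J v))` on the tangent spaces, as in the definition of `distance`. -/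
noncomputable abbrev formENorm (η : TwoForm n M) (p : M) :
    ENorm (TangentSpace 𝓘(ℝ, Model n) p) :=
  ⟨fun v => ENNReal.ofReal (Real.sqrt (η p ![v, tangentJ p v]))⟩

lemma formENormSMulClass (η : TwoForm n M) (p : M) :
    let _ := formENorm η p
    ENormSMulClass ℝ (TangentSpace 𝓘(ℝ, Model n) p) := by
  let _ := formENorm η p
  refine ⟨fun r v => ?_⟩
  have h : η p ![r • v, tangentJ p (r • v)] = r ^ 2 * η p ![v, tangentJ p v] := by
    have h1 := (η p).map_smul_univ (fun _ => r) ![v, tangentJ p v]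
    rw [Finset.prod_const, Finset.card_univ, Fintype.card_fin, smul_eq_mul] at h1
    rw [← h1]
    congr 1
    funext i
    fin_cases i
    · rfl
    · exact (tangentJ p).map_smul r v
  change ENNReal.ofReal (√(η p ![r • v, tangentJ p (r • v)])) =
    ‖r‖ₑ * ENNReal.ofReal (√(η p ![v, tangentJ p v]))
  rw [h, Real.sqrt_mul (sq_nonneg r), Real.sqrt_sq_eq_abs, ENNReal.ofReal_mul (abs_nonneg r),
    Real.enorm_eq_ofReal_abs]

lemma distance_self (η : TwoForm n M) (x : M) : distance η x x = 0 := by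
  let _ : (p : M) → ENorm (TangentSpace 𝓘(ℝ, Model n) p) := formENorm η
  have := formENormSMulClass η
  exact Manifold.riemannianEDist_self

lemma distance_comm (η : TwoForm n M) (x y : M) : distance η x y = distance η y x := by
  let _ : (p : M) → ENorm (TangentSpace 𝓘(ℝ, Model n) p) := formENorm η
  have := formENormSMulClass η
  exact Manifold.riemannianEDist_comm

lemma distance_triangle (η : TwoForm n M) (x y z : M) :
    distance η x z ≤ distance η x y + distance η y z := by
  let _ : (p : M) → ENorm (TangentSpace 𝓘(ℝ, Model n) p) := formENorm η
  have := formENormSMulClass η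
  exact Manifold.riemannianEDist_triangle

/-- The distance is bounded by the length of segments in a chart. -/
lemma distance_le_segment [IsManifold 𝓘(ℂ, Model n) ω M] (η : TwoForm n M)
    {e : OpenPartialHomeomorph M (Model n)} (he : e ∈ atlas (Model n) M) {x v : Model n}
    (hx : ∀ t ∈ Icc (0 : ℝ) 1, x + t • v ∈ e.target) :
    distance η (e.symm x) (e.symm (x + v)) ≤
      ∫⁻ t in Ioc (0 : ℝ) 1, ENNReal.ofReal (√(η.inChart e (x + t • v) ![v, J n v])) := by
  let _ : (p : M) → ENorm (TangentSpace 𝓘(ℝ, Model n) p) := formENorm η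
  have := formENormSMulClass η
  have hline : ContMDiff 𝓘(ℝ, ℝ) 𝓘(ℝ, Model n) ∞ fun t : ℝ => x + t • v := by
    rw [contMDiff_iff_contDiff]; fun_prop
  have hγ : ContMDiffOn 𝓘(ℝ, ℝ) 𝓘(ℝ, Model n) 1 (fun t : ℝ => e.symm (x + t • v)) (Icc 0 1) :=
    ((contMDiffOn_symm_atlas he).comp hline.contMDiffOn hx).of_le
      (WithTop.coe_le_coe.2 (le_top : (1 : ℕ∞) ≤ ⊤))
  have h := Manifold.riemannianEDist_le_pathELength hγ (x := e.symm x) (y := e.symm (x + v))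
    (by simp) (by simp) zero_le_one
  refine le_trans h (le_of_eq ?_)
  rw [Manifold.pathELength_eq_lintegral_mfderiv_Icc, ← restrict_Ioc_eq_restrict_Icc]
  refine setLIntegral_congr_fun measurableSet_Ioc fun t ht => ?_
  have hz := hx t ⟨ht.1.le, ht.2⟩
  have hd : mfderiv 𝓘(ℝ, ℝ) 𝓘(ℝ, Model n) (fun t : ℝ => e.symm (x + t • v)) t (1 : ℝ) =
      mfderiv 𝓘(ℝ, Model n) 𝓘(ℝ, Model n) e.symm (x + t • v) v := by
    have h1 := mfderiv_comp (I := 𝓘(ℝ, ℝ)) (I' := 𝓘(ℝ, Model n)) (I'' := 𝓘(ℝ, Model n)) t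
      (g := e.symm) (f := fun t : ℝ => x + t • v) (mdifferentiableAt_symm he hz)
      (hline.mdifferentiableAt (by simp))
    have h2 : mfderiv 𝓘(ℝ, ℝ) 𝓘(ℝ, Model n) (fun t : ℝ => x + t • v) t (1 : ℝ) = v := by
      rw [mfderiv_eq_fderiv]
      have h3 : HasDerivAt (fun s : ℝ => x + s • v) v t := by
        simpa using ((hasDerivAt_id t).smul_const v).const_add x
      exact h3.deriv
    have h4 := congrArg (fun L => L (1 : ℝ)) h1
    refine h4.trans ?_
    exact congrArg (mfderiv 𝓘(ℝ, Model n) 𝓘(ℝ, Model n) e.symm (x + t • v)) h2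
  change ENNReal.ofReal (√(η (e.symm (x + t • v))
    ![mfderiv 𝓘(ℝ, ℝ) 𝓘(ℝ, Model n) (fun t : ℝ => e.symm (x + t • v)) t (1 : ℝ),
      tangentJ (e.symm (x + t • v))
        (mfderiv 𝓘(ℝ, ℝ) 𝓘(ℝ, Model n) (fun t : ℝ => e.symm (x + t • v)) t (1 : ℝ))])) = _
  rw [inChart_apply_J η he hz, hd]

/-- A function with bounded gradient is Lipschitz for the distance. -/
lemma enorm_sub_le_distance (η : TwoForm n M) {F : Type*} [NormedAddCommGroup F] [NormedSpace ℝ F]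
    {H : M → F} (hH : ContMDiff 𝓘(ℝ, Model n) 𝓘(ℝ, F) 1 H) {C : ℝ} (hC : 0 < C)
    (hb : ∀ (p : M) (v : TangentSpace 𝓘(ℝ, Model n) p),
      norm (E := F) (mfderiv 𝓘(ℝ, Model n) 𝓘(ℝ, F) H p v) ≤ C * √(η p ![v, tangentJ p v]))
    (x y : M) :
    ‖H y - H x‖ₑ ≤ ENNReal.ofReal C * distance η x y := by
  let _ : (p : M) → ENorm (TangentSpace 𝓘(ℝ, Model n) p) := formENorm η
  have hC' : ENNReal.ofReal C ≠ 0 := by simpa using hC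
  rw [mul_comm, ← ENNReal.div_le_iff hC' ENNReal.ofReal_ne_top]
  refine le_of_forall_gt fun r hr => ?_
  obtain ⟨γ, h0, h1, hγ, hlen⟩ := Manifold.exists_lt_of_riemannianEDist_lt
    (show Manifold.riemannianEDist 𝓘(ℝ, Model n) x y < r from hr)
  refine lt_of_le_of_lt ?_ hlen
  rw [ENNReal.div_le_iff hC' ENNReal.ofReal_ne_top, mul_comm]
  have hc : ContDiffOn ℝ 1 (H ∘ γ) (Icc 0 1) := (hH.comp_contMDiffOn hγ).contDiffOn
  have h2 := enorm_sub_le_lintegral_deriv_of_contDiffOn_Icc hc zero_le_one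
  simp only [Function.comp_apply, h0, h1] at h2
  refine h2.trans ?_
  rw [Manifold.pathELength_eq_lintegral_mfderiv_Icc, ← restrict_Ioo_eq_restrict_Icc,
    ← lintegral_const_mul' _ _ ENNReal.ofReal_ne_top]
  refine setLIntegral_mono' measurableSet_Ioo fun t ht => ?_
  have hγt : MDifferentiableAt 𝓘(ℝ, ℝ) 𝓘(ℝ, Model n) γ t :=
    (hγ.contMDiffAt (Icc_mem_nhds ht.1 ht.2)).mdifferentiableAt one_ne_zero
  have h3 := mfderiv_comp t (hH.mdifferentiableAt (x := γ t) one_ne_zero) hγt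
  rw [mfderiv_eq_fderiv] at h3
  have h4 : deriv (H ∘ γ) t = mfderiv 𝓘(ℝ, Model n) 𝓘(ℝ, F) H (γ t)
      (mfderiv 𝓘(ℝ, ℝ) 𝓘(ℝ, Model n) γ t (1 : ℝ)) :=
    (fderiv_apply_one_eq_deriv (f := H ∘ γ) (x := t)).symm.trans
      (congrArg (fun L => L (1 : ℝ)) h3)
  have h5 := (congrArg norm h4).trans_le (hb _ _)
  rw [← ofReal_norm]
  refine (ENNReal.ofReal_le_ofReal h5).trans (le_of_eq ?_)
  rw [ENNReal.ofReal_mul hC.le]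
  rfl

end Distance

/-! ### Local potentials and local distance bounds -/

section Local

variable {n : ℕ}

/-- The squared Euclidean norm on `ℂⁿ`. -/
noncomputable def euclSq (z : Model n) : ℝ := ∑ j, ‖z j‖ ^ 2

lemma contDiff_euclSq : ContDiff ℝ 2 (euclSq (n := n)) := by
  unfold euclSq
  exact ContDiff.sum fun j _ => (contDiff_apply ℝ ℂ j).norm_sq ℝ

lemma hess_eq_fderiv {φ : Model n → ℝ} {z : Model n} (hφ : ContDiffAt ℝ 2 φ z) (u v : Model n) :
    hess φ z u v = fderiv ℝ (fun y => fderiv ℝ φ y v) z u := by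
  have h1 : DifferentiableAt ℝ (fderiv ℝ φ) z :=
    (hφ.fderiv_right (m := 1) (by norm_num)).differentiableAt one_ne_zero
  rw [(h1.hasFDerivAt.clm_apply (hasFDerivAt_const v z)).fderiv]
  simp [hess]

lemma hess_add {φ χ : Model n → ℝ} {z : Model n} (hφ : ContDiffAt ℝ 2 φ z)
    (hχ : ContDiffAt ℝ 2 χ z) (u v : Model n) :
    hess (φ + χ) z u v = hess φ z u v + hess χ z u v := by
  have h1 : ∀ {f : Model n → ℝ}, ContDiffAt ℝ 2 f z → DifferentiableAt ℝ (fderiv ℝ f) z := fun h =>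
    (h.fderiv_right (m := 1) (by norm_num)).differentiableAt one_ne_zero
  have h2 : fderiv ℝ (φ + χ) =ᶠ[𝓝 z] fderiv ℝ φ + fderiv ℝ χ := by
    filter_upwards [hφ.eventually (by simp), hχ.eventually (by simp)] with y hy hy'
    exact fderiv_add (hy.differentiableAt two_ne_zero) (hy'.differentiableAt two_ne_zero)
  rw [hess, h2.fderiv_eq, fderiv_add (h1 hφ) (h1 hχ)]
  rfl

lemma levi_add {φ χ : Model n → ℝ} {z : Model n} (hφ : ContDiffAt ℝ 2 φ z)
    (hχ : ContDiffAt ℝ 2 χ z) (v : Model n) :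
    levi (φ + χ) z v = levi φ z v + levi χ z v := by
  simp only [levi, hess_add hφ hχ]; ring

lemma hess_const_mul {φ : Model n → ℝ} {z : Model n} (hφ : ContDiffAt ℝ 2 φ z) (c : ℝ)
    (u v : Model n) : hess (fun y => c * φ y) z u v = c * hess φ z u v := by
  have h1 : DifferentiableAt ℝ (fderiv ℝ φ) z :=
    (hφ.fderiv_right (m := 1) (by norm_num)).differentiableAt one_ne_zero
  have h2 : fderiv ℝ (fun y => c * φ y) =ᶠ[𝓝 z] c • fderiv ℝ φ := by
    filter_upwards [hφ.eventually (by simp)] with y hy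
    exact fderiv_const_mul (hy.differentiableAt two_ne_zero) c
  rw [hess, h2.fderiv_eq, fderiv_const_smul h1]
  rfl

lemma hess_euclSq (z u : Model n) : hess euclSq z u u = 2 * euclSq u := by
  have h1 : ∀ y v : Model n, fderiv ℝ euclSq y v = ∑ j, 2 * inner ℝ (y j) (v j) := by
    intro y v
    have h : HasFDerivAt (euclSq (n := n))
        (∑ j, 2 • (innerSL ℝ (y j)).comp (ContinuousLinearMap.proj (R := ℝ) j)) y := by
      unfold euclSq
      exact HasFDerivAt.fun_sum fun j _ => (hasFDerivAt_apply j y).norm_sq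
    rw [h.fderiv]
    simp [mul_add]
  rw [hess_eq_fderiv contDiff_euclSq.contDiffAt]
  simp only [h1]
  have h2 : HasFDerivAt (fun y : Model n => ∑ j, 2 * inner ℝ (y j) (u j))
      (∑ j, (2 : ℝ) • ((innerSL ℝ (u j)).comp (ContinuousLinearMap.proj (R := ℝ) j))) z := by
    refine HasFDerivAt.fun_sum fun j _ => ?_
    have h3 := (((innerSL ℝ (u j)).hasFDerivAt).comp z (hasFDerivAt_apply (𝕜 := ℝ) j z)).const_mul 2
    refine h3.congr_of_eventuallyEq (Eventually.of_forall fun y => ?_)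
    simp [mul_comm]
  rw [h2.fderiv]
  simp [euclSq, Finset.mul_sum]

lemma euclSq_J (v : Model n) : euclSq (J n v) = euclSq v := by
  simp [euclSq, J_apply]

lemma levi_euclSq (z v : Model n) : levi euclSq z v = 4 * euclSq v := by
  rw [levi, hess_euclSq, hess_euclSq, euclSq_J]; ring

lemma norm_sq_le_euclSq (v : Model n) : ‖v‖ ^ 2 ≤ euclSq v := by
  have h0 : 0 ≤ euclSq v := Finset.sum_nonneg fun j _ => by positivity
  have : ‖v‖ ≤ √(euclSq v) := by
    refine (pi_norm_le_iff_of_nonneg (Real.sqrt_nonneg _)).2 fun j => ?_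
    refine Real.le_sqrt_of_sq_le ?_
    exact Finset.single_le_sum (f := fun j => ‖v j‖ ^ 2) (fun j _ => by positivity)
      (Finset.mem_univ j)
  calc ‖v‖ ^ 2 ≤ √(euclSq v) ^ 2 := by gcongr
    _ = _ := Real.sq_sqrt h0

variable {M : Type*} [TopologicalSpace M] [ChartedSpace (Model n) M]
  [IsManifold 𝓘(ℂ, Model n) ω M]

lemma fderiv_transition_comp {e e' : OpenPartialHomeomorph M (Model n)}
    (he : e ∈ atlas (Model n) M) (he' : e' ∈ atlas (Model n) M) {z : Model n} (hz : z ∈ e.target)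
    (hz' : e.symm z ∈ e'.source) :
    (fderiv ℝ (e ∘ e'.symm) (e' (e.symm z))).comp (fderiv ℝ (e' ∘ e.symm) z) =
      ContinuousLinearMap.id ℝ (Model n) := by
  have d1 : DifferentiableAt ℝ (e' ∘ e.symm) z :=
    ((contDiffAt_transition he he' hz hz').differentiableAt (by simp)).restrictScalars ℝ
  have d2 : DifferentiableAt ℝ (e ∘ e'.symm) (e' (e.symm z)) :=
    ((contDiffAt_transition he' he (e'.map_source hz') (by
      rw [e'.left_inv hz']; exact e.map_target hz)).differentiableAt (by simp)).restrictScalars ℝ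
  refine (fderiv_comp z (g := e ∘ e'.symm) d2 d1).symm.trans ?_
  have : (e ∘ e'.symm) ∘ (e' ∘ e.symm) =ᶠ[𝓝 z] id := by
    have : (e.symm ≫ₕ e').source ∈ 𝓝 z := (e.symm ≫ₕ e').open_source.mem_nhds (by simp [hz, hz'])
    filter_upwards [this] with y hy
    simp only [OpenPartialHomeomorph.trans_source, mem_inter_iff, mem_preimage] at hy
    have hy1 : y ∈ e.target := hy.1
    simp [e'.left_inv hy.2, e.right_inv hy1]
  rw [this.fderiv_eq, fderiv_id]

lemma inChart_pos {η : TwoForm n M} (hη : IsKahlerForm η)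
    {e : OpenPartialHomeomorph M (Model n)} (he : e ∈ atlas (Model n) M) {z : Model n}
    (hz : z ∈ e.target) {v : Model n} (hv : v ≠ 0) : 0 < η.inChart e z ![v, J n v] := by
  rw [inChart_apply_J η he hz]
  refine hη.pos _ _ fun h => hv ?_
  rw [mfderiv_symm_eq he hz] at h
  have h2 := congrArg (fun L => L v) (fderiv_transition_comp he
    (chart_mem_atlas (Model n) (e.symm z)) hz (mem_chart_source _ _))
  simp only [ContinuousLinearMap.comp_apply, ContinuousLinearMap.id_apply] at h2
  rw [← h2]
  exact (congrArg _ h).trans (map_zero _)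

omit [IsManifold 𝓘(ℂ, Model n) ω M] in
lemma inChart_zero (η : TwoForm n M) (e : OpenPartialHomeomorph M (Model n)) (z : Model n) :
    η.inChart e z ![0, J n 0] = 0 :=
  (η.inChart e z).map_coord_zero 0 rfl

lemma inChart_nonneg {η : TwoForm n M} (hη : IsKahlerForm η)
    {e : OpenPartialHomeomorph M (Model n)} (he : e ∈ atlas (Model n) M) {z : Model n}
    (hz : z ∈ e.target) (v : Model n) : 0 ≤ η.inChart e z ![v, J n v] := by
  by_cases hv : v = 0
  · rw [hv, inChart_zero]
  · exact (inChart_pos hη he hz hv).le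

/-- On compact parts of a chart, a Kähler metric is comparable with the norm. -/
lemma exists_inChart_bounds {η : TwoForm n M} (hη : IsKahlerForm η)
    {e : OpenPartialHomeomorph M (Model n)} (he : e ∈ atlas (Model n) M) {K : Set (Model n)}
    (hK : IsCompact K) (hKe : K ⊆ e.target) :
    ∃ a > 0, ∃ A > 0, ∀ z ∈ K, ∀ v, a * ‖v‖ ^ 2 ≤ η.inChart e z ![v, J n v] ∧
      η.inChart e z ![v, J n v] ≤ A * ‖v‖ ^ 2 := by
  have hcont : ContinuousOn (fun q : Model n × Model n => η.inChart e q.1 ![q.2, J n q.2])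
      (K ×ˢ sphere (0 : Model n) 1) := by
    have h1 : ContinuousOn (fun q : Model n × Model n => η.inChart e q.1)
        (K ×ˢ sphere (0 : Model n) 1) :=
      ((hη.smooth e he).continuousOn.mono hKe).comp continuousOn_fst fun q hq => hq.1
    have h2 : Continuous (fun q : Model n × Model n => ![q.2, J n q.2]) := by
      refine continuous_pi fun i => ?_
      fin_cases i
      · exact continuous_snd
      · exact (J n).continuous.comp continuous_snd
    exact h1.eval h2.continuousOn
  have hc : IsCompact (K ×ˢ sphere (0 : Model n) 1) := hK.prod (isCompact_sphere _ _)
  obtain ⟨A, hA⟩ := hc.exists_bound_of_continuousOn hcont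
  obtain ⟨a, ha0, ha⟩ : ∃ a > 0, ∀ q ∈ K ×ˢ sphere (0 : Model n) 1,
      a ≤ η.inChart e q.1 ![q.2, J n q.2] := by
    rcases (K ×ˢ sphere (0 : Model n) 1).eq_empty_or_nonempty with hemp | hne
    · exact ⟨1, one_pos, by simp [hemp]⟩
    · obtain ⟨q, hq, hmin⟩ := hc.exists_isMinOn hne hcont
      refine ⟨_, inChart_pos hη he (hKe hq.1) (v := q.2) ?_, fun q' hq' => hmin hq'⟩
      exact ne_of_mem_sphere hq.2 one_ne_zero
  refine ⟨a, ha0, max A 1, by positivity, fun z hz v => ?_⟩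
  by_cases hv : v = 0
  · rw [hv, inChart_zero]; simp
  have hv' : 0 < ‖v‖ := norm_pos_iff.2 hv
  set u := ‖v‖⁻¹ • v with hu
  have hus : u ∈ sphere (0 : Model n) 1 := by
    simp [hu, norm_smul, hv'.ne']
  have hvu : v = ‖v‖ • u := by rw [hu, smul_smul, mul_inv_cancel₀ hv'.ne', one_smul]
  have hs : η.inChart e z ![v, J n v] = ‖v‖ ^ 2 * η.inChart e z ![u, J n u] := by
    have h1 := (η.inChart e z).map_smul_univ (fun _ => ‖v‖) ![u, J n u]
    rw [Finset.prod_const, Finset.card_univ, Fintype.card_fin, smul_eq_mul] at h1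
    rw [← h1]
    congr 1
    funext i
    fin_cases i
    · exact hvu
    · change J n v = ‖v‖ • J n u
      rw [← map_smul, ← hvu]
  have h1 := ha (z, u) ⟨hz, hus⟩
  have h2 := (le_abs_self _).trans (hA (z, u) ⟨hz, hus⟩)
  rw [hs]
  constructor
  · rw [mul_comm]; gcongr
  · rw [mul_comm]; gcongr
    exact h2.trans (le_max_left _ _)

/-- A function on `ℂⁿ` which on a ball of a chart is plurisubharmonic and differs from `ψ` by a
fixed quadratic function, and whose Levi form dominates the metric `ω₀ + dd^c ψ` there. -/
lemma exists_local_potential {ω₀ : TwoForm n M} {ψ : M → ℝ}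
    (hψ : ContMDiff 𝓘(ℝ, Model n) 𝓘(ℝ, ℝ) ∞ ψ) (hω : IsKahlerForm (ω₀ + ddc ψ))
    {e : OpenPartialHomeomorph M (Model n)} (he : e ∈ atlas (Model n) M) {z₀ : Model n}
    {R A : ℝ} (hR : 0 < R) (hA : 0 ≤ A) (hsub : closedBall z₀ (2 * R) ⊆ e.target)
    (hup : ∀ z ∈ closedBall z₀ (2 * R), ∀ v, ω₀.inChart e z ![v, J n v] ≤ A * ‖v‖ ^ 2) :
    ∃ φ : Model n → ℝ, ContDiff ℝ 2 φ ∧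
      (∀ z ∈ closedBall z₀ R, φ z = ψ (e.symm z) + A / 2 * euclSq z) ∧
      ∀ z ∈ closedBall z₀ R, ∀ v, (ω₀ + ddc ψ).inChart e z ![v, J n v] ≤ levi φ z v ∧
        0 ≤ levi φ z v := by
  -- a cutoff extends the potential of the chart to all of `ℂⁿ`
  let χ : ContDiffBump z₀ := ⟨3 / 2 * R, 2 * R, by positivity, by linarith⟩
  have hs : ContDiff ℝ 2 fun z => χ z * ψ (e.symm z) := by
    refine contDiff_iff_contDiffAt.2 fun z => ?_
    by_cases hz : z ∈ e.target
    · exact χ.contDiffAt.mul (contDiffAt_comp_symm hψ he hz)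
    · have hz' : z ∉ tsupport χ := fun h => hz (hsub (by rwa [χ.tsupport_eq] at h))
      have h0 : (fun z => χ z * ψ (e.symm z)) =ᶠ[𝓝 z] fun _ => 0 := by
        filter_upwards [notMem_tsupport_iff_eventuallyEq.1 hz'] with y hy
        rw [hy]; simp
      exact contDiffAt_const.congr_of_eventuallyEq h0
  have hq : ContDiff ℝ 2 fun z : Model n => A / 2 * euclSq z := contDiff_const.mul contDiff_euclSq
  refine ⟨(fun z => χ z * ψ (e.symm z)) + fun z => A / 2 * euclSq z, hs.add hq, ?_, ?_⟩
  · intro z hz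
    have : χ z = 1 := χ.one_of_mem_closedBall (closedBall_subset_closedBall (by
      change R ≤ 3 / 2 * R; linarith) hz)
    simp [this]
  · intro z hz v
    have hz2 : z ∈ closedBall z₀ (2 * R) := closedBall_subset_closedBall (by linarith) hz
    have hze := hsub hz2
    have h1 : (fun z => χ z * ψ (e.symm z)) =ᶠ[𝓝 z] ψ ∘ e.symm := by
      filter_upwards [χ.eventuallyEq_one_of_mem_ball (x := z)
        (closedBall_subset_ball (by change R < 3 / 2 * R; linarith) hz)] with y hy
      simp [hy]
    have h2 : levi ((fun z => χ z * ψ (e.symm z)) + fun z => A / 2 * euclSq z) z v =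
        levi (ψ ∘ e.symm) z v + 2 * A * euclSq v := by
      rw [levi_add hs.contDiffAt hq.contDiffAt, ContDiffAt.levi_congr h1]
      congr 1
      rw [levi, hess_const_mul contDiff_euclSq.contDiffAt,
        hess_const_mul contDiff_euclSq.contDiffAt, ← mul_add]
      change A / 2 * levi euclSq z v = _
      rw [levi_euclSq]; ring
    have h3 : (ω₀ + ddc ψ).inChart e z ![v, J n v] =
        ω₀.inChart e z ![v, J n v] + levi (ψ ∘ e.symm) z v / 2 := by
      rw [add_inChart, ContinuousAlternatingMap.add_apply, ddc_inChart_apply_J hψ he hze]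
    have h4 := inChart_nonneg hω he hze v
    have h5 := hup z hz2 v
    have h6 := mul_le_mul_of_nonneg_left (norm_sq_le_euclSq v) hA
    rw [h2, h3]
    rw [h3] at h4
    constructor <;> nlinarith

/-- Averaging over the intermediate point `w` the lengths of the broken segments from `x` through
`w` to `y` bounds the distance of `x` and `y` by mean radial lengths. -/
lemma distance_mul_volume_le {η : TwoForm n M}
    {e : OpenPartialHomeomorph M (Model n)} (he : e ∈ atlas (Model n) M)
    {φ : Model n → ℝ} (hφ : ContDiff ℝ 2 φ) {B : Set (Model n)} (hB : B ⊆ e.target)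
    (hle : ∀ z ∈ B, ∀ v, η.inChart e z ![v, J n v] ≤ levi φ z v)
    {x y m : Model n} {r ρ : ℝ} (hxB : closedBall x ρ ⊆ B) (hyB : closedBall y ρ ⊆ B)
    (hx : closedBall m r ⊆ closedBall x ρ) (hy : closedBall m r ⊆ closedBall y ρ) :
    distance η (e.symm x) (e.symm y) * volume (closedBall m r) ≤
      meanLen φ ρ x 0 1 + meanLen φ ρ y 0 1 := by
  -- `S x v` bounds the length of the segment from `x` to `x + v`
  set S : Model n → Model n → ℝ≥0∞ := fun x v =>
    ∫⁻ t in Ioc (0 : ℝ) 1, ENNReal.ofReal (√(levi φ (x + t • v) v)) with hS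
  have hc : ∀ x : Model n, Continuous fun q : Model n × ℝ =>
      ENNReal.ofReal (√(levi φ (x + q.2 • q.1) q.1)) := fun x =>
    ENNReal.continuous_ofReal.comp (Real.continuous_sqrt.comp ((continuous_levi hφ).comp
      (f := fun q : Model n × ℝ => (x + q.2 • q.1, q.1)) (by fun_prop)))
  have hSm : ∀ x, Measurable (S x) := fun x =>
    (hc x).measurable.lintegral_prod_right' (ν := volume.restrict (Ioc (0 : ℝ) 1))
  have hseg : ∀ x : Model n, closedBall x ρ ⊆ B → ∀ w ∈ closedBall x ρ,
      distance η (e.symm x) (e.symm w) ≤ S x (w - x) := by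
    intro x hxB w hw
    have hin : ∀ t ∈ Icc (0 : ℝ) 1, x + t • (w - x) ∈ B := by
      intro t ht
      refine hxB ?_
      rw [mem_closedBall, dist_eq_norm] at hw ⊢
      rw [add_sub_cancel_left, norm_smul, Real.norm_eq_abs, abs_of_nonneg ht.1]
      exact (mul_le_of_le_one_left (norm_nonneg _) ht.2).trans hw
    have h := distance_le_segment η he (x := x) (v := w - x) fun t ht => hB (hin t ht)
    rw [add_sub_cancel] at h
    refine h.trans (setLIntegral_mono' measurableSet_Ioc fun t ht => ?_)
    exact ENNReal.ofReal_le_ofReal (Real.sqrt_le_sqrt (hle _ (hin t ⟨ht.1.le, ht.2⟩) _))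
  have hint : ∀ x : Model n, closedBall m r ⊆ closedBall x ρ →
      ∫⁻ w in closedBall m r, S x (w - x) ≤ meanLen φ ρ x 0 1 := by
    intro x hx
    have h := setLIntegral_comp_add_le (A := closedBall m r) (B := closedBall (0 : Model n) ρ)
      measurableSet_closedBall measurableSet_closedBall (-x) (fun w hw => by
        have := hx hw
        rw [mem_closedBall, dist_eq_norm] at this
        rwa [mem_closedBall_zero_iff, ← sub_eq_add_neg]) (S x)
    simp only [← sub_eq_add_neg] at h
    refine h.trans (le_of_eq ?_)
    rw [meanLen, hS]
    refine lintegral_lintegral_swap ?_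
    exact (hc x).measurable.aemeasurable
  calc distance η (e.symm x) (e.symm y) * volume (closedBall m r)
      = ∫⁻ _ in closedBall m r, distance η (e.symm x) (e.symm y) := by rw [setLIntegral_const]
    _ ≤ ∫⁻ w in closedBall m r, (S x (w - x) + S y (w - y)) := by
        refine setLIntegral_mono' measurableSet_closedBall fun w hw => ?_
        refine (distance_triangle η _ (e.symm w) _).trans ?_
        rw [distance_comm η (e.symm w)]
        exact add_le_add (hseg x hxB w (hx hw)) (hseg y hyB w (hy hw))
    _ = (∫⁻ w in closedBall m r, S x (w - x)) + ∫⁻ w in closedBall m r, S y (w - y) :=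
        lintegral_add_left ((hSm x).comp (measurable_id.sub_const x)) _
    _ ≤ _ := add_le_add (hint x hx) (hint y hy)

end Local

/-! ### Uniformity on compact connected spaces -/

/-- On a compact space, local bounds are uniform. -/
lemma exists_uniform_of_locally {X : Type*} [TopologicalSpace X] [CompactSpace X]
    {P : ℝ≥0 → X → Prop} (hmono : ∀ C C' x, C ≤ C' → P C x → P C' x)
    (h : ∀ p, ∃ C, ∀ᶠ x in 𝓝 p, P C x) : ∃ C, ∀ x, P C x := by
  choose C hC using h
  obtain ⟨t, ht⟩ := CompactSpace.elim_nhds_subcover (fun p => {x | P (C p) x}) hC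
  refine ⟨t.sup C, fun x => ?_⟩
  have hx : x ∈ ⋃ p ∈ t, {x | P (C p) x} := ht ▸ mem_univ x
  simp only [mem_iUnion] at hx
  obtain ⟨p, hp, hx⟩ := hx
  exact hmono _ _ x (Finset.le_sup hp) hx

/-- In a connected space, local uniform bounds for a family of pseudometrics are global. -/
lemma exists_nhds_bound_of_connected {X : Type*} [TopologicalSpace X] [PreconnectedSpace X]
    {𝓓 : Set (X → X → ℝ≥0∞)} (htri : ∀ D ∈ 𝓓, ∀ x y z, D x z ≤ D x y + D y z)
    (hloc : ∀ p, ∃ U ∈ 𝓝 p, ∃ C : ℝ≥0, ∀ D ∈ 𝓓, ∀ x ∈ U, ∀ y ∈ U, D x y ≤ C) (p q : X) :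
    ∃ U ∈ 𝓝 p, ∃ V ∈ 𝓝 q, ∃ C : ℝ≥0, ∀ D ∈ 𝓓, ∀ x ∈ U, ∀ y ∈ V, D x y ≤ C := by
  refine PreconnectedSpace.induction₂' (fun p q => ∃ U ∈ 𝓝 p, ∃ V ∈ 𝓝 q, ∃ C : ℝ≥0,
    ∀ D ∈ 𝓓, ∀ x ∈ U, ∀ y ∈ V, D x y ≤ C) (fun p => ?_) ⟨?_⟩ p q
  · obtain ⟨U, hU, C, hC⟩ := hloc p
    filter_upwards [eventually_mem_nhds_iff.2 hU] with y hy
    exact ⟨⟨U, hU, U, hy, C, hC⟩, ⟨U, hy, U, hU, C, hC⟩⟩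
  · rintro p q r ⟨U, hU, V, hV, C, hC⟩ ⟨V', hV', W, hW, C', hC'⟩
    refine ⟨U, hU, W, hW, C + C', fun D hD x hx z hz => ?_⟩
    refine (htri D hD x q z).trans ?_
    push_cast
    exact add_le_add (hC D hD x hx q (mem_of_mem_nhds hV)) (hC' D hD q (mem_of_mem_nhds hV') z hz)

section

variable {n : ℕ} {M : Type*} [TopologicalSpace M] [ChartedSpace (Model n) M]
  [IsManifold 𝓘(ℂ, Model n) ω M]

/-! ### Lower bounds for the distance -/

/-- On a compact manifold every `C¹` map is Lipschitz for a Kähler metric. -/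
lemma exists_lipschitz [CompactSpace M] {η : TwoForm n M} (hη : IsKahlerForm η)
    {F : Type*} [NormedAddCommGroup F] [NormedSpace ℝ F] {H : M → F}
    (hH : ContMDiff 𝓘(ℝ, Model n) 𝓘(ℝ, F) 1 H) :
    ∃ C : ℝ, 0 < C ∧ ∀ x y, ‖H y - H x‖ₑ ≤ ENNReal.ofReal C * distance η x y := by
  suffices h : ∃ C : ℝ≥0, ∀ (p : M), ∀ (v : TangentSpace 𝓘(ℝ, Model n) p),
      norm (E := F) (mfderiv 𝓘(ℝ, Model n) 𝓘(ℝ, F) H p v) ≤ C * √(η p ![v, tangentJ p v]) by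
    obtain ⟨C, hC⟩ := h
    refine ⟨C + 1, by positivity, enorm_sub_le_distance η hH (by positivity) fun p v => ?_⟩
    refine (hC p v).trans ?_
    have := Real.sqrt_nonneg (η p ![v, tangentJ p v])
    nlinarith
  refine exists_uniform_of_locally (fun C C' x hCC h v => (h v).trans (by gcongr)) fun p => ?_
  set e := chartAt (Model n) p
  have he : e ∈ atlas (Model n) M := chart_mem_atlas _ _
  have hpt : e p ∈ e.target := mem_chart_target _ _
  obtain ⟨R, hR, hsub⟩ := nhds_basis_closedBall.mem_iff.1 (e.open_target.mem_nhds hpt)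
  obtain ⟨a, ha, _, _, hb⟩ := exists_inChart_bounds hη he (isCompact_closedBall (e p) R) hsub
  have hHe : ContDiffOn ℝ 1 (H ∘ e.symm) e.target :=
    (hH.comp_contMDiffOn ((contMDiffOn_symm_atlas he).of_le
      (WithTop.coe_le_coe.2 (le_top : (1 : ℕ∞) ≤ ⊤)))).contDiffOn
  have hfc : ContinuousOn (fderiv ℝ (H ∘ e.symm)) e.target :=
    hHe.continuousOn_fderiv_of_isOpen e.open_target le_rfl
  obtain ⟨B, hB⟩ := (isCompact_closedBall (e p) R).exists_bound_of_continuousOn (hfc.mono hsub)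
  have hB0 : 0 ≤ B := (norm_nonneg _).trans (hB _ (mem_closedBall_self hR.le))
  refine ⟨⟨B / √a, by positivity⟩, ?_⟩
  have hnb : e.source ∩ e ⁻¹' closedBall (e p) R ∈ 𝓝 p :=
    inter_mem (e.open_source.mem_nhds (mem_chart_source _ _))
      ((e.continuousAt (mem_chart_source _ _)).preimage_mem_nhds (closedBall_mem_nhds _ hR))
  filter_upwards [hnb] with x hx v
  obtain ⟨z, hz⟩ : ∃ z, z = e x := ⟨_, rfl⟩
  have hzx : e.symm z = x := by rw [hz]; exact e.left_inv hx.1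
  have hzR : z ∈ closedBall (e p) R := hz ▸ hx.2
  have hzt := hsub hzR
  subst hzx
  set e' := chartAt (Model n) (e.symm z)
  have he' : e' ∈ atlas (Model n) M := chart_mem_atlas _ _
  have hxs : e.symm z ∈ e'.source := mem_chart_source _ _
  -- every tangent vector is the image of a vector of the chart
  obtain ⟨u, hu⟩ : ∃ u : Model n, mfderiv 𝓘(ℝ, Model n) 𝓘(ℝ, Model n) e.symm z u = v := by
    have h1 := fderiv_transition_comp he' he (z := e' (e.symm z)) (e'.map_source hxs)
      (by rw [e'.left_inv hxs]; exact e.map_target hzt)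
    rw [e'.left_inv hxs, e.right_inv hzt] at h1
    refine ⟨fderiv ℝ (e ∘ e'.symm) (e' (e.symm z)) v, ?_⟩
    rw [mfderiv_symm_eq he hzt]
    exact congrArg (fun L => L v) h1
  have h2 : mfderiv 𝓘(ℝ, Model n) 𝓘(ℝ, F) H (e.symm z) v = fderiv ℝ (H ∘ e.symm) z u := by
    rw [← hu]
    have h3 := mfderiv_comp z (hH.mdifferentiableAt (x := e.symm z) one_ne_zero)
      (mdifferentiableAt_symm he hzt)
    rw [mfderiv_eq_fderiv] at h3
    exact (congrArg (fun L => L u) h3).symm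
  have h4 : η (e.symm z) ![v, tangentJ (e.symm z) v] = η.inChart e z ![u, J n u] := by
    rw [inChart_apply_J η he hzt, hu]
  rw [h4]
  refine (congrArg (norm (E := F)) h2).trans_le ?_
  have h5 := (hb z hzR u).1
  have h6 : √a * ‖u‖ ≤ √(η.inChart e z ![u, J n u]) := by
    refine Real.le_sqrt_of_sq_le ?_
    rwa [mul_pow, Real.sq_sqrt ha.le]
  calc ‖fderiv ℝ (H ∘ e.symm) z u‖ ≤ ‖fderiv ℝ (H ∘ e.symm) z‖ * ‖u‖ :=
        ContinuousLinearMap.le_opNorm _ _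
    _ ≤ B * ‖u‖ := by gcongr; exact hB z hzR
    _ = B / √a * (√a * ‖u‖) := by field_simp
    _ ≤ B / √a * √(η.inChart e z ![u, J n u]) := by gcongr

/-- Near a point, the distance dominates the coordinate distance. -/
lemma exists_norm_chart_sub_le_distance [CompactSpace M] [T2Space M] {η : TwoForm n M}
    (hη : IsKahlerForm η) (p : M) : ∃ C : ℝ, 0 < C ∧ ∃ U ∈ 𝓝 p, ∀ x ∈ U, ∀ y ∈ U,
      ‖chartAt (Model n) p x - chartAt (Model n) p y‖ₑ ≤ ENNReal.ofReal C * distance η x y := by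
  have := isManifold_real n M
  obtain ⟨χ⟩ : Nonempty (SmoothBumpFunction 𝓘(ℝ, Model n) p) := inferInstance
  have hH : ContMDiff 𝓘(ℝ, Model n) 𝓘(ℝ, Model n) ∞ fun x => χ x • chartAt (Model n) p x :=
    χ.contMDiff_smul (contMDiffOn_chart (I := 𝓘(ℝ, Model n)))
  obtain ⟨C, hC, h⟩ := exists_lipschitz hη (hH.of_le
    (WithTop.coe_le_coe.2 (le_top : (1 : ℕ∞) ≤ ⊤)))
  refine ⟨C, hC, {x | χ x = 1}, χ.eventuallyEq_one, fun x hx y hy => ?_⟩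
  rw [distance_comm]
  have := h y x
  simpa only [show χ x = 1 from hx, show χ y = 1 from hy, one_smul] using this

/-- Distinct points have neighbourhoods at positive distance. -/
lemma exists_pos_le_distance [CompactSpace M] [T2Space M] {η : TwoForm n M}
    (hη : IsKahlerForm η) {p q : M} (hpq : p ≠ q) : ∃ c : ℝ, 0 < c ∧ ∃ U ∈ 𝓝 p, ∃ V ∈ 𝓝 q,
      ∀ x ∈ U, ∀ y ∈ V, ENNReal.ofReal c ≤ distance η x y := by
  have := isManifold_real n M
  obtain ⟨χ, -, hχ⟩ := (SmoothBumpFunction.nhds_basis_tsupport (I := 𝓘(ℝ, Model n)) p).mem_iff.1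
    (isOpen_ne.mem_nhds hpq)
  have hq0 : χ q = 0 := by
    by_contra h
    exact hχ (subset_tsupport _ h) rfl
  obtain ⟨C, hC, h⟩ := exists_lipschitz hη (χ.contMDiff.of_le
    (WithTop.coe_le_coe.2 (le_top : (1 : ℕ∞) ≤ ⊤)))
  refine ⟨1 / (3 * C), by positivity, {x | 2 / 3 < χ x}, ?_, {y | χ y < 1 / 3}, ?_, ?_⟩
  · exact χ.continuous.continuousAt.eventually (lt_mem_nhds (by rw [χ.eq_one]; norm_num))
  · exact χ.continuous.continuousAt.eventually (gt_mem_nhds (by rw [hq0]; norm_num))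
  · intro x hx y hy
    have hx' : 2 / 3 < χ x := hx
    have hy' : χ y < 1 / 3 := hy
    have h1 := h y x
    rw [distance_comm η y x] at h1
    have h2 : ENNReal.ofReal (1 / 3) ≤ ‖χ x - χ y‖ₑ := by
      rw [Real.enorm_eq_ofReal_abs]
      refine ENNReal.ofReal_le_ofReal ((by linarith : 1 / 3 ≤ χ x - χ y).trans (le_abs_self _))
    have h3 := h2.trans h1
    have hC' : ENNReal.ofReal C ≠ 0 := by simpa using hC
    rw [mul_comm, ← ENNReal.div_le_iff hC' ENNReal.ofReal_ne_top,
      ← ENNReal.ofReal_div_of_pos hC] at h3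
    rwa [div_div] at h3

/-! ### Upper bounds from a Hölder potential -/

/-- Coordinate segments bound the distance from above. -/
lemma distance_le_sqrt_mul_norm (η : TwoForm n M) {e : OpenPartialHomeomorph M (Model n)}
    (he : e ∈ atlas (Model n) M) {B : Set (Model n)} (hBc : Convex ℝ B) (hB : B ⊆ e.target) {A : ℝ}
    (hA : 0 ≤ A) (hup : ∀ z ∈ B, ∀ v, η.inChart e z ![v, J n v] ≤ A * ‖v‖ ^ 2) {y z : Model n}
    (hy : y ∈ B) (hz : z ∈ B) :
    distance η (e.symm y) (e.symm z) ≤ ENNReal.ofReal (√A * ‖y - z‖) := by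
  have hin : ∀ t ∈ Icc (0 : ℝ) 1, y + t • (z - y) ∈ B := fun t ht =>
    hBc.add_smul_sub_mem hy hz ht
  have h := distance_le_segment η he (x := y) (v := z - y) fun t ht => hB (hin t ht)
  rw [add_sub_cancel] at h
  refine h.trans ?_
  calc _ ≤ ∫⁻ _ in Ioc (0 : ℝ) 1, ENNReal.ofReal (√A * ‖y - z‖) := by
        refine setLIntegral_mono' measurableSet_Ioc fun t ht => ENNReal.ofReal_le_ofReal ?_
        refine (Real.sqrt_le_sqrt (hup _ (hin t ⟨ht.1.le, ht.2⟩) _)).trans ?_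
        rw [Real.sqrt_mul hA, Real.sqrt_sq (norm_nonneg _), norm_sub_rev]
    _ = _ := by simp

omit [IsManifold 𝓘(ℂ, Model n) ω M] in
lemma abs_sub_le_of_holderNorm_le {η : TwoForm n M} {α : ℝ} (hα : 0 < α) {ψ : M → ℝ} {K : ℝ≥0}
    (h : holderNorm η α ψ ≤ K) {x y : M} {D : ℝ} (hD : 0 ≤ D)
    (hd : distance η x y ≤ ENNReal.ofReal D) : |ψ x - ψ y| ≤ K * D ^ α := by
  have h1 : ENNReal.ofReal |ψ x - ψ y| / distance η x y ^ α ≤ K :=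
    ((le_iSup₂ (f := fun x y => ENNReal.ofReal |ψ x - ψ y| / distance η x y ^ α) x y).trans
      le_add_self).trans h
  have hdt : distance η x y ^ α ≠ ⊤ :=
    ENNReal.rpow_ne_top_of_nonneg hα.le (hd.trans_lt ENNReal.ofReal_lt_top).ne
  rw [ENNReal.div_le_iff_le_mul (Or.inr ENNReal.coe_ne_top) (Or.inl hdt)] at h1
  have h2 : ENNReal.ofReal |ψ x - ψ y| ≤ ENNReal.ofReal (K * D ^ α) := by
    refine h1.trans ?_
    rw [ENNReal.ofReal_mul K.coe_nonneg, ENNReal.ofReal_coe_nnreal,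
      ← ENNReal.ofReal_rpow_of_nonneg hD hα.le]
    gcongr
  exact (ENNReal.ofReal_le_ofReal_iff (by positivity)).1 h2

lemma volume_closedBall_two_mul (x : Model n) {r : ℝ} (hr : 0 ≤ r) :
    volume (closedBall (0 : Model n) (2 * r)) =
      ENNReal.ofReal (2 ^ Module.finrank ℝ (Model n)) * volume (closedBall x r) := by
  rw [Measure.addHaar_closedBall _ _ (by positivity), Measure.addHaar_closedBall _ _ hr, mul_pow,
    ENNReal.ofReal_mul (by positivity), mul_assoc]

lemma volume_closedBall_pos (x : Model n) {r : ℝ} (hr : 0 < r) : volume (closedBall x r) ≠ 0 :=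
  (measure_closedBall_pos volume x hr).ne'

/-- Local form of the Hölder estimate for the distance of `ω₀ + dd^c ψ`. -/
lemma exists_local_holder {ω₀ : TwoForm n M} (hω₀ : IsKahlerForm ω₀) (p : M) {α : ℝ} (hα : 0 < α)
    (hα1 : α ≤ 1) (K : ℝ≥0) :
    ∃ R > 0, closedBall (chartAt (Model n) p p) R ⊆ (chartAt (Model n) p).target ∧
      ∃ C : ℝ, 0 ≤ C ∧ ∀ ψ : M → ℝ, ContMDiff 𝓘(ℝ, Model n) 𝓘(ℝ, ℝ) ∞ ψ →
        IsKahlerForm (ω₀ + ddc ψ) → holderNorm ω₀ α ψ ≤ K →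
        ∀ x ∈ closedBall (chartAt (Model n) p p) R, ∀ y ∈ closedBall (chartAt (Model n) p p) R,
          distance (ω₀ + ddc ψ) ((chartAt (Model n) p).symm x) ((chartAt (Model n) p).symm y) ≤
            ENNReal.ofReal (C * ‖x - y‖ ^ (α / 2)) := by
  set e := chartAt (Model n) p
  have he : e ∈ atlas (Model n) M := chart_mem_atlas _ _
  set z₀ := e p
  obtain ⟨R', hR', hsub'⟩ := nhds_basis_closedBall.mem_iff.1
    (e.open_target.mem_nhds (mem_chart_target (Model n) p))
  set R := R' / 20 with hRdef
  have hR : 0 < R := by positivity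
  have hsub : closedBall z₀ (2 * (10 * R)) ⊆ e.target := by
    convert hsub' using 2; rw [hRdef]; ring
  obtain ⟨_, _, A, hA, hup⟩ := exists_inChart_bounds hω₀ he (isCompact_closedBall z₀ _) hsub
  have hup' : ∀ z ∈ closedBall z₀ (2 * (10 * R)), ∀ v, ω₀.inChart e z ![v, J n v] ≤ A * ‖v‖ ^ 2 :=
    fun z hz v => (hup z hz v).2
  obtain ⟨L, hL⟩ : ∃ L : ℝ, ∀ z ∈ closedBall z₀ (10 * R), ‖fderiv ℝ euclSq z‖ ≤ L :=
    (isCompact_closedBall z₀ _).exists_bound_of_continuousOn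
      (contDiff_euclSq.continuous_fderiv two_ne_zero).continuousOn
  have hL0 : 0 ≤ L := (norm_nonneg _).trans (hL z₀ (mem_closedBall_self (by positivity)))
  set H := K * (√A) ^ α + A / 2 * (L * (20 * R) ^ (1 - α)) with hH
  have hH0 : 0 ≤ H := by positivity
  set C₁ := (4 * H + 1) / (1 - (1 / 2) ^ (α / 2)) with hC₁
  have hC₁0 : 0 ≤ C₁ := by
    have : (1 / 2 : ℝ) ^ (α / 2) < 1 :=
      Real.rpow_lt_one (by norm_num) (by norm_num) (by positivity)
    have : 0 < 1 - (1 / 2 : ℝ) ^ (α / 2) := by linarith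
    positivity
  set N := Module.finrank ℝ (Model n)
  refine ⟨R, hR, (closedBall_subset_closedBall (by linarith)).trans hsub,
    2 * C₁ * 2 ^ N * 2 ^ (α / 2), by positivity, ?_⟩
  intro ψ hψ hω hK x hx y hy
  obtain ⟨φ, hφ, hφe, hφl⟩ := exists_local_potential hψ hω he (R := 10 * R) (by positivity) hA.le
    hsub hup'
  by_cases hxy : x = y
  · rw [hxy, distance_self]; exact zero_le
  set r := ‖x - y‖ with hr
  have hr0 : 0 < r := norm_pos_iff.2 (sub_ne_zero.2 hxy)
  have hr2 : r ≤ 2 * R := by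
    have h1 := dist_triangle_right x y z₀
    rw [mem_closedBall] at hx hy
    rw [hr, ← dist_eq_norm]; linarith
  -- the local potential is Hölder; the quadratic term is Lipschitz, hence Hölder on a bounded set
  have hhol : ∀ y ∈ closedBall z₀ (10 * R), ∀ z ∈ closedBall z₀ (10 * R),
      |φ y - φ z| ≤ H * ‖y - z‖ ^ α := by
    intro y hy z hz
    have hbig : closedBall z₀ (10 * R) ⊆ closedBall z₀ (2 * (10 * R)) :=
      closedBall_subset_closedBall (by linarith)
    have h1 : |ψ (e.symm y) - ψ (e.symm z)| ≤ K * (√A * ‖y - z‖) ^ α :=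
      abs_sub_le_of_holderNorm_le hα hK (by positivity)
        (distance_le_sqrt_mul_norm ω₀ he (convex_closedBall _ _) hsub hA.le hup' (hbig hy)
          (hbig hz))
    have h2 : |euclSq y - euclSq z| ≤ L * ‖y - z‖ := by
      have := (convex_closedBall z₀ (10 * R)).norm_image_sub_le_of_norm_fderiv_le (𝕜 := ℝ)
        (fun z _ => contDiff_euclSq.differentiable two_ne_zero z) hL hz hy
      rwa [Real.norm_eq_abs] at this
    have h3 : ‖y - z‖ ≤ (20 * R) ^ (1 - α) * ‖y - z‖ ^ α := by
      rcases (norm_nonneg (y - z)).eq_or_lt with h0 | h0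
      · rw [← h0]; positivity
      have hle : ‖y - z‖ ≤ 20 * R := by
        have h1 := dist_triangle_right y z z₀
        rw [mem_closedBall] at hy hz
        rw [← dist_eq_norm]; linarith
      calc ‖y - z‖ = ‖y - z‖ ^ (1 - α) * ‖y - z‖ ^ α := by
            rw [← Real.rpow_add h0]; simp
        _ ≤ _ := by
            gcongr
    rw [hφe y hy, hφe z hz]
    calc |ψ (e.symm y) + A / 2 * euclSq y - (ψ (e.symm z) + A / 2 * euclSq z)|
        = |(ψ (e.symm y) - ψ (e.symm z)) + A / 2 * (euclSq y - euclSq z)| := by congr 1; ring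
      _ ≤ |ψ (e.symm y) - ψ (e.symm z)| + |A / 2 * (euclSq y - euclSq z)| := abs_add_le _ _
      _ ≤ K * (√A * ‖y - z‖) ^ α + A / 2 * (L * ((20 * R) ^ (1 - α) * ‖y - z‖ ^ α)) := by
          rw [abs_mul, abs_of_pos (by positivity : 0 < A / 2)]
          gcongr
          exact h2.trans (by gcongr)
      _ = H * ‖y - z‖ ^ α := by
          rw [Real.mul_rpow (Real.sqrt_nonneg _) (norm_nonneg _), hH]; ring
  -- segments issuing from `x` and from `y` with endpoints in the ball of radius `‖x - y‖` about `x`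
  have hball : ∀ w ∈ closedBall z₀ R, closedBall w (2 * (2 * r)) ⊆ closedBall z₀ (10 * R) := by
    intro w hw
    refine closedBall_subset_closedBall' ?_
    rw [mem_closedBall] at hw; linarith
  have hml : ∀ w ∈ closedBall z₀ R, meanLen φ (2 * r) w 0 1 ≤
      ENNReal.ofReal (C₁ * volume.real (closedBall (0 : Model n) (2 * r)) * (2 * r) ^ (α / 2)) := by
    intro w hw
    refine meanLen_le_of_holder hα hH0 (by positivity) hφ ?_ ?_
    · refine levi_ray_nonneg (S := R) (fun z hz v => (hφl z ?_ v).2) hw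
      exact closedBall_subset_closedBall (by linarith) hz
    · exact fun y hy z hz => hhol y (hball w hw hy) z (hball w hw hz)
  have hsub2 : ∀ w ∈ closedBall z₀ R, closedBall w (2 * r) ⊆ closedBall z₀ (10 * R) := fun w hw =>
    (closedBall_subset_closedBall (by linarith)).trans (hball w hw)
  have hd := distance_mul_volume_le he hφ ((closedBall_subset_closedBall (by linarith)).trans hsub)
    (fun z hz v => (hφl z hz v).1) (x := x) (y := y) (m := x) (r := r) (ρ := 2 * r)
    (hsub2 x hx) (hsub2 y hy) (closedBall_subset_closedBall (by linarith))
    (closedBall_subset_closedBall' (by rw [dist_eq_norm]; linarith))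
  have hv0 := volume_closedBall_pos x hr0
  have hvt := volume_closedBall_ne_top x r
  rw [← ENNReal.le_div_iff_mul_le (Or.inl hv0) (Or.inl hvt)] at hd
  refine hd.trans ?_
  rw [ENNReal.div_le_iff hv0 hvt]
  refine (add_le_add (hml x hx) (hml y hy)).trans (le_of_eq ?_)
  rw [← ENNReal.ofReal_add (by positivity) (by positivity), ← two_mul]
  have hvr : volume.real (closedBall (0 : Model n) (2 * r)) =
      2 ^ N * volume.real (closedBall x r) := by
    rw [Measure.real, volume_closedBall_two_mul x hr0.le, ENNReal.toReal_mul,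
      ENNReal.toReal_ofReal (by positivity)]
    rfl
  rw [hvr, Real.mul_rpow zero_le_two hr0.le, ← ENNReal.ofReal_toReal hvt,
    ← ENNReal.ofReal_mul (by positivity), Measure.real]
  congr 1
  ring

/-- The distance of `ω₀ + dd^c ψ` is Hölder with half the exponent of the potential. -/
theorem exists_distance_le_rpow [CompactSpace M] [T2Space M] [ConnectedSpace M]
    {ω₀ : TwoForm n M} (hω₀ : IsKahlerForm ω₀) {α : ℝ} (hα : 0 < α) (hα1 : α ≤ 1) (K : ℝ≥0) :
    ∃ C : ℝ≥0, ∀ ψ : M → ℝ, ContMDiff 𝓘(ℝ, Model n) 𝓘(ℝ, ℝ) ∞ ψ →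
      IsKahlerForm (ω₀ + ddc ψ) → holderNorm ω₀ α ψ ≤ K →
      ∀ x y : M, distance (ω₀ + ddc ψ) x y ≤ C * distance ω₀ x y ^ (α / 2) := by
  let 𝓓 : Set (M → M → ℝ≥0∞) := {D | ∃ ψ : M → ℝ, ContMDiff 𝓘(ℝ, Model n) 𝓘(ℝ, ℝ) ∞ ψ ∧
    IsKahlerForm (ω₀ + ddc ψ) ∧ holderNorm ω₀ α ψ ≤ K ∧ D = distance (ω₀ + ddc ψ)}
  suffices h : ∃ C : ℝ≥0, ∀ q : M × M, ∀ D ∈ 𝓓, D q.1 q.2 ≤ C * distance ω₀ q.1 q.2 ^ (α / 2) by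
    obtain ⟨C, hC⟩ := h
    exact ⟨C, fun ψ h1 h2 h3 x y => hC (x, y) _ ⟨ψ, h1, h2, h3, rfl⟩⟩
  have hα2 : 0 < α / 2 := by positivity
  have hloc : ∀ p : M, ∃ C : ℝ≥0, ∃ U ∈ 𝓝 p, ∀ D ∈ 𝓓, ∀ x ∈ U, ∀ y ∈ U,
      D x y ≤ ENNReal.ofReal (C * ‖chartAt (Model n) p x - chartAt (Model n) p y‖ ^ (α / 2)) ∧
      ‖chartAt (Model n) p x - chartAt (Model n) p y‖ ≤ C := by
    intro p
    obtain ⟨R, hR, -, C, hC, h⟩ := exists_local_holder hω₀ p hα hα1 K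
    set e := chartAt (Model n) p
    refine ⟨⟨max C (2 * R), by positivity⟩, e.source ∩ e ⁻¹' closedBall (e p) R,
      inter_mem (e.open_source.mem_nhds (mem_chart_source _ _))
      ((e.continuousAt (mem_chart_source _ _)).preimage_mem_nhds (closedBall_mem_nhds _ hR)), ?_⟩
    rintro D ⟨ψ, h1, h2, h3, rfl⟩ x hx y hy
    have h4 := h ψ h1 h2 h3 _ hx.2 _ hy.2
    rw [e.left_inv hx.1, e.left_inv hy.1] at h4
    refine ⟨h4.trans (ENNReal.ofReal_le_ofReal ?_), ?_⟩
    · exact mul_le_mul_of_nonneg_right (le_max_left _ _) (by positivity)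
    · have h5 := dist_triangle_right (e x) (e y) (e p)
      have hx2 : dist (e x) (e p) ≤ R := hx.2
      have hy2 : dist (e y) (e p) ≤ R := hy.2
      rw [← dist_eq_norm]
      exact (by linarith : dist (e x) (e y) ≤ 2 * R).trans (le_max_right _ _)
  have hbd := exists_nhds_bound_of_connected (𝓓 := 𝓓)
    (by rintro D ⟨ψ, -, -, -, rfl⟩ x y z; exact distance_triangle _ _ _ _)
    (fun p => by
      obtain ⟨C, U, hU, h⟩ := hloc p
      refine ⟨U, hU, C * C ^ (α / 2), fun D hD x hx y hy => ?_⟩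
      obtain ⟨h1, h2⟩ := h D hD x hx y hy
      refine h1.trans ?_
      rw [← ENNReal.ofReal_coe_nnreal]
      refine ENNReal.ofReal_le_ofReal ?_
      push_cast
      gcongr)
  refine exists_uniform_of_locally (X := M × M) (fun C C' q hCC h D hD => (h D hD).trans (by gcongr))
    fun q => ?_
  obtain ⟨p, q⟩ := q
  -- near the diagonal the local estimate applies; away from it `d_ω₀` has a positive lower bound
  by_cases hpq : p = q
  · subst hpq
    obtain ⟨C, U, hU, h⟩ := hloc p
    obtain ⟨B, hB, V, hV, h'⟩ := exists_norm_chart_sub_le_distance hω₀ p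
    refine ⟨C * (Real.toNNReal B) ^ (α / 2), ?_⟩
    have hUV : (U ∩ V) ×ˢ (U ∩ V) ∈ 𝓝 (p, p) :=
      prod_mem_nhds (inter_mem hU hV) (inter_mem hU hV)
    filter_upwards [hUV] with q hq D hD
    refine (h D hD _ hq.1.1 _ hq.2.1).1.trans ?_
    have h1 := h' _ hq.1.2 _ hq.2.2
    rw [ENNReal.ofReal_mul C.coe_nonneg, ENNReal.ofReal_coe_nnreal,
      ← ENNReal.ofReal_rpow_of_nonneg (norm_nonneg _) hα2.le, ofReal_norm]
    push_cast
    rw [mul_assoc]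
    gcongr
    rw [ENNReal.coe_rpow_of_nonneg _ hα2.le, ← ENNReal.mul_rpow_of_nonneg _ _ hα2.le]
    exact ENNReal.rpow_le_rpow h1 hα2.le
  · obtain ⟨c, hc, U, hU, V, hV, h⟩ := exists_pos_le_distance hω₀ hpq
    obtain ⟨U', hU', V', hV', C, h'⟩ := hbd p q
    refine ⟨C * (Real.toNNReal c ^ (α / 2))⁻¹, ?_⟩
    filter_upwards [prod_mem_nhds (inter_mem hU hU') (inter_mem hV hV')] with q hq D hD
    refine (h' D hD _ hq.1.2 _ hq.2.2).trans ?_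
    have h1 : ENNReal.ofReal c ≤ _ := h _ hq.1.1 _ hq.2.1
    have hc' : Real.toNNReal c ^ (α / 2) ≠ 0 := by
      have : 0 < Real.toNNReal c := Real.toNNReal_pos.2 hc
      positivity
    have hcc : ((Real.toNNReal c ^ (α / 2) : ℝ≥0) : ℝ≥0∞) = ENNReal.ofReal c ^ (α / 2) :=
      ENNReal.coe_rpow_of_nonneg _ hα2.le
    calc (C : ℝ≥0∞) = C * (Real.toNNReal c ^ (α / 2))⁻¹ * (Real.toNNReal c ^ (α / 2) : ℝ≥0) := by
          norm_cast
          rw [mul_assoc, inv_mul_cancel₀ hc', mul_one]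
      _ ≤ _ := by
          rw [hcc]
          push_cast
          gcongr

end

/-! ### The density of the top power of a 2-form -/

section TopPower

variable {n : ℕ}

/-- The real basis `(e₁, i e₁, …, eₙ, i eₙ)` of `ℂⁿ`. -/
noncomputable def stdBasis (n : ℕ) : Module.Basis (Fin n × Fin 2) ℝ (Model n) :=
  (Pi.basis fun _ : Fin n => Complex.basisOneI).reindex (Equiv.sigmaEquivProd (Fin n) (Fin 2))

lemma stdBasis_apply (p : Fin n × Fin 2) : stdBasis n p = stdFrame n p := by
  obtain ⟨j, c⟩ := p
  rw [stdBasis, Module.Basis.reindex_apply]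
  fin_cases c <;> simp [stdFrame, Pi.basis_apply]

lemma apply_update_pair (η : Alt n 2) (b : Fin n × Fin 2 → Model n) (j : Fin n)
    (i : Fin n × Fin 2) [DecidableEq (Fin n × Fin 2)] (x : Model n) :
    η (fun c => Function.update b i x (j, c)) =
      if j = i.1 then η (Function.update (fun c => b (i.1, c)) i.2 x) else η fun c => b (j, c) := by
  split_ifs with h
  · subst h
    congr 1
    funext c
    by_cases hc : c = i.2
    · subst hc; simp
    · rw [Function.update_of_ne hc, Function.update_of_ne]
      rintro h; exact hc (congrArg Prod.snd h)
  · congr 1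
    funext c
    rw [Function.update_of_ne]
    rintro h'; exact h (congrArg Prod.fst h')

/-- The `n`-fold tensor power of a 2-form, evaluated on pairs of vectors. -/
noncomputable def pairProd (η : Alt n 2) :
    MultilinearMap ℝ (fun _ : Fin n × Fin 2 => Model n) ℝ where
  toFun b := ∏ j, η fun c => b (j, c)
  map_update_add' b i x y := by
    simp only [apply_update_pair]
    rw [← Finset.mul_prod_erase _ _ (Finset.mem_univ i.1),
      ← Finset.mul_prod_erase _ _ (Finset.mem_univ i.1),
      ← Finset.mul_prod_erase _ _ (Finset.mem_univ i.1)]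
    simp only [if_true]
    rw [η.map_update_add, add_mul]
    congr 1 <;> congr 1 <;>
    exact Finset.prod_congr rfl fun j hj => by simp [Finset.ne_of_mem_erase hj]
  map_update_smul' b i r x := by
    simp only [apply_update_pair]
    rw [← Finset.mul_prod_erase _ _ (Finset.mem_univ i.1),
      ← Finset.mul_prod_erase _ _ (Finset.mem_univ i.1)]
    simp only [if_true]
    rw [η.map_update_smul, smul_mul_assoc]
    congr 2
    exact Finset.prod_congr rfl fun j hj => by simp [Finset.ne_of_mem_erase hj]

lemma topPower_eq (η : Alt n 2) :
    topPower η = (2 ^ n : ℝ)⁻¹ * MultilinearMap.alternatization (pairProd η) (stdFrame n) := by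
  rw [topPower, MultilinearMap.alternatization_apply]
  congr 1
  refine Finset.sum_congr rfl fun σ _ => ?_
  rw [Units.smul_def, zsmul_eq_mul]
  congr 1
  refine Finset.prod_congr rfl fun j _ => ?_
  congr 1
  funext c
  fin_cases c <;> rfl

/-- Top powers are volume forms: pulling back by a linear map multiplies by its determinant. -/
lemma topPower_compContinuousLinearMap (η : Alt n 2) (A : Model n →L[ℝ] Model n) :
    topPower (η.compContinuousLinearMap A) = A.det * topPower η := by
  set G := MultilinearMap.alternatization (pairProd η)
  have h1 : MultilinearMap.alternatization (pairProd (η.compContinuousLinearMap A)) (stdFrame n) =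
      G (A ∘ stdFrame n) := by
    simp only [G, MultilinearMap.alternatization_apply]
    rfl
  have hb : stdFrame n = stdBasis n := funext fun p => (stdBasis_apply p).symm
  have h2 : G = G (stdBasis n) • (stdBasis n).det := G.eq_smul_basis_det (stdBasis n)
  have h3 : G (A ∘ stdFrame n) = A.det * G (stdFrame n) := by
    rw [hb, h2]
    have h4 := (stdBasis n).det_comp (A : Model n →ₗ[ℝ] Model n) (stdBasis n)
    simp only [AlternatingMap.smul_apply, smul_eq_mul, Module.Basis.det_self, mul_one] at h4 ⊢
    rw [mul_comm]
    congr 1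
  rw [topPower_eq, topPower_eq, h1, h3]
  ring

lemma continuous_topPower : Continuous (topPower (n := n)) := by
  unfold topPower
  refine continuous_const.mul (continuous_finsetSum _ fun σ _ => continuous_const.mul
    (continuous_finsetProd _ fun j _ => ?_))
  exact continuous_eval_const _

end TopPower

/-! ### Lebesgue measures of charts and the reference measure -/

section Measures

variable {n : ℕ} {M : Type*} [TopologicalSpace M] [ChartedSpace (Model n) M]

lemma measurableSet_inter_preimage {X Y : Type*} [TopologicalSpace X] [MeasurableSpace X]
    [BorelSpace X] [TopologicalSpace Y] [MeasurableSpace Y] [BorelSpace Y] {f : X → Y} {K : Set X}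
    (hK : MeasurableSet K) (hf : ContinuousOn f K) {S : Set Y} (hS : MeasurableSet S) :
    MeasurableSet (K ∩ f ⁻¹' S) := by
  have h1 : MeasurableSet (K.domRestrict f ⁻¹' S) := hf.domRestrict.measurable hS
  have h2 := hK.subtype_image h1
  convert h2 using 1
  ext x
  simp only [mem_image, mem_preimage, Subtype.exists, exists_and_right, exists_eq_right]
  exact ⟨fun h => ⟨h.1, h.2⟩, fun ⟨h, h'⟩ => ⟨h, h'⟩⟩

/-- Lebesgue measure of a chart, as a measure on the manifold. -/
noncomputable def chartVol [MeasurableSpace M] (e : OpenPartialHomeomorph M (Model n)) :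
    Measure M :=
  (volume.restrict e.target).map e.symm

variable [MeasurableSpace M] [BorelSpace M]

omit [ChartedSpace (Model n) M] in
lemma aemeasurable_symm (e : OpenPartialHomeomorph M (Model n)) :
    AEMeasurable e.symm (volume.restrict e.target) :=
  e.continuousOn_symm.aemeasurable e.open_target.measurableSet

omit [ChartedSpace (Model n) M] in
lemma chartVol_apply (e : OpenPartialHomeomorph M (Model n)) {S : Set M} (hS : MeasurableSet S) :
    chartVol e S = volume (e.target ∩ e.symm ⁻¹' S) := by
  rw [chartVol, Measure.map_apply_of_aemeasurable (aemeasurable_symm e) hS,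
    Measure.restrict_apply' e.open_target.measurableSet, inter_comm]

omit [ChartedSpace (Model n) M] in
lemma measurableSet_target_inter (e : OpenPartialHomeomorph M (Model n)) {S : Set M}
    (hS : MeasurableSet S) : MeasurableSet (e.target ∩ e.symm ⁻¹' S) :=
  measurableSet_inter_preimage e.open_target.measurableSet e.continuousOn_symm hS

variable [IsManifold 𝓘(ℂ, Model n) ω M]

omit [MeasurableSpace M] [BorelSpace M] in
lemma hasFDerivAt_transition {e e' : OpenPartialHomeomorph M (Model n)}
    (he : e ∈ atlas (Model n) M) (he' : e' ∈ atlas (Model n) M) {z : Model n} (hz : z ∈ e.target)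
    (hz' : e.symm z ∈ e'.source) :
    HasFDerivAt (e' ∘ e.symm) (fderiv ℝ (e' ∘ e.symm) z) z :=
  (((contDiffAt_transition he he' hz hz').differentiableAt (by simp)).restrictScalars
    ℝ).hasFDerivAt

/-- Lebesgue measures of two charts are locally comparable. -/
lemma exists_chartVol_restrict_le {e e' : OpenPartialHomeomorph M (Model n)}
    (he : e ∈ atlas (Model n) M) (he' : e' ∈ atlas (Model n) M) {p : M} (hp : p ∈ e.source)
    (hp' : p ∈ e'.source) :
    ∃ U ∈ 𝓝 p, ∃ C : ℝ≥0, (chartVol e).restrict U ≤ C • chartVol e' := by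
  set T := e ∘ e'.symm
  set O := (e'.symm ≫ₕ e).source with hO
  have hOo : IsOpen O := (e'.symm ≫ₕ e).open_source
  have hpO : e' p ∈ O := by simp [hO, e'.map_source hp', e'.left_inv hp', hp]
  obtain ⟨r, hr, hsub⟩ := nhds_basis_closedBall.mem_iff.1 (hOo.mem_nhds hpO)
  set K := closedBall (e' p) r
  have hKt : ∀ z ∈ K, z ∈ e'.target ∧ e'.symm z ∈ e.source := fun z hz => by
    have := hsub hz
    simpa [hO] using this
  have hTc : ContDiffOn ℝ 1 T O :=
    ((contDiffOn_transition he' he).restrict_scalars ℝ).of_le le_top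
  have hdet : ContinuousOn (fun z => (fderiv ℝ T z).det) K :=
    ContinuousLinearMap.continuous_det.comp_continuousOn
      ((hTc.continuousOn_fderiv_of_isOpen hOo le_rfl).mono hsub)
  obtain ⟨C, hC⟩ := (isCompact_closedBall (e' p) r).exists_bound_of_continuousOn hdet
  refine ⟨e'.source ∩ e' ⁻¹' ball (e' p) r,
    (e'.isOpen_inter_preimage isOpen_ball).mem_nhds ⟨hp', mem_ball_self hr⟩, C.toNNReal, ?_⟩
  refine Measure.le_intro fun S hS _ => ?_
  have hUm : MeasurableSet (e'.source ∩ e' ⁻¹' ball (e' p) r) :=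
    (e'.isOpen_inter_preimage isOpen_ball).measurableSet
  rw [Measure.restrict_apply hS, chartVol_apply e (hS.inter hUm), Measure.smul_apply,
    chartVol_apply e' hS]
  set D := K ∩ e'.symm ⁻¹' S
  have hD : MeasurableSet D := measurableSet_inter_preimage measurableSet_closedBall
    (e'.continuousOn_symm.mono fun z hz => (hKt z hz).1) hS
  calc volume (e.target ∩ e.symm ⁻¹' (S ∩ (e'.source ∩ e' ⁻¹' ball (e' p) r)))
      ≤ volume (T '' D) := by
        refine measure_mono fun z hz => ⟨e' (e.symm z), ⟨ball_subset_closedBall hz.2.2.2, ?_⟩, ?_⟩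
        · change e'.symm (e' (e.symm z)) ∈ S
          rw [e'.left_inv hz.2.2.1]; exact hz.2.1
        · change e (e'.symm (e' (e.symm z))) = z
          rw [e'.left_inv hz.2.2.1, e.right_inv hz.1]
    _ ≤ ∫⁻ z in D, ENNReal.ofReal |(fderiv ℝ T z).det| :=
        addHaar_image_le_lintegral_abs_det_fderiv _ hD fun z hz =>
          (hasFDerivAt_transition he' he (hKt z hz.1).1 (hKt z hz.1).2).hasFDerivWithinAt
    _ ≤ ∫⁻ _ in D, (C.toNNReal : ℝ≥0∞) := by
        refine setLIntegral_mono' hD fun z hz => ENNReal.ofReal_le_ofReal ?_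
        have := hC z hz.1
        rwa [Real.norm_eq_abs] at this
    _ = C.toNNReal * volume D := setLIntegral_const _ _
    _ ≤ C.toNNReal • volume (e'.target ∩ e'.symm ⁻¹' S) := by
        rw [ENNReal.smul_def, smul_eq_mul]
        gcongr
        exact fun z hz => ⟨(hKt z hz.1).1, hz.2⟩

omit [MeasurableSpace M] [BorelSpace M] in
/-- Change of charts for 2-forms. -/
lemma inChart_transition (η : TwoForm n M) {e e' : OpenPartialHomeomorph M (Model n)}
    (he : e ∈ atlas (Model n) M) (he' : e' ∈ atlas (Model n) M) {z : Model n} (hz : z ∈ e.target)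
    (hz' : e.symm z ∈ e'.source) :
    η.inChart e z = (η.inChart e' (e' (e.symm z))).compContinuousLinearMap
      (fderiv ℝ (e' ∘ e.symm) z) := by
  have key : ∀ {e : OpenPartialHomeomorph M (Model n)}, e ∈ atlas (Model n) M → ∀ {z x},
      z ∈ e.target → e.symm z = x → η.inChart e z =
        ContinuousAlternatingMap.compContinuousLinearMap (show Alt n 2 from η x)
          (fderiv ℝ (chartAt (Model n) x ∘ e.symm) z) := by
    rintro e he z x hz rfl
    rw [TwoForm.inChart, mfderiv_symm_eq he hz]
    rfl
  have hzt : e' (e.symm z) ∈ e'.target := e'.map_source hz'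
  have hx : e'.symm (e' (e.symm z)) = e.symm z := e'.left_inv hz'
  rw [key he hz rfl, key he' hzt hx]
  set c := chartAt (Model n) (e.symm z)
  have hcs : e.symm z ∈ c.source := mem_chart_source _ _
  have d1 := hasFDerivAt_transition he he' hz hz'
  have d2 := hasFDerivAt_transition he' (chart_mem_atlas (Model n) (e.symm z)) hzt
    (by rw [hx]; exact hcs)
  have d3 : HasFDerivAt ((c ∘ e'.symm) ∘ (e' ∘ e.symm))
      ((fderiv ℝ (c ∘ e'.symm) (e' (e.symm z))).comp (fderiv ℝ (e' ∘ e.symm) z)) z :=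
    HasFDerivAt.comp z d2 d1
  have he2 : (c ∘ e'.symm) ∘ (e' ∘ e.symm) =ᶠ[𝓝 z] c ∘ e.symm := by
    have : (e.symm ≫ₕ e').source ∈ 𝓝 z := (e.symm ≫ₕ e').open_source.mem_nhds (by simp [hz, hz'])
    filter_upwards [this] with y hy
    simp only [OpenPartialHomeomorph.trans_source, mem_inter_iff, mem_preimage] at hy
    simp [e'.left_inv hy.2]
  rw [← he2.fderiv_eq, d3.fderiv]
  rfl

/-- The measures `ηⁿ` of all charts are bounded, on a compact part of a given chart, by a fixed
multiple of its Lebesgue measure. -/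
lemma exists_chartMeasure_restrict_le {η : TwoForm n M} (hη : IsKahlerForm η)
    {e' : OpenPartialHomeomorph M (Model n)} (he' : e' ∈ atlas (Model n) M) {K : Set (Model n)}
    (hK : IsCompact K) (hKt : K ⊆ e'.target) {W : Set M} (hW : MeasurableSet W)
    (hWs : W ⊆ e'.source) (hWK : ∀ x ∈ W, e' x ∈ K) :
    ∃ C : ℝ≥0, ∀ e ∈ atlas (Model n) M,
      (chartMeasure η e).restrict W ≤ C • (chartVol e').restrict W := by
  have hc : ContinuousOn (fun z => topPower (η.inChart e' z)) K :=
    continuous_topPower.comp_continuousOn ((hη.smooth e' he').continuousOn.mono hKt)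
  obtain ⟨C, hC⟩ := hK.exists_bound_of_continuousOn hc
  refine ⟨C.toNNReal, fun e he => Measure.le_intro fun S hS _ => ?_⟩
  have hSW := hS.inter hW
  rw [Measure.restrict_apply hS, Measure.smul_apply, Measure.restrict_apply hS,
    chartVol_apply e' hSW, chartMeasure, Measure.map_apply_of_aemeasurable
      ((aemeasurable_symm e).mono_ac (withDensity_absolutelyContinuous _ _)) hSW,
    withDensity_apply', Measure.restrict_restrict' e.open_target.measurableSet, inter_comm]
  set D := e.target ∩ e.symm ⁻¹' (S ∩ W) with hDdef
  have hD : MeasurableSet D := measurableSet_target_inter e hSW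
  set T := e' ∘ e.symm
  have hinj : InjOn T D := by
    intro y hy z hz hyz
    have h1 := e'.injOn (hWs hy.2.2) (hWs hz.2.2) hyz
    exact e.symm.injOn hy.1 hz.1 h1
  calc ∫⁻ z in D, ENNReal.ofReal (topPower (η.inChart e z))
      ≤ ∫⁻ z in D, C.toNNReal * ENNReal.ofReal |(fderiv ℝ T z).det| := by
        refine setLIntegral_mono' hD fun z hz => ?_
        rw [inChart_transition η he he' hz.1 (hWs hz.2.2), topPower_compContinuousLinearMap]
        have h1 := hC _ (hWK _ hz.2.2)
        change _ ≤ ENNReal.ofReal C * _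
        rw [← ENNReal.ofReal_mul ((norm_nonneg _).trans h1)]
        refine ENNReal.ofReal_le_ofReal ((le_abs_self _).trans ?_)
        rw [abs_mul, mul_comm]
        exact mul_le_mul_of_nonneg_right h1 (abs_nonneg _)
    _ = C.toNNReal * ∫⁻ z in D, ENNReal.ofReal |(fderiv ℝ T z).det| :=
        lintegral_const_mul' _ _ ENNReal.coe_ne_top
    _ = C.toNNReal * volume (T '' D) := by
        rw [lintegral_abs_det_fderiv_eq_addHaar_image _ hD (fun z hz =>
          (hasFDerivAt_transition he he' hz.1 (hWs hz.2.2)).hasFDerivWithinAt) hinj]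
    _ ≤ C.toNNReal • volume (e'.target ∩ e'.symm ⁻¹' (S ∩ W)) := by
        rw [ENNReal.smul_def, smul_eq_mul]
        gcongr
        rintro _ ⟨z, hz, rfl⟩
        have hs := hWs hz.2.2
        refine ⟨e'.map_source hs, ?_⟩
        change e'.symm (e' (e.symm z)) ∈ S ∩ W
        rw [e'.left_inv hs]
        exact hz.2

/-- A finite measure on `M` which is locally comparable with the Lebesgue measures of charts and
dominates the measures `ηⁿ`. -/
theorem exists_reference_measure [CompactSpace M] [T2Space M] :
    ∃ ν : Measure M, IsFiniteMeasure ν ∧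
      (∀ p : M, ∃ U ∈ 𝓝 p, ∃ C : ℝ≥0, ν.restrict U ≤ C • chartVol (chartAt (Model n) p) ∧
        (chartVol (chartAt (Model n) p)).restrict U ≤ C • ν) ∧
      ∀ η : TwoForm n M, IsKahlerForm η → ∃ C : ℝ≥0, powerMeasure η ≤ C • ν := by
  have hball : ∀ p : M, ∃ r > 0, closedBall (chartAt (Model n) p p) r ⊆
      (chartAt (Model n) p).target := fun p =>
    nhds_basis_closedBall.mem_iff.1
      ((chartAt (Model n) p).open_target.mem_nhds (mem_chart_target (Model n) p))
  choose r hr hrsub using hball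
  set e : M → OpenPartialHomeomorph M (Model n) := fun p => chartAt (Model n) p with he_def
  have he : ∀ p, e p ∈ atlas (Model n) M := fun p => chart_mem_atlas _ _
  set W : M → Set M := fun p => (e p).source ∩ e p ⁻¹' ball (e p p) (r p) with hW
  have hWo : ∀ p, IsOpen (W p) := fun p => (e p).isOpen_inter_preimage isOpen_ball
  have hWp : ∀ p, p ∈ W p := fun p => ⟨mem_chart_source _ _, mem_ball_self (hr p)⟩
  obtain ⟨t, ht⟩ := CompactSpace.elim_nhds_subcover W fun p => (hWo p).mem_nhds (hWp p)
  have hcov : ∀ x, ∃ p ∈ t, x ∈ W p := fun x => by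
    have : x ∈ ⋃ p ∈ t, W p := ht ▸ mem_univ x
    simpa using this
  set ν : Measure M := ∑ p ∈ t, (chartVol (e p)).restrict (W p) with hν
  have hle : ∀ p ∈ t, (chartVol (e p)).restrict (W p) ≤ ν := fun p hp =>
    Finset.single_le_sum (f := fun p => (chartVol (e p)).restrict (W p))
      (fun _ _ => Measure.zero_le _) hp
  refine ⟨ν, ⟨?_⟩, fun p => ?_, fun η hη => ?_⟩
  · rw [hν, Measure.finsetSum_apply]
    refine ENNReal.sum_lt_top.2 fun p _ => ?_
    rw [Measure.restrict_apply MeasurableSet.univ, univ_inter,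
      chartVol_apply _ (hWo p).measurableSet]
    refine lt_of_le_of_lt (measure_mono fun z hz => ?_)
      (measure_closedBall_lt_top (x := e p p) (r := r p))
    have h1 : e p ((e p).symm z) ∈ ball (e p p) (r p) := hz.2.2
    rw [(e p).right_inv hz.1] at h1
    exact ball_subset_closedBall h1
  · -- each summand is bounded near `p`: either `p` lies in its chart, or away from its ball
    have hup : ∀ q ∈ t, ∃ U ∈ 𝓝 p, ∃ C : ℝ≥0,
        ((chartVol (e q)).restrict (W q)).restrict U ≤ C • chartVol (e p) := by
      intro q _
      by_cases hpq : p ∈ (e q).source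
      · obtain ⟨U, hU, C, h⟩ := exists_chartVol_restrict_le (he q) (he p) hpq
          (mem_chart_source _ _)
        obtain ⟨U', hU', hUo, hpU⟩ := mem_nhds_iff.1 hU
        refine ⟨U', hUo.mem_nhds hpU, C, ?_⟩
        rw [Measure.restrict_restrict hUo.measurableSet]
        exact (Measure.restrict_mono (inter_subset_left.trans hU') le_rfl).trans h
      · set F := (e q).symm '' closedBall (e q q) (r q) with hF
        have hFc : IsClosed F := ((isCompact_closedBall _ _).image_of_continuousOn
          ((e q).continuousOn_symm.mono (hrsub q))).isClosed
        have hpF : p ∈ Fᶜ := by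
          rintro ⟨z, hz, rfl⟩
          exact hpq ((e q).map_target (hrsub q hz))
        refine ⟨Fᶜ, hFc.isOpen_compl.mem_nhds hpF, 0, ?_⟩
        rw [Measure.restrict_restrict hFc.isOpen_compl.measurableSet]
        have : Fᶜ ∩ W q = ∅ := by
          refine eq_empty_of_forall_notMem fun x hx => hx.1 ⟨e q x, ball_subset_closedBall hx.2.2, ?_⟩
          exact (e q).left_inv hx.2.1
        rw [this, Measure.restrict_empty]
        exact Measure.zero_le _
    choose! U hU C hC using hup
    obtain ⟨q, hq, hpq⟩ := hcov p
    obtain ⟨V, hV, C', h'⟩ := exists_chartVol_restrict_le (he p) (he q) (mem_chart_source _ p) hpq.1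
    have hmem : ((⋂ q ∈ t, U q) ∩ (V ∩ W q)) ∈ 𝓝 p :=
      inter_mem ((biInter_finset_mem t).2 hU) (inter_mem hV ((hWo q).mem_nhds hpq))
    obtain ⟨O, hO, hOo, hpO⟩ := mem_nhds_iff.1 hmem
    refine ⟨O, hOo.mem_nhds hpO, max (∑ q ∈ t, C q) C', ?_, ?_⟩
    · refine Measure.le_intro fun S hS _ => ?_
      rw [Measure.restrict_apply hS, hν, Measure.finsetSum_apply, Measure.smul_apply]
      calc ∑ q ∈ t, (chartVol (e q)).restrict (W q) (S ∩ O)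
          ≤ ∑ q ∈ t, C q • chartVol (e p) S := by
            refine Finset.sum_le_sum fun q hq => ?_
            refine le_trans ?_ (hC q hq S)
            rw [Measure.restrict_apply hS]
            refine measure_mono (inter_subset_inter_right _ fun x hx => ?_)
            exact mem_iInter₂.1 (hO hx).1 q hq
        _ = (∑ q ∈ t, C q) • chartVol (e p) S := by rw [Finset.sum_smul]
        _ ≤ _ := by
            gcongr
            exact le_max_left _ _
    · refine Measure.le_intro fun S hS _ => ?_
      rw [Measure.restrict_apply hS, Measure.smul_apply]
      have hSO : MeasurableSet (S ∩ O) := hS.inter hOo.measurableSet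
      calc chartVol (e p) (S ∩ O) = (chartVol (e p)).restrict V (S ∩ O) := by
            rw [Measure.restrict_apply hSO, inter_assoc,
              inter_eq_left.2 fun x (hx : x ∈ O) => (hO hx).2.1]
        _ ≤ C' • chartVol (e q) (S ∩ O) := h' _
        _ = C' • (chartVol (e q)).restrict (W q) (S ∩ O) := by
            rw [Measure.restrict_apply hSO, inter_assoc,
              inter_eq_left.2 fun x (hx : x ∈ O) => (hO hx).2.2]
        _ ≤ max (∑ q ∈ t, C q) C' • ν S := by
            refine smul_le_smul (le_max_right _ _) ?_ zero_le zero_le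
            exact (hle q hq _).trans (measure_mono inter_subset_left)
  · have hb : ∀ q : M, ∃ C : ℝ≥0, ∀ e' ∈ atlas (Model n) M,
        (chartMeasure η e').restrict (W q) ≤ C • (chartVol (e q)).restrict (W q) := fun q =>
      exists_chartMeasure_restrict_le hη (he q) (isCompact_closedBall _ _) (hrsub q)
        (hWo q).measurableSet inter_subset_left fun x hx => ball_subset_closedBall hx.2
    choose C hC using hb
    refine ⟨∑ q ∈ t, C q, ?_⟩
    rw [powerMeasure]
    refine iSup₂_le fun e' he' => Measure.le_intro fun S hS _ => ?_
    calc chartMeasure η e' S ≤ chartMeasure η e' (⋃ q ∈ t, S ∩ W q) := by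
          refine measure_mono fun x hx => ?_
          obtain ⟨q, hq, hxq⟩ := hcov x
          exact mem_biUnion hq ⟨hx, hxq⟩
      _ ≤ ∑ q ∈ t, chartMeasure η e' (S ∩ W q) := measure_biUnion_finset_le _ _
      _ ≤ ∑ q ∈ t, C q • ν S := by
          refine Finset.sum_le_sum fun q hq => ?_
          rw [← Measure.restrict_apply hS]
          refine (hC q e' he' S).trans ?_
          rw [Measure.smul_apply]
          gcongr
          exact hle q hq
      _ = _ := by rw [Measure.smul_apply, Finset.sum_smul]

end Measures

/-! ### Uniform `L¹` bounds for normalised potentials -/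

section Euclidean

variable {n : ℕ} {φ : Model n → ℝ} {z₀ : Model n} {R Q : ℝ}

lemma lintegral_comp_ray_eq (hφ : Continuous φ) {ρ t : ℝ} {x : Model n}
    (hQ : ∀ v ∈ closedBall (0 : Model n) ρ, φ (x + t • v) ≤ Q) :
    ∫⁻ v in closedBall (0 : Model n) ρ, ENNReal.ofReal (Q - φ (x + t • v)) =
      ENNReal.ofReal (volume.real (closedBall (0 : Model n) ρ) * Q - ballInt φ ρ x t) := by
  have hK : IsCompact (closedBall (0 : Model n) ρ) := isCompact_closedBall _ _
  rw [← ofReal_integral_eq_lintegral_ofReal (integrable_of_continuous hK (by fun_prop))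
    ((ae_restrict_iff' measurableSet_closedBall).2
      (Eventually.of_forall fun v hv => sub_nonneg.2 (hQ v hv))),
    integral_sub (integrable_of_continuous hK continuous_const)
      (integrable_of_continuous hK (by fun_prop)), setIntegral_const, smul_eq_mul]
  rfl

/-- Sub-mean value inequality for a plurisubharmonic function bounded above. -/
lemma lintegral_sub_le_of_levi_nonneg (hφ : ContDiff ℝ 2 φ)
    (hpos : ∀ z ∈ closedBall z₀ (3 * R), ∀ v, 0 ≤ levi φ z v)
    (hQ : ∀ z ∈ closedBall z₀ (3 * R), φ z ≤ Q) {x : Model n} (hx : x ∈ closedBall z₀ R) :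
    ∫⁻ z in closedBall z₀ R, ENNReal.ofReal (Q - φ z) ≤
      volume (closedBall (0 : Model n) (2 * R)) * ENNReal.ofReal (Q - φ x) := by
  have hin : ∀ v ∈ closedBall (0 : Model n) (2 * R), x + (1 : ℝ) • v ∈ closedBall z₀ (3 * R) := by
    intro v hv
    rw [mem_closedBall, dist_eq_norm] at hx ⊢
    have hv' : ‖v‖ ≤ 2 * R := by simpa using hv
    calc ‖x + (1 : ℝ) • v - z₀‖ = ‖(x - z₀) + v‖ := by congr 1; simp; abel
      _ ≤ ‖x - z₀‖ + ‖v‖ := norm_add_le _ _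
      _ ≤ _ := by linarith
  have h1 : ∫⁻ z in closedBall z₀ R, ENNReal.ofReal (Q - φ z) ≤
      ∫⁻ v in closedBall (0 : Model n) (2 * R), ENNReal.ofReal (Q - φ (x + (1 : ℝ) • v)) := by
    have := setLIntegral_comp_add_le (A := closedBall z₀ R) (B := closedBall (0 : Model n) (2 * R))
      measurableSet_closedBall measurableSet_closedBall (-x) (fun z hz => ?_)
      (fun v => ENNReal.ofReal (Q - φ (x + (1 : ℝ) • v)))
    · simpa using this
    · have h2 := dist_triangle_right z x z₀
      rw [mem_closedBall] at hz hx
      rw [mem_closedBall_zero_iff, ← sub_eq_add_neg, ← dist_eq_norm]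
      linarith
  refine h1.trans ?_
  rw [lintegral_comp_ray_eq hφ.continuous fun v hv => hQ _ (hin v hv),
    ← ENNReal.ofReal_toReal (volume_closedBall_ne_top (0 : Model n) (2 * R)),
    ← ENNReal.ofReal_mul ENNReal.toReal_nonneg]
  refine ENNReal.ofReal_le_ofReal ?_
  have h3 := ballInt_mono (T := 1) (ρ := 2 * R) (x := x) hφ
    (levi_ray_nonneg (S := R) (T := 1) (R := 2 * R) (by
      convert hpos using 3; ring_nf) hx) (t := 1) ⟨zero_le_one, le_rfl⟩
  have h4 : ballInt φ (2 * R) x 0 = volume.real (closedBall (0 : Model n) (2 * R)) * φ x := by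
    simp [ballInt]
  rw [h4] at h3
  rw [mul_sub]
  change _ ≤ volume.real _ * _ - volume.real _ * _
  linarith

/-- The Lelong masses of a plurisubharmonic function bounded above are controlled by its `L¹`
norm. -/
lemma lelong_le_of_lintegral_le (hφ : ContDiff ℝ 2 φ)
    (hpos : ∀ z ∈ closedBall z₀ (5 * R), ∀ v, 0 ≤ levi φ z v)
    (hQ : ∀ z ∈ closedBall z₀ (5 * R), φ z ≤ Q) {N : ℝ} (hN : 0 ≤ N)
    (hint : ∫⁻ z in closedBall z₀ (5 * R), ENNReal.ofReal (Q - φ z) ≤ ENNReal.ofReal N)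
    {x : Model n} (hx : x ∈ closedBall z₀ (3 * R)) : lelong φ R x 1 ≤ 2 * N := by
  have hin : ∀ t ∈ Icc (0 : ℝ) 2, ∀ v ∈ closedBall (0 : Model n) R,
      x + t • v ∈ closedBall z₀ (5 * R) := by
    intro t ht v hv
    rw [mem_closedBall, dist_eq_norm] at hx ⊢
    have hv' : ‖v‖ ≤ R := by simpa using hv
    calc ‖x + t • v - z₀‖ = ‖(x - z₀) + t • v‖ := by congr 1; abel
      _ ≤ ‖x - z₀‖ + ‖t • v‖ := norm_add_le _ _
      _ ≤ 3 * R + 2 * R := by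
          rw [norm_smul, Real.norm_eq_abs, abs_of_nonneg ht.1]
          exact add_le_add hx (mul_le_mul ht.2 hv' (norm_nonneg _) zero_le_two)
      _ = _ := by ring
  have h1 := lelong_le (T := 2) (ρ := R) (x := x) hφ (fun t ht v hv => hpos _ (hin t ht v hv) v)
    (t := 1) one_pos (by norm_num)
  have h2 : ballInt φ R x (2 * 1) ≤ volume.real (closedBall (0 : Model n) R) * Q := by
    have hK : IsCompact (closedBall (0 : Model n) R) := isCompact_closedBall _ _
    have hc := hφ.continuous
    have h0 : ∫ _ in closedBall (0 : Model n) R, Q =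
        volume.real (closedBall (0 : Model n) R) * Q := by rw [setIntegral_const, smul_eq_mul]
    rw [ballInt, ← h0]
    exact setIntegral_mono_on (integrable_of_continuous hK (by fun_prop))
      (integrable_of_continuous hK continuous_const) measurableSet_closedBall
      fun v hv => hQ _ (hin _ (by norm_num) v hv)
  have h3 : ENNReal.ofReal (volume.real (closedBall (0 : Model n) R) * Q - ballInt φ R x 1) ≤
      ENNReal.ofReal N := by
    rw [← lintegral_comp_ray_eq hφ.continuous fun v hv => hQ _ (hin _ (by norm_num) v hv)]
    refine le_trans ?_ hint
    have := setLIntegral_comp_add_le (A := closedBall (0 : Model n) R) (B := closedBall z₀ (5 * R))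
      measurableSet_closedBall measurableSet_closedBall x (fun v hv => ?_)
      (fun z => ENNReal.ofReal (Q - φ z))
    · simpa [add_comm] using this
    · have := hin 1 (by norm_num) v hv
      simpa [add_comm] using this
  have h4 := (ENNReal.ofReal_le_ofReal_iff hN).1 h3
  linarith

end Euclidean

section Transfer

variable {n : ℕ} {M : Type*} [TopologicalSpace M] [MeasurableSpace M] [BorelSpace M]
  {ν : Measure M} {e : OpenPartialHomeomorph M (Model n)} {W : Set M} {B : Set (Model n)} {C : ℝ≥0}

/-- Comparison of integrals over a chart with integrals over the manifold, where the measure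
dominates the Lebesgue measure of the chart. -/
lemma lintegral_symm_le (hB : B ⊆ e.target) (hBm : MeasurableSet B) (hW : MeasurableSet W)
    (hBW : ∀ z ∈ B, e.symm z ∈ W) {f : M → ℝ≥0∞} (hf : Measurable f)
    (h : (chartVol e).restrict W ≤ C • ν) :
    ∫⁻ z in B, f (e.symm z) ≤ C * ∫⁻ x in W, f x ∂ν := by
  calc ∫⁻ z in B, f (e.symm z) = ∫⁻ z in B, W.indicator f (e.symm z) :=
        setLIntegral_congr_fun hBm fun z hz => by simp [hBW z hz]
    _ ≤ ∫⁻ z in e.target, W.indicator f (e.symm z) := lintegral_mono_set hB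
    _ = ∫⁻ x in W, f x ∂chartVol e := by
        rw [chartVol, ← lintegral_indicator hW, lintegral_map' (hf.indicator hW).aemeasurable
          (aemeasurable_symm e)]
    _ = ∫⁻ x in W, f x ∂(chartVol e).restrict W := by
        rw [Measure.restrict_restrict hW, inter_self]
    _ ≤ ∫⁻ x in W, f x ∂(C • ν) := lintegral_mono' (Measure.restrict_mono subset_rfl h) le_rfl
    _ = C * ∫⁻ x in W, f x ∂ν := by
        rw [Measure.restrict_smul, lintegral_smul_measure, ENNReal.smul_def, smul_eq_mul]

/-- The converse of `lintegral_symm_le`, which needs no measurability of the integrand. -/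
lemma lintegral_le_symm (hW : MeasurableSet W) (hWB : ∀ x ∈ W, e x ∈ B)
    (f : M → ℝ≥0∞) (h : ν.restrict W ≤ C • chartVol e) :
    ∫⁻ x in W, f x ∂ν ≤ C * ∫⁻ z in B, f (e.symm z) := by
  calc ∫⁻ x in W, f x ∂ν = ∫⁻ x in W, f x ∂ν.restrict W := by
        rw [Measure.restrict_restrict hW, inter_self]
    _ ≤ ∫⁻ x in W, f x ∂(C • chartVol e) :=
        lintegral_mono' (Measure.restrict_mono subset_rfl h) le_rfl
    _ = C * ∫⁻ x in W, f x ∂chartVol e := by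
        rw [Measure.restrict_smul, lintegral_smul_measure, ENNReal.smul_def, smul_eq_mul]
    _ ≤ C * ∫⁻ z in B, f (e.symm z) := by
        gcongr
        rw [chartVol, Measure.restrict_map_of_aemeasurable (aemeasurable_symm e) hW,
          Measure.restrict_restrict' e.open_target.measurableSet]
        refine (lintegral_map_le _ _).trans (lintegral_mono_set fun z hz => ?_)
        have := hWB _ hz.1
        rwa [e.right_inv hz.2] at this

end Transfer

section Potentials

variable {n : ℕ} {M : Type*} [TopologicalSpace M] [ChartedSpace (Model n) M]

/-- The nonpositive smooth potentials of the Kähler forms in the class of `ω₀`. -/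
def nonposPotentials (ω₀ : TwoForm n M) : Set (M → ℝ) :=
  {ψ | ContMDiff 𝓘(ℝ, Model n) 𝓘(ℝ, ℝ) ∞ ψ ∧ IsKahlerForm (ω₀ + ddc ψ) ∧ ∀ x, ψ x ≤ 0}

lemma ddc_sub_const (ψ : M → ℝ) (c : ℝ) : ddc (n := n) (fun x => ψ x - c) = ddc ψ := by
  funext x
  have h : dcLocal ((fun x => ψ x - c) ∘ (chartAt (Model n) x).symm) =
      dcLocal (ψ ∘ (chartAt (Model n) x).symm) := by
    funext z
    have : fderiv ℝ ((fun x => ψ x - c) ∘ (chartAt (Model n) x).symm) z =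
        fderiv ℝ (ψ ∘ (chartAt (Model n) x).symm) z :=
      fderiv_sub_const (f := ψ ∘ (chartAt (Model n) x).symm) c
    rw [dcLocal, dcLocal, this]
  rw [ddc, ddc, ddcLocal, ddcLocal, h]

/-- Every potential can be normalised to have maximum `0`. -/
lemma exists_normalised_potential [CompactSpace M] [Nonempty M] {ω₀ : TwoForm n M} {ψ : M → ℝ}
    (hψ : ContMDiff 𝓘(ℝ, Model n) 𝓘(ℝ, ℝ) ∞ ψ) (hω : IsKahlerForm (ω₀ + ddc ψ)) :
    ∃ χ ∈ nonposPotentials ω₀, ddc (n := n) χ = ddc ψ ∧ ∃ x, χ x = 0 := by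
  obtain ⟨x, -, hx⟩ := isCompact_univ.exists_isMaxOn univ_nonempty hψ.continuous.continuousOn
  refine ⟨fun y => ψ y - ψ x, ⟨hψ.sub contMDiff_const, ?_, fun y => ?_⟩, ddc_sub_const _ _, x,
    sub_self _⟩
  · rwa [ddc_sub_const]
  · have := hx (mem_univ y)
    exact sub_nonpos.2 this

variable [MeasurableSpace M] [BorelSpace M]

variable (n) in
/-- Local comparability of a measure with the Lebesgue measures of the preferred charts. -/
def LocallyLebesgue (ν : Measure M) : Prop :=
  ∀ p : M, ∃ U ∈ 𝓝 p, ∃ C : ℝ≥0, ν.restrict U ≤ C • chartVol (chartAt (Model n) p) ∧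
    (chartVol (chartAt (Model n) p)).restrict U ≤ C • ν

variable {ν : Measure M}

lemma LocallyLebesgue.measure_ne_zero (hν : LocallyLebesgue n ν) {p : M} {V : Set M}
    (hV : V ∈ 𝓝 p) : ν V ≠ 0 := by
  obtain ⟨U, hU, C, -, h⟩ := hν p
  set e := chartAt (Model n) p
  obtain ⟨O, hO, hOo, hpO⟩ := mem_nhds_iff.1
    (inter_mem (inter_mem hU hV) (e.open_source.mem_nhds (mem_chart_source _ p)))
  intro h0
  have h1 : chartVol e O ≤ 0 := by
    calc chartVol e O = (chartVol e).restrict U O := by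
          rw [Measure.restrict_apply hOo.measurableSet, inter_eq_left.2 fun x hx => (hO hx).1.1]
      _ ≤ (C • ν) O := h O
      _ ≤ C • ν V := by
          rw [Measure.smul_apply]
          gcongr
          exact fun x hx => (hO hx).1.2
      _ = 0 := by simp [h0]
  rw [chartVol_apply e hOo.measurableSet] at h1
  refine (e.isOpen_inter_preimage_symm hOo).measure_ne_zero volume ⟨e p, ?_⟩ (le_antisymm h1 zero_le)
  refine ⟨mem_chart_target _ _, ?_⟩
  rw [mem_preimage, e.left_inv (mem_chart_source _ p)]
  exact hpO

omit [MeasurableSpace M] [BorelSpace M] in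
/-- A chart ball of any multiple of a radius around `p` inside a given neighbourhood. -/
lemma exists_chart_ball (p : M) {U : Set M} (hU : U ∈ 𝓝 p) {k : ℝ} (hk : 0 < k) : ∃ R > 0,
    closedBall (chartAt (Model n) p p) (k * R) ⊆ (chartAt (Model n) p).target ∧
    ∀ z ∈ closedBall (chartAt (Model n) p p) (k * R), (chartAt (Model n) p).symm z ∈ interior U := by
  set e := chartAt (Model n) p
  have hmem : e.target ∩ e.symm ⁻¹' interior U ∈ 𝓝 (e p) :=
    (e.isOpen_inter_preimage_symm isOpen_interior).mem_nhds ⟨mem_chart_target _ _, by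
      rw [mem_preimage, e.left_inv (mem_chart_source _ p)]
      exact mem_interior_iff_mem_nhds.2 hU⟩
  obtain ⟨R, hR, h⟩ := nhds_basis_closedBall.mem_iff.1 hmem
  refine ⟨R / k, by positivity, ?_, ?_⟩ <;> rw [mul_div_cancel₀ _ hk.ne']
  exacts [fun z hz => (h hz).1, fun z hz => (h hz).2]

omit [MeasurableSpace M] [BorelSpace M] in
lemma chart_preimage_ball_mem (p : M) {R : ℝ} (hR : 0 < R) :
    (chartAt (Model n) p).source ∩ chartAt (Model n) p ⁻¹' ball (chartAt (Model n) p p) R ∈ 𝓝 p :=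
  ((chartAt (Model n) p).isOpen_inter_preimage isOpen_ball).mem_nhds
    ⟨mem_chart_source _ _, mem_ball_self hR⟩

variable [IsManifold 𝓘(ℂ, Model n) ω M]

/-- Near a point, the `L¹` norm of a nonpositive potential is controlled by its values. -/
lemma exists_nhds_lintegral_neg_le {ω₀ : TwoForm n M} (hω₀ : IsKahlerForm ω₀)
    (hν : LocallyLebesgue n ν) (p : M) :
    ∃ W ∈ 𝓝 p, ∃ C : ℝ≥0, ∀ ψ ∈ nonposPotentials ω₀, ∀ x ∈ W,
      ∫⁻ y in W, ENNReal.ofReal (-ψ y) ∂ν ≤ C * (1 + ENNReal.ofReal (-ψ x)) := by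
  obtain ⟨U, hU, C, hC, -⟩ := hν p
  set e := chartAt (Model n) p
  have he : e ∈ atlas (Model n) M := chart_mem_atlas _ _
  obtain ⟨R, hR, hsub, hin⟩ := exists_chart_ball (n := n) p hU (k := 6) (by norm_num)
  rw [show (6 : ℝ) * R = 2 * (3 * R) by ring] at hsub hin
  obtain ⟨_, _, A, hA, hup⟩ := exists_inChart_bounds hω₀ he (isCompact_closedBall _ _) hsub
  obtain ⟨q, hq⟩ := (isCompact_closedBall (e p) (3 * R)).exists_bound_of_continuousOn
    (contDiff_euclSq (n := n)).continuous.continuousOn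
  set W := e.source ∩ e ⁻¹' ball (e p) R
  have hWo : IsOpen W := e.isOpen_inter_preimage isOpen_ball
  have hWB : ∀ x ∈ W, e x ∈ closedBall (e p) R := fun x hx => ball_subset_closedBall hx.2
  have hWU : W ⊆ U := fun x hx => by
    have h1 := hin (e x) (closedBall_subset_closedBall (by linarith) (hWB x hx))
    rw [e.left_inv hx.1] at h1
    exact interior_subset h1
  set Q := A / 2 * q
  set D : ℝ≥0∞ := C * volume (closedBall (0 : Model n) (2 * R)) * (1 + ENNReal.ofReal Q)
  have hD : D ≠ ⊤ := ENNReal.mul_ne_top (ENNReal.mul_ne_top ENNReal.coe_ne_top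
    (volume_closedBall_ne_top _ _)) (by simp)
  refine ⟨W, chart_preimage_ball_mem p hR, D.toNNReal, fun ψ hψ x hx => ?_⟩
  obtain ⟨φ, hφ, hφe, hφl⟩ := exists_local_potential hψ.1 hψ.2.1 he (R := 3 * R) (by positivity)
    hA.le hsub fun z hz v => (hup z hz v).2
  have hq0 : ∀ z ∈ closedBall (e p) (3 * R), 0 ≤ A / 2 * euclSq z ∧ A / 2 * euclSq z ≤ Q := by
    intro z hz
    have h1 : 0 ≤ euclSq z := Finset.sum_nonneg fun _ _ => by positivity
    exact ⟨by positivity, mul_le_mul_of_nonneg_left ((le_abs_self _).trans (hq z hz))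
      (by positivity)⟩
  have hx3 : e x ∈ closedBall (e p) (3 * R) :=
    closedBall_subset_closedBall (by linarith) (hWB x hx)
  calc ∫⁻ y in W, ENNReal.ofReal (-ψ y) ∂ν
      ≤ C * ∫⁻ z in closedBall (e p) R, ENNReal.ofReal (-ψ (e.symm z)) :=
        lintegral_le_symm hWo.measurableSet hWB (fun y => ENNReal.ofReal (-ψ y))
          ((Measure.restrict_mono hWU le_rfl).trans hC)
    _ ≤ C * ∫⁻ z in closedBall (e p) R, ENNReal.ofReal (Q - φ z) := by
        refine mul_le_mul_right (setLIntegral_mono' measurableSet_closedBall fun z hz =>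
          ENNReal.ofReal_le_ofReal ?_) _
        have hz3 := closedBall_subset_closedBall (by linarith : R ≤ 3 * R) hz
        rw [hφe z hz3]
        linarith [(hq0 z hz3).2]
    _ ≤ C * (volume (closedBall (0 : Model n) (2 * R)) * ENNReal.ofReal (Q - φ (e x))) := by
        gcongr
        refine lintegral_sub_le_of_levi_nonneg hφ (fun z hz v => (hφl z hz v).2)
          (fun z hz => ?_) (hWB x hx)
        rw [hφe z hz]
        linarith [(hq0 z hz).2, hψ.2.2 (e.symm z)]
    _ ≤ C * (volume (closedBall (0 : Model n) (2 * R)) *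
          ((1 + ENNReal.ofReal Q) * (1 + ENNReal.ofReal (-ψ x)))) := by
        gcongr
        have h1 : Q - φ (e x) ≤ Q + -ψ x := by
          rw [hφe _ hx3, e.left_inv hx.1]
          linarith [(hq0 _ hx3).1]
        calc ENNReal.ofReal (Q - φ (e x)) ≤ ENNReal.ofReal Q + ENNReal.ofReal (-ψ x) :=
              (ENNReal.ofReal_le_ofReal h1).trans ENNReal.ofReal_add_le
          _ ≤ (1 + ENNReal.ofReal Q) * (1 + ENNReal.ofReal (-ψ x)) := by
              rw [one_add_mul, mul_add, mul_one, add_comm (ENNReal.ofReal Q)]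
              exact add_le_add le_add_self le_self_add
    _ = D.toNNReal * (1 + ENNReal.ofReal (-ψ x)) := by
        rw [ENNReal.coe_toNNReal hD]
        ring

/-- Nonpositive potentials are bounded in `L¹` in terms of their value at any point: the local bound
propagates along chains of neighbourhoods, since a function with a small mean over an open set takes
a small value there. -/
theorem exists_lintegral_neg_le [CompactSpace M] [PreconnectedSpace M] [IsFiniteMeasure ν]
    {ω₀ : TwoForm n M} (hω₀ : IsKahlerForm ω₀) (hν : LocallyLebesgue n ν) :
    ∃ C : ℝ≥0, ∀ ψ ∈ nonposPotentials ω₀, ∀ x,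
      ∫⁻ y, ENNReal.ofReal (-ψ y) ∂ν ≤ C * (1 + ENNReal.ofReal (-ψ x)) := by
  have hpair : ∀ p q : M, ∃ U ∈ 𝓝 p, ∃ V ∈ 𝓝 q, ∃ C : ℝ≥0, ∀ ψ ∈ nonposPotentials ω₀, ∀ x ∈ U,
      ∫⁻ y in V, ENNReal.ofReal (-ψ y) ∂ν ≤ C * (1 + ENNReal.ofReal (-ψ x)) := by
    intro p q
    refine PreconnectedSpace.induction₂' (fun p q : M => ∃ U ∈ 𝓝 p, ∃ V ∈ 𝓝 q, ∃ C : ℝ≥0,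
      ∀ ψ ∈ nonposPotentials ω₀, ∀ x ∈ U,
        ∫⁻ y in V, ENNReal.ofReal (-ψ y) ∂ν ≤ C * (1 + ENNReal.ofReal (-ψ x)))
      (fun p => ?_) ⟨?_⟩ p q
    · obtain ⟨W, hW, C, hC⟩ := exists_nhds_lintegral_neg_le hω₀ hν p
      filter_upwards [eventually_mem_nhds_iff.2 hW] with y hy
      exact ⟨⟨W, hW, W, hy, C, hC⟩, ⟨W, hy, W, hW, C, hC⟩⟩
    · rintro p q r ⟨U, hU, V, hV, C, hC⟩ ⟨V', hV', W, hW, C', hC'⟩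
      have hS := inter_mem hV hV'
      have hS0 := hν.measure_ne_zero hS
      have hSt : ν (V ∩ V') ≠ ⊤ := measure_ne_top _ _
      have hD : (C : ℝ≥0∞) / ν (V ∩ V') ≠ ⊤ := ENNReal.div_ne_top ENNReal.coe_ne_top hS0
      refine ⟨U, hU, W, hW, C' * (1 + ((C : ℝ≥0∞) / ν (V ∩ V')).toNNReal), fun ψ hψ x hx => ?_⟩
      obtain ⟨z, hz, hzle⟩ := exists_le_setLAverage (s := V ∩ V') (f := fun y => ENNReal.ofReal (-ψ y))
        hS0 hSt (hψ.1.continuous.neg.measurable.ennreal_ofReal.aemeasurable)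
      rw [setLAverage_eq] at hzle
      have h1 : ENNReal.ofReal (-ψ z) ≤
          (C : ℝ≥0∞) / ν (V ∩ V') * (1 + ENNReal.ofReal (-ψ x)) := by
        refine hzle.trans ?_
        rw [ENNReal.mul_div_right_comm.symm]
        gcongr
        exact (lintegral_mono_set inter_subset_left).trans (hC ψ hψ x hx)
      refine (hC' ψ hψ z hz.2).trans ?_
      push_cast
      rw [ENNReal.coe_toNNReal hD, mul_assoc]
      gcongr
      rw [one_add_mul]
      gcongr
      exact le_self_add
  have hpoint : ∀ p : M, ∃ C : ℝ≥0, ∀ᶠ x in 𝓝 p, ∀ ψ ∈ nonposPotentials ω₀,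
      ∫⁻ y, ENNReal.ofReal (-ψ y) ∂ν ≤ C * (1 + ENNReal.ofReal (-ψ x)) := by
    intro p
    have := isCompact_univ.induction_on (p := fun s : Set M => ∃ C : ℝ≥0, ∀ᶠ x in 𝓝 p,
      ∀ ψ ∈ nonposPotentials ω₀,
        ∫⁻ y in s, ENNReal.ofReal (-ψ y) ∂ν ≤ C * (1 + ENNReal.ofReal (-ψ x)))
      ⟨0, Eventually.of_forall fun x ψ _ => by simp⟩ ?_ ?_ ?_
    · simpa using this
    · rintro s t hst ⟨C, hC⟩
      exact ⟨C, hC.mono fun x hx ψ hψ => (lintegral_mono_set hst).trans (hx ψ hψ)⟩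
    · rintro s t ⟨C, hC⟩ ⟨C', hC'⟩
      refine ⟨C + C', ?_⟩
      filter_upwards [hC, hC'] with x hx hx' ψ hψ
      refine (lintegral_union_le _ _ _).trans ?_
      push_cast
      rw [add_mul]
      exact add_le_add (hx ψ hψ) (hx' ψ hψ)
    · intro q _
      obtain ⟨U, hU, V, hV, C, hC⟩ := hpair p q
      refine ⟨V, mem_nhdsWithin_of_mem_nhds hV, C, ?_⟩
      filter_upwards [hU] with x hx ψ hψ using hC ψ hψ x hx
  obtain ⟨C, hC⟩ := exists_uniform_of_locally (X := M) (P := fun C x => ∀ ψ ∈ nonposPotentials ω₀,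
      ∫⁻ y, ENNReal.ofReal (-ψ y) ∂ν ≤ C * (1 + ENNReal.ofReal (-ψ x)))
    (fun C C' x hCC h ψ hψ => (h ψ hψ).trans (by gcongr)) hpoint
  exact ⟨C, fun ψ hψ x => hC x ψ hψ⟩

end Potentials

/-! ### Exponential integrability of distances -/

/-- The exponential of the mean of two lengths is at most the sum of their exponentials: this splits
a broken path into its two legs. -/
lemma eexp_div_le (C₁ C₂ : ℝ≥0) {a b d : ℝ≥0∞} (h : d ≤ a + b) :
    eexp (d / (2 * (C₁ + C₂) : ℝ≥0)) ≤ eexp (a / C₁) + eexp (b / C₂) := by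
  refine (eexp_mono ?_).trans (eexp_half_add_le _ _)
  rw [ENNReal.coe_mul, ENNReal.coe_ofNat, ENNReal.le_div_iff_mul_le (by simp) (by simp),
    mul_comm, ← mul_div_assoc,
    ENNReal.mul_div_mul_left _ _ two_ne_zero ENNReal.ofNat_ne_top]
  refine (ENNReal.div_le_div_right h _).trans ?_
  rw [ENNReal.add_div]
  gcongr
  · exact le_self_add
  · exact le_add_self

/-- For a family of distances on a compact connected space, local uniform exponential integrability
implies global uniform exponential integrability. -/
theorem exists_lintegral_eexp_le_of_connected {X : Type*} [TopologicalSpace X] [CompactSpace X]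
    [PreconnectedSpace X] [MeasurableSpace X] {ν : Measure X} [IsFiniteMeasure ν]
    (hpos : ∀ p, ∀ V ∈ 𝓝 p, ν V ≠ 0) {𝓓 : Set (X → X → ℝ≥0∞)}
    (hmeas : ∀ D ∈ 𝓓, Measurable (Function.uncurry D))
    (htri : ∀ D ∈ 𝓓, ∀ x y z, D x z ≤ D x y + D y z)
    (hloc : ∀ p, ∃ W ∈ 𝓝 p, ∃ C C' : ℝ≥0, 0 < C ∧ ∀ D ∈ 𝓓,
      ∫⁻ x in W, ∫⁻ y in W, eexp (D x y / C) ∂ν ∂ν ≤ C') :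
    ∃ C C' : ℝ≥0, 0 < C ∧ ∀ D ∈ 𝓓, ∫⁻ q, eexp (D q.1 q.2 / C) ∂ν.prod ν ≤ C' := by
  have hme : ∀ D ∈ 𝓓, ∀ C : ℝ≥0, Measurable fun q : X × X => eexp (D q.1 q.2 / C) := fun D hD C =>
    measurable_eexp.comp ((hmeas D hD).div_const _)
  have hpair : ∀ p q : X, ∃ U ∈ 𝓝 p, ∃ V ∈ 𝓝 q, ∃ C C' : ℝ≥0, 0 < C ∧ ∀ D ∈ 𝓓,
      ∫⁻ x in U, ∫⁻ y in V, eexp (D x y / C) ∂ν ∂ν ≤ C' := by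
    intro p q
    refine PreconnectedSpace.induction₂' (fun p q : X => ∃ U ∈ 𝓝 p, ∃ V ∈ 𝓝 q, ∃ C C' : ℝ≥0,
      0 < C ∧ ∀ D ∈ 𝓓, ∫⁻ x in U, ∫⁻ y in V, eexp (D x y / C) ∂ν ∂ν ≤ C') (fun p => ?_) ⟨?_⟩ p q
    · obtain ⟨W, hW, C, C', hC, h⟩ := hloc p
      filter_upwards [eventually_mem_nhds_iff.2 hW] with y hy
      exact ⟨⟨W, hW, W, hy, C, C', hC, h⟩, ⟨W, hy, W, hW, C, C', hC, h⟩⟩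
    · rintro p q r ⟨U, hU, V, hV, C₁, K₁, hC₁, h₁⟩ ⟨V', hV', W, hW, C₂, K₂, hC₂, h₂⟩
      set S := V ∩ V'
      have hS0 : ν S ≠ 0 := hpos q S (inter_mem hV hV')
      set K : ℝ≥0∞ := (ν W * K₁ + ν U * K₂) / ν S
      have hK : K ≠ ⊤ := ENNReal.div_ne_top (ENNReal.add_ne_top.2
        ⟨ENNReal.mul_ne_top (measure_ne_top _ _) ENNReal.coe_ne_top,
          ENNReal.mul_ne_top (measure_ne_top _ _) ENNReal.coe_ne_top⟩) hS0
      refine ⟨U, hU, W, hW, 2 * (C₁ + C₂), K.toNNReal, by positivity, fun D hD => ?_⟩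
      rw [ENNReal.coe_toNNReal hK, ENNReal.le_div_iff_mul_le (Or.inl hS0)
        (Or.inl (measure_ne_top _ _))]
      have hm₁ := hme D hD C₁
      have hm₂ := hme D hD C₂
      have hg₁ : Measurable fun y => ∫⁻ x in U, eexp (D x y / C₁) ∂ν := hm₁.lintegral_prod_left'
      have hg₂ : Measurable fun y => ∫⁻ z in W, eexp (D y z / C₂) ∂ν := hm₂.lintegral_prod_right'
      -- compare with the two legs through a middle point, then average over the middle point
      have hmid : ∀ y, ∫⁻ x in U, ∫⁻ z in W, eexp (D x z / (2 * (C₁ + C₂) : ℝ≥0)) ∂ν ∂ν ≤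
          ν W * (∫⁻ x in U, eexp (D x y / C₁) ∂ν) + ν U * ∫⁻ z in W, eexp (D y z / C₂) ∂ν := by
        intro y
        have hmx : Measurable fun x => eexp (D x y / C₁) :=
          hm₁.comp (measurable_id.prodMk measurable_const)
        calc ∫⁻ x in U, ∫⁻ z in W, eexp (D x z / (2 * (C₁ + C₂) : ℝ≥0)) ∂ν ∂ν
            ≤ ∫⁻ x in U, ∫⁻ z in W, (eexp (D x y / C₁) + eexp (D y z / C₂)) ∂ν ∂ν :=
              lintegral_mono fun x => lintegral_mono fun z => eexp_div_le C₁ C₂ (htri D hD x y z)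
          _ = ∫⁻ x in U, (ν W * eexp (D x y / C₁) + ∫⁻ z in W, eexp (D y z / C₂) ∂ν) ∂ν := by
              refine lintegral_congr fun x => ?_
              rw [lintegral_add_left measurable_const, setLIntegral_const, mul_comm]
          _ = _ := by
              rw [lintegral_add_right _ measurable_const, setLIntegral_const,
                lintegral_const_mul _ hmx, mul_comm (ν U)]
      rw [← setLIntegral_const S]
      calc ∫⁻ _ in S, (∫⁻ x in U, ∫⁻ z in W, eexp (D x z / (2 * (C₁ + C₂) : ℝ≥0)) ∂ν ∂ν) ∂ν
          ≤ ∫⁻ y in S, (ν W * (∫⁻ x in U, eexp (D x y / C₁) ∂ν) +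
              ν U * ∫⁻ z in W, eexp (D y z / C₂) ∂ν) ∂ν := lintegral_mono hmid
        _ = ν W * (∫⁻ y in S, ∫⁻ x in U, eexp (D x y / C₁) ∂ν ∂ν) +
              ν U * ∫⁻ y in S, ∫⁻ z in W, eexp (D y z / C₂) ∂ν ∂ν := by
            rw [lintegral_add_left (hg₁.const_mul _), lintegral_const_mul _ hg₁,
              lintegral_const_mul _ hg₂]
        _ ≤ ν W * K₁ + ν U * K₂ := by
            gcongr
            · refine (lintegral_mono_set inter_subset_left).trans ?_
              rw [lintegral_lintegral_swap (f := fun y x => eexp (D x y / C₁))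
                (hm₁.comp measurable_swap).aemeasurable]
              exact h₁ D hD
            · exact (lintegral_mono_set inter_subset_right).trans (h₂ D hD)
  have := isCompact_univ.induction_on (p := fun s : Set (X × X) => ∃ C C' : ℝ≥0, 0 < C ∧
      ∀ D ∈ 𝓓, ∫⁻ q in s, eexp (D q.1 q.2 / C) ∂ν.prod ν ≤ C') ⟨1, 0, one_pos, fun D _ => by simp⟩
    ?_ ?_ ?_
  · simpa using this
  · rintro s t hst ⟨C, C', hC, h⟩
    exact ⟨C, C', hC, fun D hD => (lintegral_mono_set hst).trans (h D hD)⟩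
  · rintro s t ⟨C₁, K₁, hC₁, h₁⟩ ⟨C₂, K₂, hC₂, h₂⟩
    refine ⟨max C₁ C₂, K₁ + K₂, lt_max_of_lt_left hC₁, fun D hD => ?_⟩
    refine (lintegral_union_le _ _ _).trans ?_
    push_cast
    refine add_le_add (le_trans (lintegral_mono fun q => eexp_mono ?_) (h₁ D hD))
      (le_trans (lintegral_mono fun q => eexp_mono ?_) (h₂ D hD))
    · exact ENNReal.div_le_div_left (le_max_left _ _) _
    · exact ENNReal.div_le_div_left (le_max_right _ _) _
  · rintro ⟨p, q⟩ -
    obtain ⟨U, hU, V, hV, C, C', hC, h⟩ := hpair p q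
    refine ⟨U ×ˢ V, mem_nhdsWithin_of_mem_nhds (prod_mem_nhds hU hV), C, C', hC, fun D hD => ?_⟩
    rw [← Measure.prod_restrict]
    exact (lintegral_prod_le _).trans (h D hD)

section Manifold

variable {n : ℕ} {M : Type*} [TopologicalSpace M] [ChartedSpace (Model n) M]
  [IsManifold 𝓘(ℂ, Model n) ω M]

lemma tendsto_distance {η : TwoForm n M} (hη : IsKahlerForm η) (p : M) :
    Tendsto (fun x => distance η x p) (𝓝 p) (𝓝 0) := by
  set e := chartAt (Model n) p
  have he : e ∈ atlas (Model n) M := chart_mem_atlas _ _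
  have hp : p ∈ e.source := mem_chart_source _ _
  obtain ⟨R, hR, hsub⟩ := nhds_basis_closedBall.mem_iff.1
    (e.open_target.mem_nhds (mem_chart_target (Model n) p))
  obtain ⟨_, _, A, hA, hup⟩ := exists_inChart_bounds hη he (isCompact_closedBall _ _) hsub
  have h1 : Tendsto (fun x => ENNReal.ofReal (√A * ‖e x - e p‖)) (𝓝 p) (𝓝 0) := by
    have : Tendsto (fun x => √A * ‖e x - e p‖) (𝓝 p) (𝓝 (√A * ‖e p - e p‖)) :=
      (((e.continuousAt hp).tendsto.sub tendsto_const_nhds).norm).const_mul _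
    rw [sub_self, norm_zero, mul_zero] at this
    simpa using ENNReal.tendsto_ofReal this
  refine tendsto_of_tendsto_of_tendsto_of_le_of_le' tendsto_const_nhds h1
    (Eventually.of_forall fun _ => zero_le) ?_
  filter_upwards [chart_preimage_ball_mem (n := n) p hR] with x hx
  have := distance_le_sqrt_mul_norm η he (convex_closedBall _ _) hsub hA.le
    (fun z hz v => (hup z hz v).2) (ball_subset_closedBall hx.2) (mem_closedBall_self hR.le)
  rwa [e.left_inv hx.1, e.left_inv hp] at this

lemma continuous_distance {η : TwoForm n M} (hη : IsKahlerForm η) :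
    Continuous fun q : M × M => distance η q.1 q.2 := by
  -- the topology of the pseudometric is coarser than that of `M`
  have key : ∀ Y : PseudoEMetricSpace M, (∀ x y, Y.edist x y = distance η x y) →
      Continuous fun q : M × M => Y.edist q.1 q.2 := by
    intro Y hY
    have hid : @Continuous M M _ Y.toUniformSpace.toTopologicalSpace id := by
      refine (@continuous_iff_continuousAt M M _ Y.toUniformSpace.toTopologicalSpace _).2 fun p => ?_
      refine (@tendsto_iff_edist_tendsto_0 M M Y _ _ _).2 ?_
      simpa [hY] using tendsto_distance hη p
    exact @Continuous.edist M (M × M) Y _ _ _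
      (@Continuous.comp (M × M) M M _ _ Y.toUniformSpace.toTopologicalSpace Prod.fst id hid
        continuous_fst)
      (@Continuous.comp (M × M) M M _ _ Y.toUniformSpace.toTopologicalSpace Prod.snd id hid
        continuous_snd)
  exact key
    { edist := distance η
      edist_self := distance_self η
      edist_comm := distance_comm η
      edist_triangle := distance_triangle η } fun _ _ => rfl

variable [MeasurableSpace M] [BorelSpace M] {ν : Measure M}

/-- Near a point, the distances defined by nonpositive potentials with an `L¹` bound are uniformly
exponentially integrable. -/
lemma exists_nhds_lintegral_eexp_distance_le [IsFiniteMeasure ν] {ω₀ : TwoForm n M}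
    (hω₀ : IsKahlerForm ω₀) (hν : LocallyLebesgue n ν) (L : ℝ≥0) (p : M) :
    ∃ W ∈ 𝓝 p, ∃ C C' : ℝ≥0, 0 < C ∧ ∀ ψ ∈ nonposPotentials ω₀,
      ∫⁻ y, ENNReal.ofReal (-ψ y) ∂ν ≤ L →
      ∫⁻ x in W, ∫⁻ y in W, eexp (distance (ω₀ + ddc ψ) x y / C) ∂ν ∂ν ≤ C' := by
  obtain ⟨U, hU, C, hC, hC'⟩ := hν p
  set e := chartAt (Model n) p
  have he : e ∈ atlas (Model n) M := chart_mem_atlas _ _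
  obtain ⟨R, hR, hsub, hin⟩ := exists_chart_ball (n := n) p hU (k := 10) (by norm_num)
  rw [show (10 : ℝ) * R = 2 * (5 * R) by ring] at hsub hin
  obtain ⟨_, _, A, hA, hup⟩ := exists_inChart_bounds hω₀ he (isCompact_closedBall _ _) hsub
  obtain ⟨q, hq⟩ := (isCompact_closedBall (e p) (5 * R)).exists_bound_of_continuousOn
    (contDiff_euclSq (n := n)).continuous.continuousOn
  set Q := A / 2 * q
  have hq0 : ∀ z ∈ closedBall (e p) (5 * R), 0 ≤ A / 2 * euclSq z ∧ A / 2 * euclSq z ≤ Q := by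
    intro z hz
    have h1 : 0 ≤ euclSq z := Finset.sum_nonneg fun _ _ => by positivity
    exact ⟨by positivity, mul_le_mul_of_nonneg_left ((le_abs_self _).trans (hq z hz))
      (by positivity)⟩
  set N : ℝ≥0∞ := ENNReal.ofReal Q * volume (closedBall (e p) (5 * R)) + C * L
  have hN : N ≠ ⊤ := ENNReal.add_ne_top.2 ⟨ENNReal.mul_ne_top ENNReal.ofReal_ne_top
    (volume_closedBall_ne_top _ _), ENNReal.mul_ne_top ENNReal.coe_ne_top ENNReal.coe_ne_top⟩
  obtain ⟨c, hc, K, hK, hexp⟩ := exists_lintegral_eexp_meanLen_le (e p) hR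
    (M := 2 * N.toReal) (by positivity)
  set B := closedBall (e p) (R / 2)
  have hB0 : volume B ≠ 0 := volume_closedBall_pos _ (by positivity)
  have hBt : volume B ≠ ⊤ := volume_closedBall_ne_top _ _
  set κ := (volume B).toNNReal
  have hκ : (κ : ℝ≥0∞) = volume B := ENNReal.coe_toNNReal hBt
  have hκ0 : 0 < κ := ENNReal.toNNReal_pos hB0 hBt
  set cc := c.toNNReal
  have hcc : 0 < cc := Real.toNNReal_pos.2 hc
  set W := e.source ∩ e ⁻¹' ball (e p) (R / 2)
  have hWo : IsOpen W := e.isOpen_inter_preimage isOpen_ball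
  have hWB : ∀ x ∈ W, e x ∈ B := fun x hx => ball_subset_closedBall hx.2
  have hBR : B ⊆ closedBall (e p) R := closedBall_subset_closedBall (by linarith)
  have hWU : W ⊆ U := fun x hx => by
    have h1 := hin (e x) (closedBall_subset_closedBall (by linarith) (hWB x hx))
    rw [e.left_inv hx.1] at h1
    exact interior_subset h1
  have hCW : ν.restrict W ≤ C • chartVol e := (Measure.restrict_mono hWU le_rfl).trans hC
  set K' : ℝ≥0∞ := C * (C * (K * volume B + volume B * K))
  have hK' : K' ≠ ⊤ := by finiteness
  refine ⟨W, chart_preimage_ball_mem p (by positivity), 2 / (cc * κ), K'.toNNReal, by positivity,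
    fun ψ hψ hL => ?_⟩
  obtain ⟨φ, hφ, hφe, hφl⟩ := exists_local_potential hψ.1 hψ.2.1 he (R := 5 * R) (by positivity)
    hA.le hsub fun z hz v => (hup z hz v).2
  have hlel : ∀ x ∈ closedBall (e p) (3 * R), lelong φ R x 1 ≤ 2 * N.toReal := by
    intro x hx
    refine lelong_le_of_lintegral_le (Q := Q) hφ (fun z hz v => (hφl z hz v).2)
      (fun z hz => ?_) ENNReal.toReal_nonneg ?_ hx
    · rw [hφe z hz]
      linarith [(hq0 z hz).2, hψ.2.2 (e.symm z)]
    · rw [ENNReal.ofReal_toReal hN]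
      have hm : Measurable fun y => ENNReal.ofReal (-ψ y) :=
        hψ.1.continuous.neg.measurable.ennreal_ofReal
      have h5 : closedBall (e p) (5 * R) ⊆ closedBall (e p) (2 * (5 * R)) :=
        closedBall_subset_closedBall (by linarith)
      calc ∫⁻ z in closedBall (e p) (5 * R), ENNReal.ofReal (Q - φ z)
          ≤ ∫⁻ z in closedBall (e p) (5 * R), (ENNReal.ofReal Q +
              ENNReal.ofReal (-ψ (e.symm z))) := by
            refine setLIntegral_mono' measurableSet_closedBall fun z hz =>
              (ENNReal.ofReal_le_ofReal ?_).trans ENNReal.ofReal_add_le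
            rw [hφe z hz]
            linarith [(hq0 z hz).1]
        _ = ENNReal.ofReal Q * volume (closedBall (e p) (5 * R)) +
              ∫⁻ z in closedBall (e p) (5 * R), ENNReal.ofReal (-ψ (e.symm z)) := by
            rw [lintegral_add_left measurable_const, setLIntegral_const]
        _ ≤ N := by
            refine add_le_add le_rfl ?_
            refine (lintegral_symm_le (h5.trans hsub) measurableSet_closedBall
              isOpen_interior.measurableSet (fun z hz => hin z (h5 hz)) hm
              ((Measure.restrict_mono interior_subset le_rfl).trans hC')).trans ?_
            gcongr
            exact (setLIntegral_le_lintegral _ _).trans hL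
  set g : Model n → ℝ≥0∞ := fun z => eexp (ENNReal.ofReal c * meanLen φ R z 0 1)
  have hg : Measurable g := measurable_eexp.comp ((measurable_meanLen hφ R 0 1).const_mul _)
  have hgB : ∫⁻ z in B, g z ≤ K := (lintegral_mono_set hBR).trans (hexp φ hφ (fun z hz v =>
    (hφl z (closedBall_subset_closedBall (by linarith) hz) v).2) hlel)
  -- the distance of two points is bounded by the mean lengths of the segments issuing from them
  have hd : ∀ x ∈ B, ∀ y ∈ B,
      eexp (distance (ω₀ + ddc ψ) (e.symm x) (e.symm y) / (2 / (cc * κ) : ℝ≥0)) ≤ g x + g y := by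
    intro x hx y hy
    refine (eexp_mono ?_).trans (eexp_half_add_le _ _)
    have hball : ∀ w ∈ B, closedBall w R ⊆ closedBall (e p) (5 * R) := fun w hw =>
      closedBall_subset_closedBall' (by rw [mem_closedBall] at hw; linarith)
    have hball' : ∀ w ∈ B, closedBall (e p) (R / 2) ⊆ closedBall w R := fun w hw =>
      closedBall_subset_closedBall' (by rw [mem_closedBall, dist_comm] at hw; linarith)
    have h1 := distance_mul_volume_le he hφ ((closedBall_subset_closedBall (by linarith)).trans hsub)
      (fun z hz v => (hφl z hz v).1) (hball x hx) (hball y hy) (hball' x hx) (hball' y hy)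
    have h2 : distance (ω₀ + ddc ψ) (e.symm x) (e.symm y) / (2 / (cc * κ) : ℝ≥0) =
        ENNReal.ofReal c * (distance (ω₀ + ddc ψ) (e.symm x) (e.symm y) * volume B) / 2 := by
      rw [← hκ, div_eq_mul_inv, ← ENNReal.coe_inv (by positivity), inv_div,
        ENNReal.coe_div two_ne_zero, ENNReal.coe_mul, ENNReal.coe_ofNat, div_eq_mul_inv, div_eq_mul_inv]
      change _ * ((ENNReal.ofReal c) * _ * _) = _
      ring
    rw [h2, ← mul_add]
    gcongr
  rw [ENNReal.coe_toNNReal hK']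
  calc ∫⁻ x in W, ∫⁻ y in W, eexp (distance (ω₀ + ddc ψ) x y / (2 / (cc * κ) : ℝ≥0)) ∂ν ∂ν
      ≤ ∫⁻ x in W, C * (g (e x) * volume B + K) ∂ν := by
        refine setLIntegral_mono' hWo.measurableSet fun x hx => ?_
        refine (lintegral_le_symm hWo.measurableSet hWB _ hCW).trans ?_
        gcongr
        calc ∫⁻ z in B, eexp (distance (ω₀ + ddc ψ) x (e.symm z) / (2 / (cc * κ) : ℝ≥0))
            ≤ ∫⁻ z in B, (g (e x) + g z) := by
              refine setLIntegral_mono' measurableSet_closedBall fun z hz => ?_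
              have := hd (e x) (hWB x hx) z hz
              rwa [e.left_inv hx.1] at this
          _ = g (e x) * volume B + ∫⁻ z in B, g z := by
              rw [lintegral_add_left measurable_const, setLIntegral_const]
          _ ≤ _ := by gcongr
    _ ≤ C * ∫⁻ z in B, C * (g (e (e.symm z)) * volume B + K) :=
        lintegral_le_symm hWo.measurableSet hWB (fun x => C * (g (e x) * volume B + K)) hCW
    _ = C * ∫⁻ z in B, C * (g z * volume B + K) := by
        congr 1
        refine setLIntegral_congr_fun measurableSet_closedBall fun z hz => ?_
        have hz' : z ∈ e.target := hsub (closedBall_subset_closedBall (by linarith) hz)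
        simp only [e.right_inv hz']
    _ = C * (C * ((∫⁻ z in B, g z) * volume B + K * volume B)) := by
        rw [lintegral_const_mul' _ _ ENNReal.coe_ne_top, lintegral_add_right _ measurable_const,
          lintegral_mul_const _ hg, setLIntegral_const]
    _ ≤ K' := by
        change _ ≤ (C : ℝ≥0∞) * (C * (K * volume B + volume B * K))
        rw [mul_comm (volume B) K]
        gcongr

/-- The distances of the Kähler metrics in a class are uniformly exponentially integrable. -/
theorem exists_lintegral_exp_distance_le [CompactSpace M] [T2Space M] [ConnectedSpace M]
    {ω₀ : TwoForm n M} (hω₀ : IsKahlerForm ω₀) :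
    ∃ C C' : ℝ≥0, 0 < C ∧ ∀ ψ : M → ℝ, ContMDiff 𝓘(ℝ, Model n) 𝓘(ℝ, ℝ) ∞ ψ →
      IsKahlerForm (ω₀ + ddc ψ) →
      ∫⁻ p : M × M, EReal.exp ((distance (ω₀ + ddc ψ) p.1 p.2 / C : ℝ≥0∞) : EReal)
        ∂((powerMeasure ω₀).prod (powerMeasure ω₀)) ≤ C' := by
  obtain ⟨ν, hfin, hν, hpow⟩ := exists_reference_measure (n := n) (M := M)
  have hν : LocallyLebesgue n ν := hν
  obtain ⟨L, hL⟩ := exists_lintegral_neg_le hω₀ hν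
  have := ChartedSpace.secondCountable_of_sigmaCompact (Model n) M
  let 𝓓 : Set (M → M → ℝ≥0∞) := {D | ∃ ψ ∈ nonposPotentials ω₀, (∃ x, ψ x = 0) ∧
    D = distance (ω₀ + ddc ψ)}
  obtain ⟨C, C', hC, h⟩ := exists_lintegral_eexp_le_of_connected (ν := ν) (𝓓 := 𝓓)
    (fun p V hV => hν.measure_ne_zero hV)
    (by rintro D ⟨ψ, hψ, -, rfl⟩; exact (continuous_distance hψ.2.1).measurable)
    (by rintro D ⟨ψ, -, -, rfl⟩ x y z; exact distance_triangle _ _ _ _)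
    (fun p => by
      obtain ⟨W, hW, C, C', hC, h⟩ := exists_nhds_lintegral_eexp_distance_le hω₀ hν L p
      refine ⟨W, hW, C, C', hC, ?_⟩
      rintro D ⟨ψ, hψ, ⟨x, hx⟩, rfl⟩
      refine h ψ hψ ?_
      simpa [hx] using hL ψ hψ x)
  obtain ⟨m, hm⟩ := hpow ω₀ hω₀
  have hfin' : IsFiniteMeasure (m • ν) := inferInstance
  have hle : (powerMeasure ω₀).prod (powerMeasure ω₀) ≤ (m • ν).prod (m • ν) :=
    Measure.prod_mono hm hm
  refine ⟨C, m * m * C', hC, fun ψ hψ hω => ?_⟩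
  obtain ⟨χ, hχ, hdd, hx⟩ := exists_normalised_potential hψ hω
  rw [← hdd]
  refine (lintegral_mono' hle le_rfl).trans ?_
  have h1 := h _ ⟨χ, hχ, hx, rfl⟩
  rw [Measure.prod_smul_left, Measure.prod_smul_right, lintegral_smul_measure,
    lintegral_smul_measure]
  simp only [ENNReal.smul_def, smul_eq_mul]
  push_cast
  rw [mul_assoc]
  gcongr
  exact h1

end Manifold

end KahlerDist

theorem mainTheorem2 {n : ℕ} {M : Type*} [TopologicalSpace M] [T2Space M] [CompactSpace M]
    [ConnectedSpace M] [MeasurableSpace M] [BorelSpace M]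
    [ChartedSpace (KahlerDist.Model n) M] [IsManifold 𝓘(ℂ, KahlerDist.Model n) ω M]
    (ω₀ : KahlerDist.TwoForm n M) (hω₀ : KahlerDist.IsKahlerForm ω₀) :
    (∀ α : ℝ, 0 < α → α ≤ 1 → ∀ K : ℝ≥0, ∃ C : ℝ≥0, ∀ ψ : M → ℝ,
      ContMDiff 𝓘(ℝ, KahlerDist.Model n) 𝓘(ℝ, ℝ) ∞ ψ →
      KahlerDist.IsKahlerForm (ω₀ + KahlerDist.ddc ψ) →
      KahlerDist.holderNorm ω₀ α ψ ≤ K →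
      ∀ x y : M, KahlerDist.distance (ω₀ + KahlerDist.ddc ψ) x y ≤
        C * KahlerDist.distance ω₀ x y ^ (α / 2)) ∧
    (∃ C C' : ℝ≥0, 0 < C ∧ ∀ ψ : M → ℝ,
      ContMDiff 𝓘(ℝ, KahlerDist.Model n) 𝓘(ℝ, ℝ) ∞ ψ →
      KahlerDist.IsKahlerForm (ω₀ + KahlerDist.ddc ψ) →
      ∫⁻ p : M × M,
          EReal.exp ((KahlerDist.distance (ω₀ + KahlerDist.ddc ψ) p.1 p.2 / C : ℝ≥0∞) : EReal)
        ∂((KahlerDist.powerMeasure ω₀).prod (KahlerDist.powerMeasure ω₀)) ≤ C') := by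
  exact ⟨fun _ hα hα1 K => KahlerDist.exists_distance_le_rpow hω₀ hα hα1 K,
    KahlerDist.exists_lintegral_exp_distance_le hω₀⟩
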